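/- **Setting.** Let $T>0$, $\mu_x,\mu_y\in\mathbb R$, $\sigma_x,\sigma_y>0$, $\rho\in[-1,1]$, and, for $k\in\{x,y,z\}$, $a_k>0$, $\alpha_k\ge 0$, $c_k^\pm\ge 0$, $\lambda^{k,\pm}\ge0$, and let $F^{k,\pm}$ be probability distributions on $[0,\infty)$ with finite fourth moment. Put $\mu_{\hat x}=\mu_{\hat z}=\mu_x$, $\mu_{\hat y}=\mu_y$, and, for exchange rates $x,y>0$, $\hat k=x$ for $k\in\{x,z\}$ and $\hat k=y$ for $k=y$. Let $\theta^{k,\pm}=\int r\,F^{k,\pm}(dr)$, $\eta^{k,\pm}=\int r^2F^{k,\pm}(dr)$, $\gamma^k=\lambda^{k,+}\theta^{k,+}-\lambda^{k,-}\theta^{k,-}$, $\delta^k=\lambda^{k,+}\eta^{k,+}+\lambda^{k,-}\eta^{k,-}$, $\psi^k=c_k^+\lambda^{k,+}\eta^{k,+}+c_k^-\lambda^{k,-}\eta^{k,-}$, $\upsilon_k=1-a_k\mu_{\hat k}/\alpha_k$, and $$h_2^k(t)=\begin{cases}\dfrac{a_k\mu_{\hat k}}{1-\upsilon_k e^{-\mu_{\hat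 k}(T-t)}},&\mu_{\hat k}\ne0,\\[2mm] \big(\alpha_k^{-1}+a_k^{-1}(T-t)\big)^{-1},&\mu_{\hat k}=0,\end{cases}$$ $$h_1^k(t)=\begin{cases}\dfrac{(1-2a_k\gamma^k)\mu_{\hat k}(t-T)+\upsilon_k(1-e^{-\mu_{\hat k}(T-t)})}{1-\upsilon_k e^{-\mu_{\hat k}(T-t)}},&\mu_{\hat k}\ne0,\\[2mm] 2\gamma^k(T-t)\big(\alpha_k^{-1}+a_k^{-1}(T-t)\big)^{-1},&\mu_{\hat k}=0\end{cases}$$ (for $\alpha_k=0$, the limits as $\alpha_k\downarrow0$), $$g^k(t)=\int_t^T e^{\mu_{\hat k}(u-t)}\Big(-\psi^k+\gamma^kh_1^k(u)+\delta^kh_2^k(u)-\tfrac1{4a_k}h_1^k(u)^2\Big)du,\qquad h_0^x=g^x+g^z,\quad h_0^y=g^y,$$ and, with $\boldsymbol q=(q^x,q^y,q^z)$, $$H_0(t,x,y,\boldsymbol q)=x(q^x+q^z)+yq^y-h_0^xx-h_0^yy-h_1^xxq^x-h_1^yyq^y-h_1^zxq^z-h_2^xx(q^x)^2-h_2^yy(q^y)^2-h_2^zx(q^z)^2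 .$$ Then $\partial_xH_0$ is a function of $(t,q^x,q^z)$ and $\partial_yH_0$ is a function of $(t,q^y)$. The first-order term $H_1(t,x,y,\boldsymbol q)$ solves, for $t\in[0,T)$, $x,y>0$, $\boldsymbol q\in\mathbb R^3$, the linear equation $$\begin{aligned}0=\partial_tH_1&+\mu_xx\,\partial_xH_1+\mu_yy\,\partial_yH_1+\tfrac12\sigma_x^2x^2\partial_{xx}H_1+\tfrac12\sigma_y^2y^2\partial_{yy}H_1+\rho\sigma_x\sigma_yxy\,\partial_{xy}H_1\\&-\sum_{k}\frac{\hat k-\partial_{q^k}H_0}{2a_k\hat k}\,\partial_{q^k}H_1+\sum_{k}\sum_{i=\pm}\lambda^{k,i}\int_{(0,\infty)}\big(H_1(t,x,y,\boldsymbol q+i\,r\,\boldsymbol 1^k)-H_1(t,x,y,\boldsymbol q)\big)F^{k,i}(dr)\\&-\tfrac12\big(\sigma_x^2x^2(\partial_xH_0)^2+2\rho\sigma_x\sigma_yxy\,\partial_xH_0\,\partial_yH_0+\sigma_y^2y^2(\partial_yH_0)^2\big)\end{aligned}\tag{E}$$ with $H_1(T,\cdot)=0$, where $\boldsymbol 1^k$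 is the $k$-th unit vector. A solution is understood in the classical sense: continuous for $t\in[0,T]$, continuously differentiable in $t$ (one-sidedly at $t=0$) and in $\boldsymbol q$ and twice continuously differentiable in $(x,y)$ for $t\in[0,T)$, with the integrals in (E) convergent. Let $O^{k,\pm}_t=\sum_{n=1}^{N^{k,\pm}_t}\xi^{k,\pm}_n$, where the $N^{k,\pm}$ are Poisson processes with intensities $\lambda^{k,\pm}$, $\xi_n^{k,\pm}\sim F^{k,\pm}$, and all the processes $N^{k,\pm}$ and all the variables $\xi^{k,\pm}_n$ are mutually independent. For $t\in[0,T]$ and $\mathfrak Q^k_t=q^k$ let $\mathfrak Q^k$ on $[t,T]$ solve $$d\mathfrak Q^k_u=\beta_k(u,\mathfrak Q^k_u)\,du-dO^{k,-}_u+dO^{k,+}_u,\qquad \beta_k(u,q)=-\tfrac1{2a_k}\big(h_1^k(u)+2h_2^k(u)q\big),$$ and write $\mathbb E_{t,\cdot}$ for expectations given these starting values. **Proposition.** For $t\in[0,T]$ and $q^x,q^y,q^z\in\mathbb R$ put $$\begin{aligned}H_{11}(t,q^x,q^z)&=-\int_t^Te^{(2\mu_x+\sigma_x^2)(u-t)}\,\tfrac12\sigma_x^2\;\mathbb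 E_{t,q^x,q^z}\big[(\partial_xH_0(u,\mathfrak Q^x_u,\mathfrak Q^z_u))^2\big]du,\\ H_{12}(t,q^y)&=-\int_t^Te^{(2\mu_y+\sigma_y^2)(u-t)}\,\tfrac12\sigma_y^2\;\mathbb E_{t,q^y}\big[(\partial_yH_0(u,\mathfrak Q^y_u))^2\big]du,\\ H_{13}(t,\boldsymbol q)&=-\int_t^Te^{(\mu_x+\mu_y+\rho\sigma_x\sigma_y)(u-t)}\,\rho\sigma_x\sigma_y\;\mathbb E_{t,\boldsymbol q}\big[\partial_xH_0(u,\mathfrak Q^x_u,\mathfrak Q^z_u)\,\partial_yH_0(u,\mathfrak Q^y_u)\big]du.\end{aligned}$$ 1. All these expectations and time integrals are finite. 2. $H_1=H_{11}(t,q^x,q^z)\,x^2+H_{12}(t,q^y)\,y^2+H_{13}(t,\boldsymbol q)\,xy$ is a classical solution of (E) with $H_1(T,\cdot)=0$, and its coefficients grow at most like the fourth power of the inventories, uniformly in $t\in[0,T]$. 3. Conversely, if functions $\tilde H_{11}(t,q^x,q^z)$, $\tilde H_{12}(t,q^y)$, $\tilde H_{13}(t,\boldsymbol q)$ make $\tilde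 H_{11}x^2+\tilde H_{12}y^2+\tilde H_{13}xy$ a classical solution of (E) with terminal value $0$, and have, uniformly in $t\in[0,T]$, polynomial growth of some integer degree $p\ge4$ in the inventories for which all $F^{k,\pm}$ have finite $p$-th moment, then they are given on $[0,T]$ by the formulas above. -/

import Mathlib

open MeasureTheory ProbabilityTheory Set
open scoped NNReal Matrix

noncomputable section

namespace FX

/-- The three currency pairs of the triplet. -/
inductive Pair
  | x | y | z
  deriving DecidableEq

instance : Fintype Pair where
  elems := {.x, .y, .z}
  complete k := by cases k <;> simp

/-- The two sides of the clients' order flow: market sells (superscript `+`), which raise the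
broker's inventory, and market buys (superscript `-`), which lower it. -/
inductive Side
  | sell | buy
  deriving DecidableEq

instance : Fintype Side where
  elems := {.sell, .buy}
  complete s := by cases s <;> simp

/-- The sign of the effect of a client order on the broker's inventory. -/
def Side.sgn : Side → ℝ
  | .sell => 1
  | .buy => -1

/-- The constants of the model: the horizon, the drifts, volatilities and correlation of the
mid-exchange rates, the temporary impacts `a`, the terminal penalties `α`, the service fees `c`,
the intensities `lam` and the volume distributions `F` of the clients' orders. -/
structure Model where
  T : ℝ
  μx : ℝ
  μy : ℝ
  σx : ℝ
  σy : ℝ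
  ρ : ℝ
  a : Pair → ℝ
  α : Pair → ℝ
  c : Pair → Side → ℝ
  lam : Pair → Side → ℝ≥0
  F : Pair → Side → Measure ℝ
  T_pos : 0 < T
  σx_pos : 0 < σx
  σy_pos : 0 < σy
  ρ_mem : ρ ∈ Icc (-1 : ℝ) 1
  a_pos : ∀ k, 0 < a k
  α_nonneg : ∀ k, 0 ≤ α k
  c_nonneg : ∀ k s, 0 ≤ c k s
  F_prob : ∀ k s, IsProbabilityMeasure (F k s)
  F_supp : ∀ k s, F k s (Iio 0) = 0

namespace Model

variable (m : Model)

/-- The drift of the mid-exchange rate in which trades in the pair `k` are marked to market. -/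
def muHat : Pair → ℝ
  | .x => m.μx
  | .y => m.μy
  | .z => m.μx

/-- First moment of the order volumes. -/
def theta (k : Pair) (s : Side) : ℝ := ∫ r in Ioi 0, r ∂(m.F k s)

/-- Second moment of the order volumes. -/
def eta (k : Pair) (s : Side) : ℝ := ∫ r in Ioi 0, r ^ 2 ∂(m.F k s)

def gamma (k : Pair) : ℝ :=
  m.lam k .sell * m.theta k .sell - m.lam k .buy * m.theta k .buy

def delta (k : Pair) : ℝ :=
  m.lam k .sell * m.eta k .sell + m.lam k .buy * m.eta k .buy

def psi (k : Pair) : ℝ :=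
  m.c k .buy * m.lam k .buy * m.eta k .buy + m.c k .sell * m.lam k .sell * m.eta k .sell

/-- The function `h₂ᵏ`, which solves `-h₂' + h₂² / a - μ̂ h₂ = 0`, `h₂(T) = α`.  With
`υ = 1 - a μ̂ / α` it is `a μ̂ / (1 - υ e^{-μ̂ (T-t)})` if `μ̂ ≠ 0`, and
`(α⁻¹ + a⁻¹ (T-t))⁻¹` if `μ̂ = 0`; the fractions are written with numerator and denominator
multiplied by `α` (and by `a`, for `μ̂ = 0`), so that they are also right for `α = 0`. -/
def h2 (k : Pair) (t : ℝ) : ℝ :=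
  if m.muHat k = 0 then m.α k * m.a k / (m.a k + m.α k * (m.T - t))
  else m.α k * (m.a k * m.muHat k) /
    (m.α k - (m.α k - m.a k * m.muHat k) * Real.exp (-m.muHat k * (m.T - t)))

/-- The function `h₁ᵏ`, which solves `-h₁' + μ̂ (1 - h₁) + h₂ h₁ / a - 2 γ h₂ = 0`, `h₁(T) = 0`.
It is `(1 - υ e^{-μ̂ (T-t)})⁻¹ ((1 - 2 a γ) μ̂ (t - T) + υ (1 - e^{-μ̂ (T-t)}))` if `μ̂ ≠ 0`, and
`2 γ (T-t) (α⁻¹ + a⁻¹ (T-t))⁻¹` if `μ̂ = 0`, written as in `h2`. -/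
def h1 (k : Pair) (t : ℝ) : ℝ :=
  if m.muHat k = 0 then
    2 * m.gamma k * (m.T - t) * (m.α k * m.a k / (m.a k + m.α k * (m.T - t)))
  else (m.α k * ((1 - 2 * m.a k * m.gamma k) * m.muHat k * (t - m.T)) +
      (m.α k - m.a k * m.muHat k) * (1 - Real.exp (-m.muHat k * (m.T - t)))) /
    (m.α k - (m.α k - m.a k * m.muHat k) * Real.exp (-m.muHat k * (m.T - t)))

/-- The contribution of the pair `k` to the functions `h₀`. -/
def h0part (k : Pair) (t : ℝ) : ℝ :=
  (-∫ u in t..m.T, Real.exp (m.muHat k * (u - t)) * m.psi k) +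
  (∫ u in t..m.T, Real.exp (m.muHat k * (u - t)) * (m.gamma k * m.h1 k u)) +
  (∫ u in t..m.T, Real.exp (m.muHat k * (u - t)) * (m.delta k * m.h2 k u)) -
  ∫ u in t..m.T, Real.exp (m.muHat k * (u - t)) * (1 / (4 * m.a k) * (m.h1 k u) ^ 2)

def h0x (t : ℝ) : ℝ := m.h0part .x t + m.h0part .z t

def h0y (t : ℝ) : ℝ := m.h0part .y t

/-- The value function, net of cash, of the ambiguity neutral broker. -/
def H0 (t x y : ℝ) (q : Pair → ℝ) : ℝ :=
  x * (q .x + q .z) + y * q .y - m.h0x t * x - m.h0y t * y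
    - m.h1 .x t * x * q .x - m.h1 .y t * y * q .y - m.h1 .z t * x * q .z
    - m.h2 .x t * x * q .x ^ 2 - m.h2 .y t * y * q .y ^ 2 - m.h2 .z t * x * q .z ^ 2

/-- `∂ₓ H₀`, which depends on `(t, qˣ, qᶻ)` only; see `hasDerivAt_H0_x`. -/
def dxH0 (t qx qz : ℝ) : ℝ :=
  (qx + qz) - m.h0x t - m.h1 .x t * qx - m.h1 .z t * qz - m.h2 .x t * qx ^ 2 - m.h2 .z t * qz ^ 2

/-- `∂_y H₀`, which depends on `(t, qʸ)` only; see `hasDerivAt_H0_y`. -/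
def dyH0 (t qy : ℝ) : ℝ :=
  qy - m.h0y t - m.h1 .y t * qy - m.h2 .y t * qy ^ 2

theorem hasDerivAt_H0_x (t x y : ℝ) (q : Pair → ℝ) :
    HasDerivAt (fun x' => m.H0 t x' y q) (m.dxH0 t (q .x) (q .z)) x := by
  have e : (fun x' => m.H0 t x' y q) =
      fun x' => x' * m.dxH0 t (q .x) (q .z) + y * m.dyH0 t (q .y) := by
    funext x'
    simp only [H0, dxH0, dyH0]
    ring
  rw [e]
  simpa using ((hasDerivAt_id x).mul_const (m.dxH0 t (q .x) (q .z))).add_const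
    (y * m.dyH0 t (q .y))

theorem hasDerivAt_H0_y (t x y : ℝ) (q : Pair → ℝ) :
    HasDerivAt (fun y' => m.H0 t x y' q) (m.dyH0 t (q .y)) y := by
  have e : (fun y' => m.H0 t x y' q) =
      fun y' => x * m.dxH0 t (q .x) (q .z) + y' * m.dyH0 t (q .y) := by
    funext y'
    simp only [H0, dxH0, dyH0]
    ring
  rw [e]
  simpa using ((hasDerivAt_id y).mul_const (m.dyH0 t (q .y))).const_add
    (x * m.dxH0 t (q .x) (q .z))

/-- The drift of the auxiliary inventory process of the pair `k`. -/
def beta (k : Pair) (t q : ℝ) : ℝ := -(1 / (2 * m.a k)) * (m.h1 k t + 2 * m.h2 k t * q)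

end Model

/-! ### Partial derivatives of functions of `(t, x, y, q)` -/

/-- Time derivative on `[0, T]` (one-sided at the end points). -/
def dT (T : ℝ) (H : ℝ → ℝ → ℝ → (Pair → ℝ) → ℝ) (t x y : ℝ) (q : Pair → ℝ) : ℝ :=
  derivWithin (fun s => H s x y q) (Icc 0 T) t

def dX (H : ℝ → ℝ → ℝ → (Pair → ℝ) → ℝ) (t x y : ℝ) (q : Pair → ℝ) : ℝ :=
  deriv (fun x' => H t x' y q) x

def dY (H : ℝ → ℝ → ℝ → (Pair → ℝ) → ℝ) (t x y : ℝ) (q : Pair → ℝ) : ℝ :=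
  deriv (fun y' => H t x y' q) y

def dQ (k : Pair) (H : ℝ → ℝ → ℝ → (Pair → ℝ) → ℝ) (t x y : ℝ) (q : Pair → ℝ) : ℝ :=
  deriv (fun v => H t x y (Function.update q k v)) (q k)

/-- A function of `(t, x, y, q)`, as a function on the product space. -/
def onProd (H : ℝ → ℝ → ℝ → (Pair → ℝ) → ℝ) (w : ℝ × ℝ × ℝ × (Pair → ℝ)) : ℝ :=
  H w.1 w.2.1 w.2.2.1 w.2.2.2

/-- The state space, with times in `I` and positive exchange rates. -/
def dom (I : Set ℝ) : Set (ℝ × ℝ × ℝ × (Pair → ℝ)) :=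
  I ×ˢ (Ioi 0 ×ˢ (Ioi 0 ×ˢ univ))

/-- Classical regularity: continuous on `[0, T]`, and on `[0, T)` continuously differentiable in
`t` and `q` and twice continuously differentiable in `(x, y)`. -/
structure IsRegular (T : ℝ) (H : ℝ → ℝ → ℝ → (Pair → ℝ) → ℝ) : Prop where
  cont : ContinuousOn (onProd H) (dom (Icc 0 T))
  diff_t : ∀ t ∈ Ico 0 T, ∀ x > 0, ∀ y > 0, ∀ q,
    DifferentiableWithinAt ℝ (fun s => H s x y q) (Icc 0 T) t
  diff_x : ∀ t ∈ Ico 0 T, ∀ x > 0, ∀ y > 0, ∀ q, DifferentiableAt ℝ (fun x' => H t x' y q) x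
  diff_y : ∀ t ∈ Ico 0 T, ∀ x > 0, ∀ y > 0, ∀ q, DifferentiableAt ℝ (fun y' => H t x y' q) y
  diff_xx : ∀ t ∈ Ico 0 T, ∀ x > 0, ∀ y > 0, ∀ q, DifferentiableAt ℝ (fun x' => dX H t x' y q) x
  diff_yy : ∀ t ∈ Ico 0 T, ∀ x > 0, ∀ y > 0, ∀ q, DifferentiableAt ℝ (fun y' => dY H t x y' q) y
  diff_xy : ∀ t ∈ Ico 0 T, ∀ x > 0, ∀ y > 0, ∀ q, DifferentiableAt ℝ (fun x' => dY H t x' y q) x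
  diff_q : ∀ k, ∀ t ∈ Ico 0 T, ∀ x > 0, ∀ y > 0, ∀ q : Pair → ℝ,
    DifferentiableAt ℝ (fun v => H t x y (Function.update q k v)) (q k)
  cont_t : ContinuousOn (onProd (dT T H)) (dom (Ico 0 T))
  cont_x : ContinuousOn (onProd (dX H)) (dom (Ico 0 T))
  cont_y : ContinuousOn (onProd (dY H)) (dom (Ico 0 T))
  cont_xx : ContinuousOn (onProd (dX (dX H))) (dom (Ico 0 T))
  cont_yy : ContinuousOn (onProd (dY (dY H))) (dom (Ico 0 T))
  cont_xy : ContinuousOn (onProd (dX (dY H))) (dom (Ico 0 T))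
  cont_q : ∀ k, ContinuousOn (onProd (dQ k H)) (dom (Ico 0 T))

/-! ### The linear equation for the first-order term `H₁` -/

namespace Model

variable (m : Model)

/-- The generator of the mid-exchange rates. -/
def genP (H : ℝ → ℝ → ℝ → (Pair → ℝ) → ℝ) (t x y : ℝ) (q : Pair → ℝ) : ℝ :=
  m.μx * x * dX H t x y q + m.μy * y * dY H t x y q
    + 1 / 2 * m.σx ^ 2 * x ^ 2 * dX (dX H) t x y q
    + 1 / 2 * m.σy ^ 2 * y ^ 2 * dY (dY H) t x y q
    + m.ρ * m.σx * m.σy * x * y * dX (dY H) t x y q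

/-- The vector `𝒟H = (σₓ x ∂ₓH, σ_y y ∂_yH)`. -/
def gradP (H : ℝ → ℝ → ℝ → (Pair → ℝ) → ℝ) (t x y : ℝ) (q : Pair → ℝ) : Fin 2 → ℝ :=
  ![m.σx * x * dX H t x y q, m.σy * y * dY H t x y q]

/-- The correlation matrix of the mid-exchange rates. -/
def corr : Matrix (Fin 2) (Fin 2) ℝ := !![1, m.ρ; m.ρ, 1]

/-- The rate in which trades in the pair `k` are marked to market. -/
def rateHat (k : Pair) (x y : ℝ) : ℝ :=
  match k with
  | .x => x
  | .y => y
  | .z => x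

/-- Inventory after a client order of volume `r` on side `s` in the pair `k`. -/
def afterOrder (q : Pair → ℝ) (k : Pair) (s : Side) (r : ℝ) : Pair → ℝ :=
  Function.update q k (q k + s.sgn * r)

/-- Change of a function that does not depend on the cash position, when a client order arrives. -/
def jump (H : ℝ → ℝ → ℝ → (Pair → ℝ) → ℝ) (k : Pair) (s : Side) (t x y : ℝ) (q : Pair → ℝ)
    (r : ℝ) : ℝ :=
  H t x y (afterOrder q k s r) - H t x y q

/-- The right-hand side of the linear partial integro-differential equation for `H₁`. -/
def pideRHS (H : ℝ → ℝ → ℝ → (Pair → ℝ) → ℝ) (t x y : ℝ) (q : Pair → ℝ) : ℝ :=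
  dT m.T H t x y q + m.genP H t x y q
    - ∑ k : Pair, (rateHat k x y - dQ k m.H0 t x y q) / (2 * m.a k * rateHat k x y) *
        dQ k H t x y q
    + ∑ k : Pair, ∑ s : Side, m.lam k s * ∫ r in Ioi 0, jump H k s t x y q r ∂(m.F k s)
    - 1 / 2 * (m.gradP m.H0 t x y q ⬝ᵥ (m.corr *ᵥ m.gradP m.H0 t x y q))

/-- Classical solutions of the equation for `H₁`, with terminal value zero. -/
structure IsSolutionH1 (H : ℝ → ℝ → ℝ → (Pair → ℝ) → ℝ) : Prop where
  regular : IsRegular m.T H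
  integrable : ∀ k s, ∀ t ∈ Ico 0 m.T, ∀ x > 0, ∀ y > 0, ∀ q,
    IntegrableOn (jump H k s t x y q) (Ioi 0) (m.F k s)
  pide : ∀ t ∈ Ico 0 m.T, ∀ x > 0, ∀ y > 0, ∀ q, m.pideRHS H t x y q = 0
  terminal : ∀ x > 0, ∀ y > 0, ∀ q, H m.T x y q = 0

/-- The ansatz `H₁ = H₁₁ x² + H₁₂ y² + H₁₃ x y`. -/
def ansatz (H11 : ℝ → ℝ → ℝ → ℝ) (H12 : ℝ → ℝ → ℝ) (H13 : ℝ → ℝ → ℝ → ℝ → ℝ)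
    (t x y : ℝ) (q : Pair → ℝ) : ℝ :=
  H11 t (q .x) (q .z) * x ^ 2 + H12 t (q .y) * y ^ 2 + H13 t (q .x) (q .y) (q .z) * (x * y)

/-- Polynomial growth of degree `p` in the inventories, uniformly on `[0, T]`. -/
def HasGrowth (p : ℕ) (H11 : ℝ → ℝ → ℝ → ℝ) (H12 : ℝ → ℝ → ℝ) (H13 : ℝ → ℝ → ℝ → ℝ → ℝ) : Prop :=
  ∃ C : ℝ, ∀ t ∈ Icc 0 m.T, ∀ qx qy qz : ℝ,
    |H11 t qx qz| ≤ C * (1 + |qx| + |qz|) ^ p ∧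
    |H12 t qy| ≤ C * (1 + |qy|) ^ p ∧
    |H13 t qx qy qz| ≤ C * (1 + |qx| + |qy| + |qz|) ^ p

end Model

/-! ### Client orders and the auxiliary inventory processes -/

section Probability

variable {Ω : Type*} [MeasurableSpace Ω]

/-- `N` is a Poisson process with intensity `l`. -/
structure IsPoissonProcess (P : Measure Ω) (l : ℝ≥0) (N : ℝ≥0 → Ω → ℕ) : Prop where
  measurable : ∀ t, Measurable (N t)
  zero : ∀ᵐ ω ∂P, N 0 ω = 0
  mono : ∀ᵐ ω ∂P, Monotone fun t => N t ω
  rightCont : ∀ᵐ ω ∂P, ∀ t, ContinuousWithinAt (fun s => N s ω) (Ici t) t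
  law : ∀ s t, s ≤ t → HasLaw (fun ω => N t ω - N s ω) (poissonMeasure (l * (t - s))) P
  indep : HasIndepIncrements N P

/-- The counting processes `N` and the order volumes `ξ` (the volume of the order number `n + 1`
is `ξ k s n`) of the clients' order flow: Poisson processes with the intensities of the model,
volumes with the distributions of the model, and all of them mutually independent. -/
structure IsOrderFlow (m : Model) (P : Measure Ω) (N : Pair → Side → ℝ≥0 → Ω → ℕ)
    (ξ : Pair → Side → ℕ → Ω → ℝ) : Prop where
  poisson : ∀ k s, IsPoissonProcess P (m.lam k s) (N k s)
  measurable : ∀ k s n, Measurable (ξ k s n)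
  law : ∀ k s n, HasLaw (ξ k s n) (m.F k s) P
  indep : iIndep
    (Sum.elim
      (fun j : Pair × Side =>
        ⨆ t : ℝ≥0, MeasurableSpace.comap (N j.1 j.2 t) inferInstance)
      (fun j : Pair × Side × ℕ =>
        MeasurableSpace.comap (ξ j.1 j.2.1 j.2.2) inferInstance)) P

/-- Cumulative volume up to time `t ≥ 0` of a compound Poisson order flow. -/
def cumVolume (N : ℝ≥0 → Ω → ℕ) (ξ : ℕ → Ω → ℝ) (t : ℝ) (ω : Ω) : ℝ :=
  ∑ n ∈ Finset.range (N t.toNNReal ω), ξ n ω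

/-- `Q` is an auxiliary inventory process of the pair `k` on `[t, T]` that starts from `q` at
time `t`: it solves `dQ = β_k(u, Q) du - ∫ r J^{k,-}(dr, du) + ∫ r J^{k,+}(dr, du)`, `Q_t = q`,
where `J^{k,±}` is the jump measure of the cumulative order volume, so that its integral over
`(t, u]` is the increment of that volume. -/
structure IsAuxInventory (m : Model) (P : Measure Ω) (N : Pair → Side → ℝ≥0 → Ω → ℕ)
    (ξ : Pair → Side → ℕ → Ω → ℝ) (k : Pair) (t q : ℝ) (Q : ℝ → Ω → ℝ) : Prop where
  measurable : ∀ u ∈ Icc t m.T, Measurable (Q u)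
  integrable : ∀ᵐ ω ∂P, IntervalIntegrable (fun s => m.beta k s (Q s ω)) volume t m.T
  sde : ∀ᵐ ω ∂P, ∀ u ∈ Icc t m.T,
    Q u ω = q + (∫ s in t..u, m.beta k s (Q s ω))
      - (cumVolume (N k .buy) (ξ k .buy) u ω - cumVolume (N k .buy) (ξ k .buy) t ω)
      + (cumVolume (N k .sell) (ξ k .sell) u ω - cumVolume (N k .sell) (ξ k .sell) t ω)

namespace Model

variable (m : Model) (P : Measure Ω) (Q : Pair → ℝ → ℝ → ℝ → Ω → ℝ)

/-! In what follows `Q k t q u` is the value at time `u` of the auxiliary inventory process of the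
pair `k` that starts from `q` at time `t`. -/

/-- Expectation in the representation of `H₁₁`. -/
def expXX (t qx qz u : ℝ) : ℝ :=
  ∫ ω, (m.dxH0 u (Q .x t qx u ω) (Q .z t qz u ω)) ^ 2 ∂P

/-- Expectation in the representation of `H₁₂`. -/
def expYY (t qy u : ℝ) : ℝ :=
  ∫ ω, (m.dyH0 u (Q .y t qy u ω)) ^ 2 ∂P

/-- Expectation in the representation of `H₁₃`. -/
def expXY (t qx qy qz u : ℝ) : ℝ :=
  ∫ ω, m.dxH0 u (Q .x t qx u ω) (Q .z t qz u ω) * m.dyH0 u (Q .y t qy u ω) ∂P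

def repH11 (t qx qz : ℝ) : ℝ :=
  -∫ u in t..m.T, Real.exp ((2 * m.μx + m.σx ^ 2) * (u - t)) * (1 / 2 * m.σx ^ 2) *
    m.expXX P Q t qx qz u

def repH12 (t qy : ℝ) : ℝ :=
  -∫ u in t..m.T, Real.exp ((2 * m.μy + m.σy ^ 2) * (u - t)) * (1 / 2 * m.σy ^ 2) *
    m.expYY P Q t qy u

def repH13 (t qx qy qz : ℝ) : ℝ :=
  -∫ u in t..m.T, Real.exp ((m.μx + m.μy + m.ρ * m.σx * m.σy) * (u - t)) *
    (m.ρ * m.σx * m.σy) * m.expXY P Q t qx qy qz u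

end Model

end Probability

end FX

end

/-! The drift of each auxiliary inventory is affine in the inventory. With the integrating factor
`wt` (the exponential of the integral of `h2 / a`), the process `wt * Q - shift` is therefore its
starting value plus `noise`, a difference of two integrals of `wt` against independent compound
Poisson processes (`IsAuxInventory.ae_eq`). The `r`-th cumulant of this noise over `(t, u]` is `kap
r u - kap r t`, where `kap` integrates `wt ^ r` against the intensities and `r`-th moments of the
orders (`hasCumulants_noise`).

Let `bell n x κ` be the `n`-th moment of `x` plus a variable with cumulants `κ`. The Appell-type
polynomial `app n`, which is `bell n` at the driftless coordinate with the negated cumulants `-kap`,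
is then a martingale along the inventory, and it solves the homogeneous backward equation by pure
algebra (`backward_app`). Products over two different pairs inherit both properties, by independence
and because one order moves only one inventory (`isBasis_app2`).

The derivatives of `H0` in the exchange rates are sums of quadratic polynomials in single
inventories. The three sources are thus combinations, with continuous time coefficients `d i`, of
such products `B i` of degree at most four; this is why fourth moments suffice. Consequently the
expectation of a source at time `u`, started from `(t, q)`, is the sum of `d i u * B i t q`. It is
finite and continuous in `u`. The representation is the sum of `τ i t * B i t q`, where `τ i` solves
a scalar linear ODE with `τ i T = 0`, so the product rule shows that it is a classical solution
(`IsSource.isCoeff`). No Itô formula and no differentiation under the expectation is needed.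

On quadratic functions of the exchange rates the equation (E) separates into three equations for the
coefficients of `x ^ 2`, `y ^ 2` and `x * y`, each with the generator of the auxiliary inventories
(`pideRHS_quad`). This turns the coefficient solutions into a solution of (E) and conversely.

Uniqueness is analytic. A difference of two solutions of the same coefficient equation solves the
homogeneous one. Along the characteristics of the drift this is an ODE whose right-hand side
consists of the jump operator and a zeroth-order term, both bounded on functions of growth `p` when
`p`-th moments are finite. In an exponentially weighted norm each application of the equation halves
the bound, so the difference vanishes (`eq_zero_of_backward`). -/

noncomputable section

namespace FX

/-! ### Moments and cumulants up to order four -/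

/-- The `n`-th moment (`n ≤ 4`) of `x + X`, where `X` has cumulants `κ 1, …, κ 4`. -/
def bell (n : ℕ) (x : ℝ) (κ : ℕ → ℝ) : ℝ :=
  match n with
  | 0 => 1
  | 1 => x + κ 1
  | 2 => (x + κ 1) ^ 2 + κ 2
  | 3 => (x + κ 1) ^ 3 + 3 * κ 2 * (x + κ 1) + κ 3
  | 4 => (x + κ 1) ^ 4 + 6 * κ 2 * (x + κ 1) ^ 2 + 4 * κ 3 * (x + κ 1) + κ 4 + 3 * κ 2 ^ 2
  | _ => 0

variable {Ω : Type*} [MeasurableSpace Ω] {P : Measure Ω}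

/-- `X` has a finite fourth moment, and its first four cumulants are `κ 1, …, κ 4`. -/
structure HasCumulants (X : Ω → ℝ) (P : Measure Ω) (κ : ℕ → ℝ) : Prop where
  aemeas : AEMeasurable X P
  int4 : Integrable (fun ω => X ω ^ 4) P
  moment : ∀ n ≤ 4, ∫ ω, X ω ^ n ∂P = bell n 0 κ

theorem integrable_pow_of_le [IsFiniteMeasure P] {X : Ω → ℝ} {p n : ℕ} (hX : AEMeasurable X P)
    (h : Integrable (fun ω => X ω ^ p) P) (hn : n ≤ p) : Integrable (fun ω => X ω ^ n) P := by
  refine ((integrable_const (1 : ℝ)).add h.norm).mono' (hX.pow_const n).aestronglyMeasurable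
    (Filter.Eventually.of_forall fun ω => ?_)
  simp only [norm_pow, Pi.add_apply, Real.norm_eq_abs]
  rcases le_total |X ω| 1 with h1 | h1
  · linarith [pow_le_one₀ (n := n) (abs_nonneg (X ω)) h1, pow_nonneg (abs_nonneg (X ω)) p]
  · linarith [pow_le_pow_right₀ h1 hn]

namespace HasCumulants

variable {X Y : Ω → ℝ} {κ κ' : ℕ → ℝ}

theorem integrable_pow [IsFiniteMeasure P] (h : HasCumulants X P κ) {n : ℕ} (hn : n ≤ 4) :
    Integrable (fun ω => X ω ^ n) P := integrable_pow_of_le h.aemeas h.int4 hn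

theorem congr (h : HasCumulants X P κ) (e : X =ᵐ[P] Y) : HasCumulants Y P κ where
  aemeas := h.aemeas.congr e
  int4 := h.int4.congr (e.mono fun ω hω => by simp only [hω])
  moment n hn := by
    rw [← h.moment n hn]
    exact integral_congr_ae (e.mono fun ω hω => by simp only [hω])

/-- `bell n` at `x = 0` is homogeneous of degree `n` when `κ r` is given weight `r`. -/
theorem const_mul (h : HasCumulants X P κ) (a : ℝ) :
    HasCumulants (fun ω => a * X ω) P (fun r => a ^ r * κ r) where
  aemeas := h.aemeas.const_mul a
  int4 := by
    simp only [mul_pow]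
    exact h.int4.const_mul _
  moment n hn := by
    simp only [mul_pow, integral_const_mul, h.moment n hn]
    interval_cases n <;> simp only [bell] <;> ring

theorem zero [IsProbabilityMeasure P] : HasCumulants (fun _ : Ω => (0 : ℝ)) P (fun _ => 0) where
  aemeas := aemeasurable_const
  int4 := by simp
  moment n hn := by
    interval_cases n <;> simp [bell]

/-- Expectation of a polynomial of degree four. -/
theorem integral_poly [IsProbabilityMeasure P] (h : HasCumulants X P κ) (c0 c1 c2 c3 c4 : ℝ) :
    Integrable (fun ω => c0 + c1 * X ω + c2 * X ω ^ 2 + c3 * X ω ^ 3 + c4 * X ω ^ 4) P ∧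
    ∫ ω, (c0 + c1 * X ω + c2 * X ω ^ 2 + c3 * X ω ^ 3 + c4 * X ω ^ 4) ∂P =
      c0 + c1 * bell 1 0 κ + c2 * bell 2 0 κ + c3 * bell 3 0 κ + c4 * bell 4 0 κ := by
  have i0 : Integrable (fun _ : Ω => c0) P := integrable_const _
  have i1 : Integrable (fun ω => c1 * X ω) P := by
    simpa using (h.integrable_pow (n := 1) (by norm_num)).const_mul c1
  have i2 := (h.integrable_pow (n := 2) (by norm_num)).const_mul c2
  have i3 := (h.integrable_pow (n := 3) (by norm_num)).const_mul c3
  have i4 := (h.integrable_pow (n := 4) (by norm_num)).const_mul c4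
  have i01 : Integrable (fun ω => c0 + c1 * X ω) P := i0.add i1
  have i02 : Integrable (fun ω => c0 + c1 * X ω + c2 * X ω ^ 2) P := i01.add i2
  have i03 : Integrable (fun ω => c0 + c1 * X ω + c2 * X ω ^ 2 + c3 * X ω ^ 3) P := i02.add i3
  refine ⟨i03.add i4, ?_⟩
  rw [integral_add i03 i4, integral_add i02 i3,
    integral_add i01 i2, integral_add i0 i1, integral_const_mul, integral_const_mul,
    integral_const_mul, integral_const_mul, h.moment 2 (by norm_num), h.moment 3 (by norm_num),
    h.moment 4 (by norm_num)]
  have := h.moment 1 (by norm_num)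
  simp only [pow_one] at this
  simp [this]

theorem integral_pow_mul_pow [IsFiniteMeasure P] (hX : HasCumulants X P κ)
    (hY : HasCumulants Y P κ') (hXY : IndepFun X Y P) {i j : ℕ} (hi : i ≤ 4) (hj : j ≤ 4) :
    Integrable (fun ω => X ω ^ i * Y ω ^ j) P ∧
    ∫ ω, X ω ^ i * Y ω ^ j ∂P = bell i 0 κ * bell j 0 κ' := by
  have hind : IndepFun (fun ω => X ω ^ i) (fun ω => Y ω ^ j) P :=
    hXY.comp (measurable_id.pow_const i) (measurable_id.pow_const j)
  refine ⟨hind.integrable_mul (hX.integrable_pow hi) (hY.integrable_pow hj), ?_⟩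
  rw [← hX.moment i hi, ← hY.moment j hj]
  exact hind.integral_fun_mul_eq_mul_integral (hX.integrable_pow hi).aestronglyMeasurable
    (hY.integrable_pow hj).aestronglyMeasurable

/-- Moments of the sum factor through the binomial theorem and independence. What remains is that
`bell` is of binomial type, a polynomial identity for each `n ≤ 4`. -/
theorem add [IsFiniteMeasure P] (hX : HasCumulants X P κ) (hY : HasCumulants Y P κ')
    (hXY : IndepFun X Y P) : HasCumulants (fun ω => X ω + Y ω) P (fun r => κ r + κ' r) := by
  have key : ∀ n ≤ 4, Integrable (fun ω => (X ω + Y ω) ^ n) P ∧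
      ∫ ω, (X ω + Y ω) ^ n ∂P = bell n 0 (fun r => κ r + κ' r) := by
    intro n hn
    have hi : ∀ m ∈ Finset.range (n + 1),
        Integrable (fun ω => X ω ^ m * Y ω ^ (n - m) * (n.choose m : ℝ)) P := fun m hm =>
      (hX.integral_pow_mul_pow hY hXY (by grind) (by grind)).1.mul_const _
    simp only [add_pow]
    refine ⟨integrable_finsetSum _ hi, ?_⟩
    rw [integral_finsetSum _ hi]
    have e : ∀ m ∈ Finset.range (n + 1), ∫ ω, X ω ^ m * Y ω ^ (n - m) * (n.choose m : ℝ) ∂P =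
        bell m 0 κ * bell (n - m) 0 κ' * (n.choose m : ℝ) := fun m hm => by
      rw [integral_mul_const, (hX.integral_pow_mul_pow hY hXY (by grind) (by grind)).2]
    rw [Finset.sum_congr rfl e]
    interval_cases n <;> simp [Finset.sum_range_succ, bell, Nat.choose] <;> ring
  exact ⟨hX.aemeas.add hY.aemeas, (key 4 le_rfl).1, fun n hn => (key n hn).2⟩

/-- Dominated convergence gives the limits of the moments, and `bell` is continuous in the
cumulants. It carries cumulants from Riemann sums to stochastic integrals. -/
theorem of_tendsto [IsFiniteMeasure P] {Xn : ℕ → Ω → ℝ} {κn : ℕ → ℕ → ℝ} {V : Ω → ℝ}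
    (h : ∀ n, HasCumulants (Xn n) P (κn n)) (hV : Integrable (fun ω => V ω ^ 4) P)
    (hVm : AEMeasurable V P)
    (hb : ∀ n, ∀ᵐ ω ∂P, |Xn n ω| ≤ V ω)
    (hlim : ∀ᵐ ω ∂P, Filter.Tendsto (fun n => Xn n ω) Filter.atTop (nhds (X ω)))
    (hκ : ∀ r, Filter.Tendsto (fun n => κn n r) Filter.atTop (nhds (κ r))) :
    HasCumulants X P κ := by
  have hm : AEMeasurable X P := aemeasurable_of_tendsto_metrizable_ae _ (fun n => (h n).aemeas) hlim
  refine ⟨hm, ?_, fun j hj => ?_⟩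
  · refine hV.mono' (hm.pow_const 4).aestronglyMeasurable ?_
    filter_upwards [hlim, ae_all_iff.2 hb] with ω h1 h2
    rw [norm_pow, Real.norm_eq_abs]
    exact pow_le_pow_left₀ (abs_nonneg _)
      (le_of_tendsto h1.abs (Filter.Eventually.of_forall h2)) 4
  · have h1 : Filter.Tendsto (fun n => ∫ ω, Xn n ω ^ j ∂P) Filter.atTop (nhds (∫ ω, X ω ^ j ∂P)) := by
      refine tendsto_integral_of_dominated_convergence (fun ω => V ω ^ j)
        (fun n => ((h n).aemeas.pow_const j).aestronglyMeasurable)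
        (integrable_pow_of_le hVm hV hj) (fun n => ?_) ?_
      · filter_upwards [hb n] with ω h2
        rw [norm_pow, Real.norm_eq_abs]
        exact pow_le_pow_left₀ (abs_nonneg _) h2 j
      · filter_upwards [hlim] with ω h2 using h2.pow j
    refine tendsto_nhds_unique h1 ?_
    simp only [(h _).moment j hj]
    have t1 := hκ 1
    have t2 := hκ 2
    have t3 := hκ 3
    have t4 := hκ 4
    interval_cases j <;> simp only [bell]
    · exact tendsto_const_nhds
    · exact t1.const_add 0
    · exact ((t1.const_add 0).pow 2).add t2
    · exact (((t1.const_add 0).pow 3).add ((t2.const_mul 3).mul (t1.const_add 0))).add t3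
    · exact (((((t1.const_add 0).pow 4).add ((t2.const_mul 6).mul ((t1.const_add 0).pow 2))).add
        ((t3.const_mul 4).mul (t1.const_add 0))).add t4).add ((t2.pow 2).const_mul 3)

end HasCumulants

end FX

end

noncomputable section
set_option linter.unusedSectionVars false
namespace FX

variable {Ω : Type*} [MeasurableSpace Ω] {P : Measure Ω}

/-! ### Sums of i.i.d. variables over consecutive random blocks -/

/-- The number `v 0 + ⋯ + v (i - 1)` of variables used by the first `i` blocks. -/
def blockStart (v : ℕ → ℕ) (i : ℕ) : ℕ := ∑ j ∈ Finset.range i, v j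

/-- The sum of the `i`-th block, when the lengths of the blocks are `v 0, v 1, …`. -/
def blockSum (ξ : ℕ → Ω → ℝ) (v : ℕ → ℕ) (i : ℕ) (ω : Ω) : ℝ :=
  ∑ n ∈ Finset.range (v i), ξ (blockStart v i + n) ω

theorem measure_eq_tsum_inter_preimage {ι : Type*} [Countable ι] [MeasurableSpace ι]
    [MeasurableSingletonClass ι] {W : Ω → ι} (hW : Measurable W) {E : Set Ω}
    (hE : MeasurableSet E) : P E = ∑' w, P (E ∩ W ⁻¹' {w}) := by
  rw [← measure_iUnion _ fun w => hE.inter (hW (measurableSet_singleton w))]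
  · congr 1
    ext ω
    simp
  · intro w w' h
    refine Set.disjoint_left.2 fun ω h1 h2 => h ?_
    rw [← h1.2, ← h2.2]

/-- A sequence of block lengths and a sequence of i.i.d. variables with law `F`, all of them
independent. -/
structure IsBlockModel (P : Measure Ω) (F : Measure ℝ) (K : ℕ → Ω → ℕ) (ξ : ℕ → Ω → ℝ) :
    Prop where
  measK : ∀ i, Measurable (K i)
  measξ : ∀ n, Measurable (ξ n)
  indepK : iIndepFun K P
  indepξ : iIndepFun ξ P
  law : ∀ n, P.map (ξ n) = F
  indep : Indep (⨆ i, MeasurableSpace.comap (K i) inferInstance)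
    (⨆ n, MeasurableSpace.comap (ξ n) inferInstance) P

namespace IsBlockModel

variable {F : Measure ℝ} {K : ℕ → Ω → ℕ} {ξ : ℕ → Ω → ℝ}

theorem indep_lt_ge (h : IsBlockModel P F K ξ) (c : ℕ) :
    Indep (⨆ n ∈ {n | n < c}, MeasurableSpace.comap (ξ n) inferInstance)
      (⨆ n ∈ {n | c ≤ n}, MeasurableSpace.comap (ξ n) inferInstance) P := by
  refine indep_iSup_of_disjoint (fun n => (h.measξ n).comap_le) h.indepξ ?_
  exact Set.disjoint_left.2 fun n (h1 : n < c) (h2 : c ≤ n) => absurd h1 (not_lt.2 h2)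

theorem measurable_of_mem (S : Set ℕ) {n : ℕ} (hn : n ∈ S) :
    Measurable[⨆ n ∈ S, MeasurableSpace.comap (ξ n) inferInstance] (ξ n) :=
  (comap_measurable (ξ n)).mono (le_iSup₂_of_le n hn le_rfl) le_rfl

theorem measurable_sum_shift (c k : ℕ) :
    Measurable[⨆ n ∈ {n | c ≤ n}, MeasurableSpace.comap (ξ n) inferInstance]
      (fun ω => ∑ n ∈ Finset.range k, ξ (c + n) ω) := by
  refine Finset.measurable_fun_sum _ fun n _ => measurable_of_mem _ ?_
  simp

theorem blockStart_mono (v : ℕ → ℕ) : Monotone (blockStart v) := fun _ _ hij =>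
  Finset.sum_le_sum_of_subset (Finset.range_subset_range.2 hij)

theorem measurable_blockSum (v : ℕ → ℕ) {i m : ℕ} (hi : i < m) :
    Measurable[⨆ n ∈ {n | n < blockStart v m}, MeasurableSpace.comap (ξ n) inferInstance]
      (blockSum ξ v i) := by
  refine Finset.measurable_fun_sum _ fun n hn => measurable_of_mem _ ?_
  have h1 : blockStart v (i + 1) ≤ blockStart v m := blockStart_mono v hi
  have h2 : blockStart v (i + 1) = blockStart v i + v i := Finset.sum_range_succ _ _
  have h3 := Finset.mem_range.1 hn
  simp only [mem_ofPred_eq]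
  omega

/-- By induction both laws are the same convolution power of `F`. Hence the law of a block depends
on its length only, not on its starting index. -/
theorem map_sum_shift (h : IsBlockModel P F K ξ) (c k : ℕ) :
    P.map (fun ω => ∑ n ∈ Finset.range k, ξ (c + n) ω) =
      P.map (fun ω => ∑ n ∈ Finset.range k, ξ n ω) := by
  have := h.indepξ.isProbabilityMeasure
  have step : ∀ c k, P.map (fun ω => ∑ n ∈ Finset.range (k + 1), ξ (c + n) ω) =
      (P.map (fun ω => ∑ n ∈ Finset.range k, ξ (c + n) ω)) ∗ F := by
    intro c k
    have hm : Measurable (fun ω => ∑ n ∈ Finset.range k, ξ (c + n) ω) :=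
      Finset.measurable_fun_sum _ fun n _ => h.measξ _
    have hi : IndepFun (fun ω => ∑ n ∈ Finset.range k, ξ (c + n) ω) (ξ (c + k)) P := by
      refine indep_of_indep_of_le (h.indep_lt_ge (c + k)) ?_ ?_
      · refine Measurable.comap_le ?_
        refine Finset.measurable_fun_sum _ fun n hn => measurable_of_mem _ ?_
        have := Finset.mem_range.1 hn
        simp only [mem_ofPred_eq]
        omega
      · exact (measurable_of_mem _ (by simp)).comap_le
    rw [← h.law (c + k), ← hi.map_add_eq_map_conv_map hm (h.measξ _)]
    congr 1
    funext ω
    simp [Finset.sum_range_succ]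
  induction k with
  | zero => simp
  | succ k ih =>
    rw [step, ih]
    have := step 0 k
    simp only [zero_add] at this
    rw [this]

theorem measurable_blockSum_random (h : IsBlockModel P F K ξ) (i : ℕ) :
    Measurable (fun ω => blockSum ξ (fun j => K j ω) i ω) := by
  have hs : Measurable (fun ω => (K i ω, blockStart (fun j => K j ω) i)) :=
    (h.measK i).prodMk (Finset.measurable_fun_sum _ fun j _ => h.measK j)
  have h2 : ∀ p : ℕ × ℕ, Measurable (fun ω => ∑ n ∈ Finset.range p.1, ξ (p.2 + n) ω) := fun p =>
    Finset.measurable_fun_sum _ fun n _ => h.measξ _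
  exact (measurable_from_prod_countable_right (f := fun q : (ℕ × ℕ) × Ω =>
    ∑ n ∈ Finset.range q.1.1, ξ (q.1.2 + n) q.2) h2).comp (hs.prodMk measurable_id)

/-- Extension by zero of finitely many block lengths. -/
def extendZero {m : ℕ} (v : Fin m → ℕ) (i : ℕ) : ℕ := if h : i < m then v ⟨i, h⟩ else 0

theorem blockSum_congr {v v' : ℕ → ℕ} {i m : ℕ} (hi : i < m) (h : ∀ j < m, v j = v' j) (ω : Ω) :
    blockSum ξ v i ω = blockSum ξ v' i ω := by
  have : blockStart v i = blockStart v' i := Finset.sum_congr rfl fun j hj =>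
    h j ((Finset.mem_range.1 hj).trans hi)
  rw [blockSum, blockSum, h i hi, this]

theorem indep_past_length (h : IsBlockModel P F K ξ) (m : ℕ) :
    IndepFun (fun ω (i : Fin m) => K i ω) (K m) P := by
  have := h.indepK.indepFun_finset (Finset.range m) {m} (by simp) h.measK
  have hφ : Measurable (fun (f : Finset.range m → ℕ) (i : Fin m) => f ⟨i, by simp⟩) :=
    measurable_pi_lambda _ fun i => measurable_pi_apply _
  have hψ : Measurable (fun f : ({m} : Finset ℕ) → ℕ => f ⟨m, by simp⟩) := measurable_pi_apply _
  exact this.comp hφ hψ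

/-- The starting index of block `m` depends on the earlier block lengths, so the sums are decomposed
over all values of the lengths. Given these, the blocks use disjoint sets of the variables, and the
law of the last one forgets where it starts. The result is a product of a factor in `A` and a factor
in `B`, which is independence up to normalization. -/
theorem measure_past_block (h : IsBlockModel P F K ξ) (m : ℕ) (a : ℕ → ℝ) {A B : Set ℝ}
    (hA : MeasurableSet A) (hB : MeasurableSet B) :
    P ((fun ω => ∑ i ∈ Finset.range m, a i * blockSum ξ (fun j => K j ω) i ω) ⁻¹' A ∩
        (fun ω => blockSum ξ (fun j => K j ω) m ω) ⁻¹' B) =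
      (∑' v : Fin m → ℕ, P ((fun ω (i : Fin m) => K i ω) ⁻¹' {v}) *
        P ((fun ω => ∑ i ∈ Finset.range m, a i * blockSum ξ (extendZero v) i ω) ⁻¹' A)) *
      ∑' k : ℕ, P (K m ⁻¹' {k}) * P.map (fun ω => ∑ n ∈ Finset.range k, ξ n ω) B := by
  have hp := h.indepξ.isProbabilityMeasure
  have hVm : Measurable (fun ω (i : Fin m) => K i ω) := measurable_pi_lambda _ fun i => h.measK i
  have hW : Measurable (fun ω => ((fun i : Fin m => K i ω), K m ω)) := hVm.prodMk (h.measK m)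
  have hXm : Measurable (fun ω => ∑ i ∈ Finset.range m, a i * blockSum ξ (fun j => K j ω) i ω) :=
    Finset.measurable_fun_sum _ fun i _ => (h.measurable_blockSum_random i).const_mul _
  rw [measure_eq_tsum_inter_preimage hW ((hXm hA).inter (h.measurable_blockSum_random m hB)),
    ENNReal.tsum_prod', ← ENNReal.tsum_mul_right]
  refine tsum_congr fun v => ?_
  rw [← ENNReal.tsum_mul_left]
  refine tsum_congr fun k => ?_
  -- For lengths `v`, the past uses the variables with index below `c`, and block `m` starts at `c`.
  set c := blockStart (extendZero v) m
  have hY : Measurable[⨆ n ∈ {n | n < c}, MeasurableSpace.comap (ξ n) inferInstance]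
      (fun ω => ∑ i ∈ Finset.range m, a i * blockSum ξ (extendZero v) i ω) :=
    Finset.measurable_fun_sum _ fun i hi =>
      (measurable_blockSum _ (Finset.mem_range.1 hi)).const_mul _
  have hS := measurable_sum_shift (ξ := ξ) c k
  have hset : ((fun ω => ∑ i ∈ Finset.range m, a i * blockSum ξ (fun j => K j ω) i ω) ⁻¹' A ∩
        (fun ω => blockSum ξ (fun j => K j ω) m ω) ⁻¹' B) ∩
        (fun ω => ((fun i : Fin m => K i ω), K m ω)) ⁻¹' {(v, k)} =
      ((fun ω (i : Fin m) => K i ω) ⁻¹' {v} ∩ K m ⁻¹' {k}) ∩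
      (((fun ω => ∑ i ∈ Finset.range m, a i * blockSum ξ (extendZero v) i ω) ⁻¹' A) ∩
        (fun ω => ∑ n ∈ Finset.range k, ξ (c + n) ω) ⁻¹' B) := by
    have key : ∀ ω, (fun i : Fin m => K i ω) = v → K m ω = k →
        (∑ i ∈ Finset.range m, a i * blockSum ξ (fun j => K j ω) i ω =
          ∑ i ∈ Finset.range m, a i * blockSum ξ (extendZero v) i ω) ∧
        blockSum ξ (fun j => K j ω) m ω = ∑ n ∈ Finset.range k, ξ (c + n) ω := by
      intro ω h1 h2
      have h3 : ∀ j < m, K j ω = extendZero v j := fun j hj => by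
        simp [extendZero, hj, ← h1]
      refine ⟨Finset.sum_congr rfl fun i hi => ?_, ?_⟩
      · rw [blockSum_congr (Finset.mem_range.1 hi) h3]
      · have : blockStart (fun j => K j ω) m = c := Finset.sum_congr rfl fun j hj =>
          h3 j (Finset.mem_range.1 hj)
        rw [blockSum, this, h2]
    ext ω
    simp only [mem_inter_iff, mem_preimage, mem_singleton_iff, Prod.mk.injEq]
    constructor
    · rintro ⟨⟨h1, h2⟩, h3, h4⟩
      obtain ⟨e1, e2⟩ := key ω h3 h4
      exact ⟨⟨h3, h4⟩, e1 ▸ h1, e2 ▸ h2⟩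
    · rintro ⟨⟨h3, h4⟩, h1, h2⟩
      obtain ⟨e1, e2⟩ := key ω h3 h4
      exact ⟨⟨e1 ▸ h1, e2 ▸ h2⟩, h3, h4⟩
  have leξ : ∀ S : Set ℕ, (⨆ n ∈ S, MeasurableSpace.comap (ξ n) inferInstance) ≤
      ⨆ n, MeasurableSpace.comap (ξ n) inferInstance := fun S => iSup₂_le fun n _ => le_iSup
        (fun n => MeasurableSpace.comap (ξ n) inferInstance) n
  have hK : ∀ i, Measurable[⨆ i, MeasurableSpace.comap (K i) inferInstance] (K i) := fun i =>
    (comap_measurable (K i)).mono (le_iSup (fun i => MeasurableSpace.comap (K i) inferInstance) i)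
      le_rfl
  have hV : Measurable[⨆ i, MeasurableSpace.comap (K i) inferInstance]
      (fun ω (i : Fin m) => K i ω) := @measurable_pi_lambda _ _ _ (_) _ _ fun i => hK i
  -- Three independences in turn: lengths from variables, variables below `c` from those from `c`
  -- on, and past lengths from the length of block `m`.
  rw [hset, (Indep_iff _ _ _).1 h.indep _ _
    ((hV (measurableSet_singleton v)).inter (hK m (measurableSet_singleton k)))
    ((leξ _ _ (hY hA)).inter (leξ _ _ (hS hB))),
    (Indep_iff _ _ _).1 (h.indep_lt_ge c) _ _ (hY hA) (hS hB),
    (h.indep_past_length m).measure_inter_preimage_eq_mul _ _ (measurableSet_singleton v)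
      (measurableSet_singleton k), ← h.map_sum_shift c k]
  have hS' : Measurable (fun ω => ∑ n ∈ Finset.range k, ξ (c + n) ω) :=
    Finset.measurable_fun_sum _ fun n _ => h.measξ _
  rw [Measure.map_apply hS' hB]
  ring

/-- This is `measure_past_block` with no condition on the past. Its first factor equals one, as the
case where `B` is everything shows. -/
theorem map_blockSum (h : IsBlockModel P F K ξ) (m : ℕ) :
    P.map (fun ω => blockSum ξ (fun j => K j ω) m ω) =
      Measure.sum fun k => P (K m ⁻¹' {k}) • P.map (fun ω => ∑ n ∈ Finset.range k, ξ n ω) := by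
  have hp := h.indepξ.isProbabilityMeasure
  ext B hB
  have h1 := h.measure_past_block m (fun _ => 0) MeasurableSet.univ hB
  have h2 := h.measure_past_block m (fun _ => 0) MeasurableSet.univ MeasurableSet.univ
  have h3 : ∑' k : ℕ, P (K m ⁻¹' {k}) *
      P.map (fun ω => ∑ n ∈ Finset.range k, ξ n ω) univ = 1 := by
    have e : ∀ k : ℕ, P.map (fun ω => ∑ n ∈ Finset.range k, ξ n ω) univ = 1 := fun k => by
      rw [Measure.map_apply (Finset.measurable_fun_sum _ fun n _ => h.measξ _) MeasurableSet.univ]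
      simp
    simp only [e, mul_one]
    have := measure_eq_tsum_inter_preimage (P := P) (h.measK m) MeasurableSet.univ
    simpa using this.symm
  rw [h3] at h2
  simp only [preimage_univ, univ_inter, measure_univ, mul_one] at h1 h2
  rw [← h2, one_mul] at h1
  rw [Measure.map_apply (h.measurable_blockSum_random m) hB, Measure.sum_apply _ hB]
  simpa using h1

theorem indepFun_past_block (h : IsBlockModel P F K ξ) (m : ℕ) (a : ℕ → ℝ) :
    IndepFun (fun ω => ∑ i ∈ Finset.range m, a i * blockSum ξ (fun j => K j ω) i ω)
      (fun ω => blockSum ξ (fun j => K j ω) m ω) P := by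
  have hp := h.indepξ.isProbabilityMeasure
  rw [indepFun_iff_measure_inter_preimage_eq_mul]
  intro A B hA hB
  have hB' : P ((fun ω => blockSum ξ (fun j => K j ω) m ω) ⁻¹' B) =
      ∑' k : ℕ, P (K m ⁻¹' {k}) * P.map (fun ω => ∑ n ∈ Finset.range k, ξ n ω) B := by
    rw [← Measure.map_apply (h.measurable_blockSum_random m) hB, h.map_blockSum m,
      Measure.sum_apply _ hB]
    simp
  have hu : ∑' k : ℕ, P (K m ⁻¹' {k}) *
      P.map (fun ω => ∑ n ∈ Finset.range k, ξ n ω) univ = 1 := by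
    have := congrArg (fun μ => μ univ) (h.map_blockSum m)
    simp only [Measure.map_apply (h.measurable_blockSum_random m) MeasurableSet.univ,
      Measure.sum_apply _ MeasurableSet.univ] at this
    simpa using this.symm
  have h1 := h.measure_past_block m a hA hB
  have h2 := h.measure_past_block m a hA MeasurableSet.univ
  rw [hu, mul_one] at h2
  simp only [preimage_univ, inter_univ] at h2
  rw [hB']
  exact h1.trans (by rw [← h2])

end IsBlockModel

end FX

end

noncomputable section

namespace FX

variable {Ω : Type*} [MeasurableSpace Ω] {P : Measure Ω}

/-! ### Compound Poisson variables -/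

theorem cast_descFactorial_succ (k j : ℕ) :
    (k.descFactorial (j + 1) : ℝ) = (k.descFactorial j : ℝ) * (k - j) := by
  rcases le_or_gt j k with h | h
  · rw [Nat.descFactorial_succ, Nat.cast_mul, Nat.cast_sub h, mul_comm]
  · rw [Nat.descFactorial_of_lt h, Nat.descFactorial_of_lt (by omega)]
    simp

/-- The factorial moments of a Poisson variable: the first `j` terms vanish, and multiplying the
weight at `n + j` by the falling factorial gives `ν ^ j` times the weight at `n`. -/
theorem hasSum_poisson_descFactorial (ν : ℝ≥0) (j : ℕ) :
    HasSum (fun k : ℕ => Real.exp (-ν) * (ν : ℝ) ^ k / (k.factorial : ℝ) * (k.descFactorial j : ℝ))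
      ((ν : ℝ) ^ j) := by
  have h := (hasSum_one_poissonMeasure ν).mul_right ((ν : ℝ) ^ j)
  rw [one_mul] at h
  have h0 : ∑ i ∈ Finset.range j,
      Real.exp (-ν) * (ν : ℝ) ^ i / (i.factorial : ℝ) * (i.descFactorial j : ℝ) = 0 :=
    Finset.sum_eq_zero fun i hi => by
      rw [Nat.descFactorial_of_lt (Finset.mem_range.1 hi)]
      simp
  rw [show ((ν : ℝ) ^ j) = (ν : ℝ) ^ j + ∑ i ∈ Finset.range j,
      Real.exp (-ν) * (ν : ℝ) ^ i / (i.factorial : ℝ) * (i.descFactorial j : ℝ) by simp [h0],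
    ← hasSum_nat_add_iff]
  refine h.congr_fun ?_
  intro n
  have e : ((n + j).factorial : ℝ) = (n.factorial : ℝ) * ((n + j).descFactorial j : ℝ) := by
    have := Nat.factorial_mul_descFactorial (Nat.le_add_left j n)
    rw [Nat.add_sub_cancel] at this
    exact_mod_cast this.symm
  have h1 : (n.factorial : ℝ) ≠ 0 := by positivity
  have h2 : ((n + j).descFactorial j : ℝ) ≠ 0 := by
    have := Nat.descFactorial_pos.2 (Nat.le_add_left j n)
    positivity
  rw [e]
  field_simp
  ring

/-- The cumulants of a variable with moments `M`. -/
def cumulantOfMoment (M : ℕ → ℝ) (r : ℕ) : ℝ :=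
  match r with
  | 1 => M 1
  | 2 => M 2 - M 1 ^ 2
  | 3 => M 3 - 3 * M 1 * M 2 + 2 * M 1 ^ 3
  | 4 => M 4 - 4 * M 1 * M 3 - 3 * M 2 ^ 2 + 12 * M 1 ^ 2 * M 2 - 6 * M 1 ^ 4
  | _ => 0

namespace IsBlockModel

variable {F : Measure ℝ} {K : ℕ → Ω → ℕ} {ξ : ℕ → Ω → ℝ}

theorem hasCumulants_xi (h : IsBlockModel P F K ξ) (hF : Integrable (fun r : ℝ => r ^ 4) F)
    (n : ℕ) : HasCumulants (ξ n) P (cumulantOfMoment fun r => ∫ x, x ^ r ∂F) := by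
  have hp := h.indepξ.isProbabilityMeasure
  have hc : ∀ r : ℕ, ∫ ω, ξ n ω ^ r ∂P = ∫ x, x ^ r ∂F := fun r => by
    rw [← h.law n, integral_map (h.measξ n).aemeasurable
      (by fun_prop)]
  refine ⟨(h.measξ n).aemeasurable, ?_, fun r hr => ?_⟩
  · rw [← h.law n] at hF
    exact hF.comp_measurable (h.measξ n)
  · rw [hc r]
    interval_cases r <;> simp only [bell, cumulantOfMoment]
    · rw [← h.law n, integral_map (h.measξ n).aemeasurable (by fun_prop)]
      simp
    all_goals ring

theorem hasCumulants_sum (h : IsBlockModel P F K ξ) (hF : Integrable (fun r : ℝ => r ^ 4) F)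
    (k : ℕ) : HasCumulants (fun ω => ∑ n ∈ Finset.range k, ξ n ω) P
      (fun r => k * cumulantOfMoment (fun r => ∫ x, x ^ r ∂F) r) := by
  have hp := h.indepξ.isProbabilityMeasure
  induction k with
  | zero => simpa using HasCumulants.zero (P := P)
  | succ k ih =>
    have hi : IndepFun (fun ω => ∑ n ∈ Finset.range k, ξ n ω) (ξ k) P := by
      refine indep_of_indep_of_le (h.indep_lt_ge k) ?_ ?_
      · refine Measurable.comap_le ?_
        exact Finset.measurable_fun_sum _ fun n hn => measurable_of_mem _ (Finset.mem_range.1 hn)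
      · exact (measurable_of_mem _ (le_refl k)).comap_le
    have := ih.add (h.hasCumulants_xi hF k) hi
    simp only [Finset.sum_range_succ]
    convert this using 2 with r
    push_cast
    ring

/-- The moments of a sum of `k` i.i.d. variables, in terms of the falling factorials of `k`. -/
theorem bell_natCast_mul (M : ℕ → ℝ) {n : ℕ} (hn : n ≤ 4) : ∃ A : ℕ → ℝ,
    (∀ k : ℕ, bell n 0 (fun r => k * cumulantOfMoment M r) =
      ∑ j ∈ Finset.range 5, A j * (k.descFactorial j : ℝ)) ∧
    ∀ ν : ℝ, bell n 0 (fun r => ν * M r) = ∑ j ∈ Finset.range 5, A j * ν ^ j := by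
  -- `A n j` is the partial Bell polynomial in the moments `M`. The same coefficients serve falling
  -- factorials of `k` and powers of `ν`, because the factorial moments of a Poisson variable are
  -- the powers of its mean.
  let A : ℕ → ℕ → ℝ := fun n j => match n, j with
    | 0, 0 => 1
    | 1, 1 => M 1
    | 2, 1 => M 2
    | 2, 2 => M 1 ^ 2
    | 3, 1 => M 3
    | 3, 2 => 3 * M 1 * M 2
    | 3, 3 => M 1 ^ 3
    | 4, 1 => M 4
    | 4, 2 => 4 * M 1 * M 3 + 3 * M 2 ^ 2
    | 4, 3 => 6 * M 1 ^ 2 * M 2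
    | 4, 4 => M 1 ^ 4
    | _, _ => 0
  refine ⟨A n, fun k => ?_, fun ν => ?_⟩
  · have d0 : (k.descFactorial 0 : ℝ) = 1 := by simp
    have d1 := cast_descFactorial_succ k 0
    have d2 := cast_descFactorial_succ k 1
    have d3 := cast_descFactorial_succ k 2
    have d4 := cast_descFactorial_succ k 3
    simp only [zero_add, Nat.reduceAdd] at d1 d2 d3 d4
    simp only [Finset.sum_range_succ, Finset.sum_range_zero, d4, d3, d2, d1, d0]
    interval_cases n <;> simp only [bell, cumulantOfMoment, A] <;> push_cast <;> ring
  · simp only [Finset.sum_range_succ, Finset.sum_range_zero]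
    interval_cases n <;> simp only [bell, A] <;> ring

/-- Given the length `k`, the moments are combinations of falling factorials of `k`. Averaging over
the Poisson law replaces these by powers of `ν`, which gives the moments belonging to the cumulants
`ν M r`. -/
theorem hasCumulants_block (h : IsBlockModel P F K ξ) (hF : Integrable (fun r : ℝ => r ^ 4) F)
    (m : ℕ) (ν : ℝ≥0) (hν : P.map (K m) = poissonMeasure ν) :
    HasCumulants (fun ω => blockSum ξ (fun j => K j ω) m ω) P
      (fun r => ν * ∫ x, x ^ r ∂F) := by
  have hp := h.indepξ.isProbabilityMeasure
  set M : ℕ → ℝ := fun r => ∫ x, x ^ r ∂F with hM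
  have hD := h.measurable_blockSum_random m
  have hPK : ∀ k, P (K m ⁻¹' {k}) =
      ENNReal.ofReal (Real.exp (-ν) * (ν : ℝ) ^ k / (k.factorial : ℝ)) := fun k => by
    rw [← Measure.map_apply (h.measK m) (measurableSet_singleton k), hν, poissonMeasure_singleton]
  have hSm : ∀ k : ℕ, Measurable (fun ω => ∑ n ∈ Finset.range k, ξ n ω) := fun k =>
    Finset.measurable_fun_sum _ fun n _ => h.measξ _
  have hsum : ∀ n ≤ 4, HasSum (fun k : ℕ => Real.exp (-ν) * (ν : ℝ) ^ k / (k.factorial : ℝ) *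
      bell n 0 (fun r => k * cumulantOfMoment M r)) (bell n 0 (fun r => ν * M r)) := by
    intro n hn
    obtain ⟨A, h1, h2⟩ := bell_natCast_mul M hn
    rw [h2]
    simp only [h1, Finset.mul_sum]
    refine hasSum_sum fun j _ => ?_
    refine ((hasSum_poisson_descFactorial ν j).mul_left (A j)).congr_fun fun k => ?_
    ring
  have hmom : ∀ k : ℕ, ∀ n ≤ 4, ∫ x, x ^ n ∂(P (K m ⁻¹' {k}) •
        P.map (fun ω => ∑ n ∈ Finset.range k, ξ n ω)) =
      Real.exp (-ν) * (ν : ℝ) ^ k / (k.factorial : ℝ) *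
        bell n 0 (fun r => k * cumulantOfMoment M r) := fun k n hn => by
    rw [integral_smul_measure, integral_map (hSm k).aemeasurable (by fun_prop),
      (h.hasCumulants_sum hF k).moment n hn, hPK, ENNReal.toReal_ofReal (by positivity), smul_eq_mul]
  have hInt : ∀ k : ℕ, Integrable (fun x : ℝ => x ^ 4) (P (K m ⁻¹' {k}) •
        P.map (fun ω => ∑ n ∈ Finset.range k, ξ n ω)) := fun k => by
    refine Integrable.smul_measure ?_ (measure_ne_top _ _)
    rw [integrable_map_measure (by fun_prop) (hSm k).aemeasurable]
    exact (h.hasCumulants_sum hF k).int4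
  have hI4 : Integrable (fun x : ℝ => x ^ 4) (P.map fun ω => blockSum ξ (fun j => K j ω) m ω) := by
    rw [h.map_blockSum m]
    refine integrable_sum_measure hInt ?_
    -- Fourth powers are nonnegative, so the series of norms is the series of moments already
    -- summed.
    refine (hsum 4 le_rfl).summable.congr fun k => ?_
    rw [← hmom k 4 le_rfl]
    refine integral_congr_ae (Filter.Eventually.of_forall fun x => ?_)
    simp only [Real.norm_eq_abs, abs_of_nonneg (show (0 : ℝ) ≤ x ^ 4 by positivity)]
  have hprob : IsProbabilityMeasure (P.map fun ω => blockSum ξ (fun j => K j ω) m ω) :=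
    Measure.isProbabilityMeasure_map hD.aemeasurable
  refine ⟨hD.aemeasurable, hI4.comp_measurable hD, fun n hn => ?_⟩
  have hIn := integrable_pow_of_le (X := id) aemeasurable_id hI4 hn
  have e : ∫ ω, blockSum ξ (fun j => K j ω) m ω ^ n ∂P =
      ∫ x, x ^ n ∂(P.map fun ω => blockSum ξ (fun j => K j ω) m ω) := by
    rw [integral_map hD.aemeasurable (by fun_prop)]
  rw [e]
  simp only [id_eq] at hIn
  rw [h.map_blockSum m] at hIn ⊢
  have := hasSum_integral_measure hIn
  simp only [hmom _ n hn] at this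
  exact this.unique (hsum n hn)

/-- A weighted sum of the first `m` blocks, when their lengths are Poisson variables. -/
theorem hasCumulants_weighted_sum (h : IsBlockModel P F K ξ)
    (hF : Integrable (fun r : ℝ => r ^ 4) F) (a : ℕ → ℝ) (ν : ℕ → ℝ≥0) (m : ℕ)
    (hν : ∀ i, P.map (K i) = poissonMeasure (ν i)) :
    HasCumulants (fun ω => ∑ i ∈ Finset.range m, a i * blockSum ξ (fun j => K j ω) i ω) P
      (fun r => ∑ i ∈ Finset.range m, a i ^ r * (ν i * ∫ x, x ^ r ∂F)) := by
  have hp := h.indepξ.isProbabilityMeasure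
  induction m with
  | zero => simpa using HasCumulants.zero (P := P)
  | succ m ih =>
    simp only [Finset.sum_range_succ]
    exact ih.add ((h.hasCumulants_block hF m (ν m) (hν m)).const_mul (a m))
      ((h.indepFun_past_block m a).comp measurable_id (measurable_const_mul (a m)))

end IsBlockModel

end FX

end

noncomputable section

namespace FX

/-! ### Riemann-Stieltjes sums -/

/-- The points of the uniform partition of `[t, u]` into `n + 1` intervals. -/
def node (t u : ℝ) (n i : ℕ) : ℝ := t + (u - t) * (i / (n + 1))

/-- The Riemann-Stieltjes sum of `∫ w dO` over `[t, u]` with respect to the uniform partition. -/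
def stieltjesSum (w O : ℝ → ℝ) (t u : ℝ) (n : ℕ) : ℝ :=
  ∑ i ∈ Finset.range (n + 1), w (node t u n i) * (O (node t u n (i + 1)) - O (node t u n i))

theorem node_zero (t u : ℝ) (n : ℕ) : node t u n 0 = t := by simp [node]

theorem node_last (t u : ℝ) (n : ℕ) : node t u n (n + 1) = u := by
  have : (n : ℝ) + 1 ≠ 0 := by positivity
  simp [node, div_self this]

theorem node_mono {t u : ℝ} (h : t ≤ u) (n : ℕ) : Monotone (node t u n) := fun i j hij => by
  have : (i : ℝ) ≤ j := by exact_mod_cast hij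
  have h0 : 0 ≤ u - t := by linarith
  unfold node
  gcongr

theorem node_succ_sub (t u : ℝ) (n i : ℕ) :
    node t u n (i + 1) - node t u n i = (u - t) / (n + 1) := by
  have : (n : ℝ) + 1 ≠ 0 := by positivity
  simp only [node, Nat.cast_add, Nat.cast_one]
  field_simp
  ring

theorem node_mem {t u : ℝ} (h : t ≤ u) (n : ℕ) {i : ℕ} (hi : i ≤ n + 1) :
    node t u n i ∈ Icc t u := by
  constructor
  · have := node_mono h n (Nat.zero_le i)
    rwa [node_zero] at this
  · have := node_mono h n hi
    rwa [node_last] at this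

theorem sum_node_sub (O : ℝ → ℝ) (t u : ℝ) (n : ℕ) :
    ∑ i ∈ Finset.range (n + 1), (O (node t u n (i + 1)) - O (node t u n i)) = O u - O t := by
  rw [Finset.sum_range_sub (fun i => O (node t u n i)), node_zero, node_last]

theorem abs_stieltjesSum_le {w O : ℝ → ℝ} {t u C : ℝ} (htu : t ≤ u)
    (hO : MonotoneOn O (Icc t u)) (hw : ∀ s ∈ Icc t u, |w s| ≤ C) (n : ℕ) :
    |stieltjesSum w O t u n| ≤ C * (O u - O t) := by
  rw [← sum_node_sub O t u n, Finset.mul_sum]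
  refine (Finset.abs_sum_le_sum_abs _ _).trans (Finset.sum_le_sum fun i hi => ?_)
  have hi' := Finset.mem_range.1 hi
  have h1 := node_mem htu n (i := i) (by omega)
  have h2 := node_mem htu n (i := i + 1) (by omega)
  have h3 : 0 ≤ O (node t u n (i + 1)) - O (node t u n i) :=
    sub_nonneg.2 (hO h1 h2 (node_mono htu n (Nat.le_succ i)))
  rw [abs_mul, abs_of_nonneg h3]
  exact mul_le_mul_of_nonneg_right (hw _ h1) h3

/-- The limit is the Stieltjes integral written by parts, so only ordinary integrals occur. On each
cell the error is at most `sup |w'|` times the increment of `O` times the mesh, and the increments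
telescope. -/
theorem tendsto_stieltjesSum {w w' O : ℝ → ℝ} {t u : ℝ} (htu : t ≤ u)
    (hw : ∀ s, HasDerivAt w (w' s) s) (hw' : Continuous w') (hO : MonotoneOn O (Icc t u)) :
    Filter.Tendsto (stieltjesSum w O t u) Filter.atTop
      (nhds (w u * (O u - O t) - ∫ s in t..u, w' s * (O s - O t))) := by
  obtain ⟨C, hC⟩ := (isCompact_Icc (a := t) (b := u)).exists_bound_of_continuousOn
    hw'.continuousOn
  have hC0 : 0 ≤ C := (norm_nonneg _).trans (hC t ⟨le_rfl, htu⟩)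
  have hOi : ∀ a ∈ Icc t u, ∀ b ∈ Icc t u, a ≤ b → IntervalIntegrable O volume a b := by
    intro a ha b hb hab
    refine (hO.mono ?_).intervalIntegrable
    rw [uIcc_of_le hab]
    exact Icc_subset_Icc ha.1 hb.2
  have key : ∀ n, |w u * (O u - O t) - (∫ s in t..u, w' s * (O s - O t)) - stieltjesSum w O t u n| ≤
      C * (O u - O t) * (u - t) / (n + 1) := by
    intro n
    have e1 : w u * (O u - O t) = ∑ i ∈ Finset.range (n + 1),
        (w (node t u n (i + 1)) * (O (node t u n (i + 1)) - O t) -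
          w (node t u n i) * (O (node t u n i) - O t)) := by
      rw [sum_node_sub (fun s => w s * (O s - O t))]
      simp
    have e2 : ∫ s in t..u, w' s * (O s - O t) = ∑ i ∈ Finset.range (n + 1),
        ∫ s in (node t u n i)..(node t u n (i + 1)), w' s * (O s - O t) := by
      rw [intervalIntegral.sum_integral_adjacent_intervals, node_zero, node_last]
      intro i hi
      have h1 := node_mem htu n (i := i) (by omega)
      have h2 := node_mem htu n (i := i + 1) (by omega)
      exact ((hOi _ h1 _ h2 (node_mono htu n (Nat.le_succ i))).sub
        intervalIntegrable_const).continuousOn_mul hw'.continuousOn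
    rw [e1, e2, stieltjesSum, ← Finset.sum_sub_distrib, ← Finset.sum_sub_distrib]
    have e3 : C * (O u - O t) * (u - t) / (n + 1) = ∑ i ∈ Finset.range (n + 1),
        C * (O (node t u n (i + 1)) - O (node t u n i)) * ((u - t) / (n + 1)) := by
      rw [← Finset.sum_mul, ← Finset.mul_sum, sum_node_sub]
      ring
    rw [e3]
    refine (Finset.abs_sum_le_sum_abs _ _).trans (Finset.sum_le_sum fun i hi => ?_)
    have hi' := Finset.mem_range.1 hi
    have h1 := node_mem htu n (i := i) (by omega)
    have h2 := node_mem htu n (i := i + 1) (by omega)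
    have h12 := node_mono htu n (Nat.le_succ i)
    rw [← node_succ_sub t u n i]
    set a := node t u n i
    set b := node t u n (i + 1)
    have hI := hOi a h1 b h2 h12
    have f1 : ∫ s in a..b, w' s = w b - w a :=
      intervalIntegral.integral_eq_sub_of_hasDerivAt (fun s _ => hw s)
        (hw'.intervalIntegrable _ _)
    -- Integration by parts on one cell: the error is an integral of `w'` against the remaining
    -- increment of `O`.
    have f2 : w b * (O b - O t) - w a * (O a - O t) - (∫ s in a..b, w' s * (O s - O t)) -
        w a * (O b - O a) = ∫ s in a..b, w' s * (O b - O s) := by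
      have g1 : ∫ s in a..b, w' s * (O b - O s) =
          (∫ s in a..b, w' s * (O b - O t)) - ∫ s in a..b, w' s * (O s - O t) := by
        rw [← intervalIntegral.integral_sub]
        · congr 1
          funext s
          ring
        · exact (hw'.intervalIntegrable _ _).mul_const _
        · exact (hI.sub intervalIntegrable_const).continuousOn_mul hw'.continuousOn
      rw [g1, intervalIntegral.integral_mul_const, f1]
      ring
    rw [f2]
    have := intervalIntegral.norm_integral_le_of_norm_le_const (a := a) (b := b)
      (f := fun s => w' s * (O b - O s)) (C := C * (O b - O a)) (fun s hs => by
        rw [uIoc_of_le h12] at hs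
        have hs' : s ∈ Icc t u := ⟨h1.1.trans hs.1.le, hs.2.trans h2.2⟩
        have m1 := hO h1 hs' hs.1.le
        have m2 := hO hs' h2 hs.2
        rw [norm_mul, Real.norm_eq_abs (O b - O s), abs_of_nonneg (by linarith)]
        exact mul_le_mul (hC s hs') (by linarith) (by linarith) hC0)
    rwa [abs_of_nonneg (by linarith : 0 ≤ b - a)] at this
  rw [tendsto_iff_dist_tendsto_zero]
  refine squeeze_zero (fun n => dist_nonneg) (fun n => ?_)
    ((tendsto_const_div_atTop_nhds_zero_nat (C * (O u - O t) * (u - t))).comp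
      (Filter.tendsto_add_atTop_nat 1))
  rw [dist_comm, Real.dist_eq]
  simpa using key n

theorem tendsto_stieltjesSum_id {w w' : ℝ → ℝ} {t u : ℝ} (htu : t ≤ u)
    (hw : ∀ s, HasDerivAt w (w' s) s) (hw' : Continuous w') :
    Filter.Tendsto (stieltjesSum w id t u) Filter.atTop (nhds (∫ s in t..u, w s)) := by
  have hwc : Continuous w := continuous_iff_continuousAt.2 fun s => (hw s).continuousAt
  have h := tendsto_stieltjesSum htu hw hw' (O := id) (monotone_id.monotoneOn _)
  convert h using 2
  have := intervalIntegral.integral_deriv_mul_eq_sub (a := t) (b := u) (u := w)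
    (v := fun s => s - t) (u' := w') (v' := fun _ => 1) (fun s _ => hw s)
    (fun s _ => (hasDerivAt_id s).sub_const t) (hw'.intervalIntegrable _ _)
    intervalIntegrable_const
  rw [intervalIntegral.integral_add ((by fun_prop : Continuous
    fun s => w' s * (s - t)).intervalIntegrable _ _) ((by fun_prop : Continuous
    fun s => w s * 1).intervalIntegrable _ _)] at this
  simp only [mul_one, sub_self, mul_zero, sub_zero] at this
  simp only [id]
  linarith

end FX

end

noncomputable section
set_option linter.unusedSectionVars false
namespace FX

variable {Ω : Type*} [MeasurableSpace Ω] {P : Measure Ω}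

/-! ### Stochastic integrals with respect to a compound Poisson process -/

/-- `bell` never reads `κ 0`. This matters below, where a weight `0 ^ r` is zero only for `r ≥ 1`.
-/
theorem HasCumulants.congr_cumulants {X : Ω → ℝ} {κ κ' : ℕ → ℝ} (h : HasCumulants X P κ)
    (e : ∀ r, 1 ≤ r → κ r = κ' r) : HasCumulants X P κ' := by
  refine ⟨h.aemeas, h.int4, fun n hn => ?_⟩
  rw [h.moment n hn]
  have e1 := e 1 (by norm_num)
  have e2 := e 2 (by norm_num)
  have e3 := e 3 (by norm_num)
  have e4 := e 4 (by norm_num)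
  interval_cases n <;> simp only [bell, e1, e2, e3, e4]

/-- The data of a single compound Poisson order flow. -/
structure IsStream (P : Measure Ω) (l : ℝ≥0) (F : Measure ℝ) (N : ℝ≥0 → Ω → ℕ)
    (ξ : ℕ → Ω → ℝ) : Prop where
  poisson : IsPoissonProcess P l N
  measξ : ∀ n, Measurable (ξ n)
  indepξ : iIndepFun ξ P
  law : ∀ n, P.map (ξ n) = F
  indep : Indep (⨆ t, MeasurableSpace.comap (N t) inferInstance)
    (⨆ n, MeasurableSpace.comap (ξ n) inferInstance) P
  supp : F (Iio 0) = 0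

/-- The σ-algebra generated by a compound Poisson order flow. -/
@[reducible]
def streamSigma (N : ℝ≥0 → Ω → ℕ) (ξ : ℕ → Ω → ℝ) : MeasurableSpace Ω :=
  (⨆ t, MeasurableSpace.comap (N t) inferInstance) ⊔
    ⨆ n, MeasurableSpace.comap (ξ n) inferInstance

/-- The integral of `w` over `(t, u]` with respect to the cumulative volume. -/
def stochInt (w : ℝ → ℝ) (N : ℝ≥0 → Ω → ℕ) (ξ : ℕ → Ω → ℝ) (t u : ℝ) (ω : Ω) : ℝ :=
  Filter.limUnder Filter.atTop fun n => stieltjesSum w (fun s => cumVolume N ξ s ω) t u n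

theorem measurable_cumVolume (N : ℝ≥0 → Ω → ℕ) (ξ : ℕ → Ω → ℝ) (t : ℝ) :
    Measurable[streamSigma N ξ] (cumVolume N ξ t) := by
  have hN : Measurable[streamSigma N ξ] (N t.toNNReal) := (comap_measurable (N t.toNNReal)).mono
    ((le_iSup (fun t => MeasurableSpace.comap (N t) inferInstance) t.toNNReal).trans le_sup_left)
    le_rfl
  have hξ : ∀ n, Measurable[streamSigma N ξ] (ξ n) := fun n => (comap_measurable (ξ n)).mono
    ((le_iSup (fun n => MeasurableSpace.comap (ξ n) inferInstance) n).trans le_sup_right) le_rfl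
  let _ : MeasurableSpace Ω := streamSigma N ξ
  have h2 : ∀ k : ℕ, Measurable (fun ω => ∑ n ∈ Finset.range k, ξ n ω) := fun k =>
    Finset.measurable_fun_sum _ fun n _ => hξ n
  exact (measurable_from_prod_countable_right (f := fun q : ℕ × Ω =>
    ∑ n ∈ Finset.range q.1, ξ n q.2) h2).comp (hN.prodMk measurable_id)

/-- As a pointwise limit, with a default value where there is none, the integral is measurable for
the σ-algebra of its own order flow and not merely almost everywhere equal to such a function.
Independence of integrals of different flows thus follows from independence of these σ-algebras. -/
theorem measurable_stochInt (w : ℝ → ℝ) (N : ℝ≥0 → Ω → ℕ) (ξ : ℕ → Ω → ℝ) (t u : ℝ) :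
    Measurable[streamSigma N ξ] (stochInt w N ξ t u) := by
  have h := fun s => measurable_cumVolume N ξ s
  let _ : MeasurableSpace Ω := streamSigma N ξ
  refine (StronglyMeasurable.limUnder fun n => Measurable.stronglyMeasurable ?_).measurable
  exact Finset.measurable_fun_sum _ fun i _ => ((h _).sub (h _)).const_mul _

namespace IsStream

variable {l : ℝ≥0} {F : Measure ℝ} {N : ℝ≥0 → Ω → ℕ} {ξ : ℕ → Ω → ℝ}

theorem isBlockModel (h : IsStream P l F N ξ) {τ : ℕ → ℝ≥0} (hτ : Monotone τ) :
    IsBlockModel P F (fun i ω => N (τ (i + 1)) ω - N (τ i) ω) ξ where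
  measK i := (h.poisson.measurable _).sub (h.poisson.measurable _)
  measξ := h.measξ
  indepK := h.poisson.indep.nat hτ
  indepξ := h.indepξ
  law := h.law
  indep := by
    refine indep_of_indep_of_le_left h.indep (iSup_le fun i => Measurable.comap_le ?_)
    have hN : ∀ s, Measurable[⨆ t, MeasurableSpace.comap (N t) inferInstance] (N s) := fun s =>
      (comap_measurable (N s)).mono
        (le_iSup (fun t => MeasurableSpace.comap (N t) inferInstance) s) le_rfl
    exact (hN _).sub (hN _)

theorem ae_nonneg (h : IsStream P l F N ξ) : ∀ᵐ ω ∂P, ∀ n, 0 ≤ ξ n ω := by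
  refine ae_all_iff.2 fun n => ?_
  have : ∀ᵐ x ∂(P.map (ξ n)), 0 ≤ x := by
    rw [h.law n, ae_iff]
    convert h.supp using 2
    ext x
    simp
  exact ae_of_ae_map (h.measξ n).aemeasurable this

theorem ae_monotone_cumVolume (h : IsStream P l F N ξ) :
    ∀ᵐ ω ∂P, Monotone fun s => cumVolume N ξ s ω := by
  filter_upwards [h.ae_nonneg, h.poisson.mono] with ω h1 h2 s t hst
  exact Finset.sum_le_sum_of_subset_of_nonneg
    (Finset.range_subset_range.2 (h2 (Real.toNNReal_le_toNNReal hst))) fun n _ _ => h1 n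

/-- Because the counting process starts at zero, the lengths telescope and block `i` starts exactly
at the order number reached at time `τ i`. This is why `τ 0 = 0` is required. -/
theorem ae_blockSum_eq (h : IsStream P l F N ξ) {τ : ℕ → ℝ≥0} (hτ : Monotone τ) (h0 : τ 0 = 0) :
    ∀ᵐ ω ∂P, ∀ i, blockSum ξ (fun j => N (τ (j + 1)) ω - N (τ j) ω) i ω =
      cumVolume N ξ (τ (i + 1)) ω - cumVolume N ξ (τ i) ω := by
  filter_upwards [h.poisson.zero, h.poisson.mono] with ω hz hm i
  have hs : blockStart (fun j => N (τ (j + 1)) ω - N (τ j) ω) i = N (τ i) ω := by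
    have hmono : Monotone fun j => N (τ j) ω := fun a b hab => hm (hτ hab)
    have := Finset.sum_range_tsub hmono i
    simp only [h0, hz, Nat.sub_zero] at this
    exact this
  have hle : N (τ i) ω ≤ N (τ (i + 1)) ω := hm (hτ (Nat.le_succ i))
  rw [blockSum, hs, cumVolume, cumVolume, Real.toNNReal_coe, Real.toNNReal_coe]
  obtain ⟨d, hd⟩ := Nat.exists_eq_add_of_le hle
  rw [hd, Finset.sum_range_add, Nat.add_sub_cancel_left]
  ring

theorem hasCumulants_stieltjesSum (h : IsStream P l F N ξ)
    (hF : Integrable (fun r : ℝ => r ^ 4) F) (w : ℝ → ℝ) {t u : ℝ} (ht : 0 ≤ t) (htu : t ≤ u)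
    (n : ℕ) : HasCumulants (fun ω => stieltjesSum w (fun s => cumVolume N ξ s ω) t u n) P
      (fun r => l * (∫ x, x ^ r ∂F) * stieltjesSum (fun s => w s ^ r) id t u n) := by
  -- The time `0` is put before the nodes of `[t, u]`, so that the blocks start with the first
  -- order. The extra block of orders up to `t` gets the weight `a 0 = 0`.
  let τ : ℕ → ℝ≥0 := fun i => Nat.casesOn i 0 fun j => (node t u n j).toNNReal
  have hnode : ∀ i, 0 ≤ node t u n i := fun i => by
    have := node_mono htu n (Nat.zero_le i)
    rw [node_zero] at this
    linarith
  have hτ : Monotone τ := monotone_nat_of_le_succ fun i => by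
    cases i with
    | zero => exact zero_le
    | succ j => exact Real.toNNReal_le_toNNReal (node_mono htu n (Nat.le_succ j))
  have hB := h.isBlockModel hτ
  have hlaw : ∀ i, P.map (fun ω => N (τ (i + 1)) ω - N (τ i) ω) =
      poissonMeasure (l * (τ (i + 1) - τ i)) := fun i =>
    (h.poisson.law _ _ (hτ (Nat.le_succ i))).map_eq
  let a : ℕ → ℝ := fun i => Nat.casesOn i 0 fun j => w (node t u n j)
  have hc := hB.hasCumulants_weighted_sum hF a (fun i => l * (τ (i + 1) - τ i)) (n + 2) hlaw
  refine (hc.congr ?_).congr_cumulants fun r hr => ?_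
  · filter_upwards [h.ae_blockSum_eq hτ rfl] with ω hω
    simp only [hω]
    rw [Finset.sum_range_succ', show a 0 = 0 from rfl, zero_mul, add_zero]
    simp only [a, τ, Real.coe_toNNReal _ (hnode _)]
    rfl
  · rw [Finset.sum_range_succ']
    have h0 : a 0 ^ r = 0 := by
      simp only [a]
      exact zero_pow (by omega)
    rw [h0, zero_mul, add_zero, stieltjesSum, Finset.mul_sum]
    refine Finset.sum_congr rfl fun i _ => ?_
    have hd : ((τ (i + 1 + 1) - τ (i + 1) : ℝ≥0) : ℝ) = node t u n (i + 1) - node t u n i := by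
      rw [NNReal.coe_sub (hτ (Nat.le_succ (i + 1)))]
      simp only [τ, Real.coe_toNNReal _ (hnode _)]
    simp only [NNReal.coe_mul, hd, a, id]
    ring

theorem ae_tendsto_stochInt (h : IsStream P l F N ξ) {w w' : ℝ → ℝ}
    (hw : ∀ s, HasDerivAt w (w' s) s) (hw' : Continuous w') {t u : ℝ} (htu : t ≤ u) :
    ∀ᵐ ω ∂P, Filter.Tendsto (stieltjesSum w (fun s => cumVolume N ξ s ω) t u) Filter.atTop
        (nhds (stochInt w N ξ t u ω)) ∧
      stochInt w N ξ t u ω = w u * (cumVolume N ξ u ω - cumVolume N ξ t ω) -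
        ∫ s in t..u, w' s * (cumVolume N ξ s ω - cumVolume N ξ t ω) := by
  filter_upwards [h.ae_monotone_cumVolume] with ω hω
  have hl := tendsto_stieltjesSum htu hw hw' (hω.monotoneOn (Icc t u))
  have e := hl.limUnder_eq
  exact ⟨by rw [stochInt, e]; exact hl, e⟩

/-- Stieltjes sums are weighted sums of independent compound Poisson increments, so their cumulants
are Riemann sums for the claimed ones. The passage to the limit is dominated by a multiple of the
total volume. -/
theorem hasCumulants_stochInt (h : IsStream P l F N ξ) (hF : Integrable (fun r : ℝ => r ^ 4) F)
    {w w' : ℝ → ℝ} (hw : ∀ s, HasDerivAt w (w' s) s) (hw' : Continuous w') {t u : ℝ}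
    (ht : 0 ≤ t) (htu : t ≤ u) :
    HasCumulants (stochInt w N ξ t u) P
      (fun r => l * (∫ x, x ^ r ∂F) * ∫ s in t..u, w s ^ r) := by
  have hp := h.indepξ.isProbabilityMeasure
  have hwc : Continuous w := continuous_iff_continuousAt.2 fun s => (hw s).continuousAt
  obtain ⟨C, hC⟩ := (isCompact_Icc (a := t) (b := u)).exists_bound_of_continuousOn
    hwc.continuousOn
  -- The dominating variable `C * (O u - O t)` is itself a Stieltjes sum with one cell and constant
  -- weight, hence has a finite fourth moment.
  have hV := (h.hasCumulants_stieltjesSum hF (fun _ => C) ht htu 0)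
  have hVe : ∀ ω, stieltjesSum (fun _ => C) (fun s => cumVolume N ξ s ω) t u 0 =
      C * (cumVolume N ξ u ω - cumVolume N ξ t ω) := fun ω => by
    rw [stieltjesSum, ← Finset.mul_sum, sum_node_sub (fun s => cumVolume N ξ s ω)]
  simp only [hVe] at hV
  refine HasCumulants.of_tendsto (fun n => h.hasCumulants_stieltjesSum hF w ht htu n) hV.int4
    hV.aemeas (fun n => ?_) ?_ fun r => ?_
  · filter_upwards [h.ae_monotone_cumVolume] with ω hω
    exact abs_stieltjesSum_le htu (hω.monotoneOn _) hC n
  · filter_upwards [h.ae_tendsto_stochInt hw hw' htu] with ω hω using hω.1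
  · refine (tendsto_stieltjesSum_id htu (w := fun s => w s ^ r)
      (w' := fun s => r * w s ^ (r - 1) * w' s) (fun s => (hw s).pow r) ?_).const_mul _
    fun_prop

end IsStream

/-- Each side of each currency pair gives a compound Poisson order flow. -/
theorem IsOrderFlow.isStream {m : Model} [IsProbabilityMeasure P]
    {N : Pair → Side → ℝ≥0 → Ω → ℕ}
    {ξ : Pair → Side → ℕ → Ω → ℝ} (h : IsOrderFlow m P N ξ) (k : Pair) (s : Side) :
    IsStream P (m.lam k s) (m.F k s) (N k s) (ξ k s) := by
  have hle : ∀ i, Sum.elim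
      (fun j : Pair × Side =>
        ⨆ t : ℝ≥0, MeasurableSpace.comap (N j.1 j.2 t) inferInstance)
      (fun j : Pair × Side × ℕ =>
        MeasurableSpace.comap (ξ j.1 j.2.1 j.2.2) inferInstance) i ≤ ‹MeasurableSpace Ω› := by
    rintro (j | j)
    · exact iSup_le fun t => ((h.poisson _ _).measurable t).comap_le
    · exact (h.measurable _ _ _).comap_le
  refine ⟨h.poisson k s, h.measurable k s, ?_, fun n => (h.law k s n).map_eq, ?_, m.F_supp k s⟩
  · exact h.indep.precomp (g := fun n => Sum.inr (k, s, n)) fun a b hab => by simpa using hab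
  · have := indep_iSup_of_disjoint hle h.indep (S := {Sum.inl (k, s)})
      (T := range fun n => Sum.inr (k, s, n)) (by simp)
    refine indep_of_indep_of_le this ?_ (iSup_le fun n => ?_)
    · exact le_iSup₂_of_le (f := fun i (_ : i ∈ ({Sum.inl (k, s)} : Set _)) => Sum.elim _ _ i)
        (Sum.inl (k, s)) rfl le_rfl
    · exact le_iSup₂_of_le (f := fun i (_ : i ∈ range fun n => Sum.inr (k, s, n)) => Sum.elim _ _ i)
        (Sum.inr (k, s, n)) ⟨n, rfl⟩ le_rfl

/-- Order flows in different pairs or on different sides are independent. -/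
theorem IsOrderFlow.indep_stream {m : Model} [IsProbabilityMeasure P]
    {N : Pair → Side → ℝ≥0 → Ω → ℕ}
    {ξ : Pair → Side → ℕ → Ω → ℝ} (h : IsOrderFlow m P N ξ) {S T : Set (Pair × Side)}
    (hST : Disjoint S T) :
    Indep (⨆ j ∈ S, streamSigma (N j.1 j.2) (ξ j.1 j.2))
      (⨆ j ∈ T, streamSigma (N j.1 j.2) (ξ j.1 j.2)) P := by
  have hle : ∀ i, Sum.elim
      (fun j : Pair × Side =>
        ⨆ t : ℝ≥0, MeasurableSpace.comap (N j.1 j.2 t) inferInstance)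
      (fun j : Pair × Side × ℕ =>
        MeasurableSpace.comap (ξ j.1 j.2.1 j.2.2) inferInstance) i ≤ ‹MeasurableSpace Ω› := by
    rintro (j | j)
    · exact iSup_le fun t => ((h.poisson _ _).measurable t).comap_le
    · exact (h.measurable _ _ _).comap_le
  -- The flow to which a counting process or an order volume belongs; disjoint sets of flows have
  -- disjoint preimages.
  let π : (Pair × Side) ⊕ (Pair × Side × ℕ) → Pair × Side :=
    Sum.elim id fun j => (j.1, j.2.1)
  have key := indep_iSup_of_disjoint hle h.indep (S := π ⁻¹' S) (T := π ⁻¹' T)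
    (hST.preimage π)
  have hsub : ∀ S : Set (Pair × Side), (⨆ j ∈ S, streamSigma (N j.1 j.2) (ξ j.1 j.2)) ≤
      ⨆ i ∈ π ⁻¹' S, Sum.elim
      (fun j : Pair × Side =>
        ⨆ t : ℝ≥0, MeasurableSpace.comap (N j.1 j.2 t) inferInstance)
      (fun j : Pair × Side × ℕ =>
        MeasurableSpace.comap (ξ j.1 j.2.1 j.2.2) inferInstance) i := fun S => by
    refine iSup₂_le fun j hj => sup_le ?_ (iSup_le fun n => ?_)
    · exact le_iSup₂_of_le (f := fun i (_ : i ∈ π ⁻¹' S) => Sum.elim _ _ i) (Sum.inl j) hj le_rfl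
    · exact le_iSup₂_of_le (f := fun i (_ : i ∈ π ⁻¹' S) => Sum.elim _ _ i)
        (Sum.inr (j.1, j.2, n)) hj le_rfl
  exact indep_of_indep_of_le key (hsub S) (hsub T)

end FX

end

noncomputable section

namespace FX

/-! ### Linear equations driven by a path of finite variation -/

/-- Variation of constants for `dR = (b - A Q) du`, `Q = R + J - J t`, with the integrating factor
`W`, `W' = A W`. -/
theorem integrating_factor {W A b J Q : ℝ → ℝ} {t T q : ℝ}
    (hW : ∀ s, HasDerivAt W (W s * A s) s) (hA : Continuous A) (hb : Continuous b)
    (hJ : ∀ s, ContinuousWithinAt J (Ici s) s) (hJi : ∀ u, IntervalIntegrable J volume t u)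
    (hQi : IntervalIntegrable (fun s => b s - A s * Q s) volume t T)
    (hQ : ∀ u ∈ Icc t T, Q u = q + (∫ s in t..u, (b s - A s * Q s)) + (J u - J t))
    {u : ℝ} (hu : u ∈ Icc t T) :
    W u * Q u = W t * q + (∫ s in t..u, W s * b s) + (W u * (J u - J t) -
      ∫ s in t..u, (W s * A s) * (J s - J t)) := by
  have htT : t ≤ T := hu.1.trans hu.2
  have hWc : Continuous W := continuous_iff_continuousAt.2 fun s => (hW s).continuousAt
  -- The part of `Q` without jumps. Since `Q` is right-continuous, `R` has a right derivative at
  -- every time in `[t, T)`, which is enough for the fundamental theorem of calculus for `W * R`.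
  set R : ℝ → ℝ := fun u => q + ∫ s in t..u, (b s - A s * Q s) with hR
  have hRc : ContinuousOn R (Icc t T) := by
    refine continuousOn_const.add ?_
    rw [← uIcc_of_le htT]
    exact intervalIntegral.continuousOn_primitive_interval
      (by
        rw [uIcc_of_le htT]
        exact (intervalIntegrable_iff_integrableOn_Icc_of_le htT).1 hQi)
  have hQR : ∀ s ∈ Icc t T, Q s = R s + (J s - J t) := hQ
  have hRd : ∀ s ∈ Ico t T, HasDerivWithinAt R (b s - A s * Q s) (Ioi s) s := by
    intro s hs
    have hsT : Icc s T ⊆ Icc t T := Icc_subset_Icc hs.1 le_rfl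
    have hcw : ContinuousWithinAt (fun s => b s - A s * Q s) (Ioi s) s := by
      have h1 : ContinuousWithinAt (fun v => b v - A v * (R v + (J v - J t))) (Icc s T) s :=
        hb.continuousWithinAt.sub (hA.continuousWithinAt.mul
          (((hRc s ⟨hs.1, hs.2.le⟩).mono hsT).add
            (((hJ s).mono Icc_subset_Ici_self).sub continuousWithinAt_const)))
      have h2 : ContinuousWithinAt (fun v => b v - A v * Q v) (Icc s T) s :=
        h1.congr (fun v hv => by rw [hQR v (hsT hv)]) (by rw [hQR s ⟨hs.1, hs.2.le⟩])
      refine (h2.mono_of_mem_nhdsWithin ?_)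
      exact Filter.mem_of_superset (Ioc_mem_nhdsGT hs.2) Ioc_subset_Icc_self
    have hts : IntervalIntegrable (fun s => b s - A s * Q s) volume t s :=
      hQi.mono_set (by
        rw [uIcc_of_le htT, uIcc_of_le hs.1]
        exact Icc_subset_Icc le_rfl hs.2.le)
    have hm : StronglyMeasurableAtFilter (fun s => b s - A s * Q s) (nhdsWithin s (Ioi s)) := by
      refine ⟨Ioc s T, Ioc_mem_nhdsGT hs.2, ?_⟩
      have := (hQi.mono_set (c := s) (d := T) (by
        rw [uIcc_of_le htT, uIcc_of_le hs.2.le]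
        exact Icc_subset_Icc hs.1 le_rfl)).1.aestronglyMeasurable
      exact this
    exact ((intervalIntegral.integral_hasDerivWithinAt_right hts (s := Ici s) (t := Ioi s)
      hm hcw).mono Ioi_subset_Ici_self).const_add q
  have hsub : Icc t u ⊆ Icc t T := Icc_subset_Icc le_rfl hu.2
  have hint2 : IntervalIntegrable (fun s => (W s * A s) * (J s - J t)) volume t u :=
    ((hJi u).sub intervalIntegrable_const).continuousOn_mul (hWc.mul hA).continuousOn
  have hint1 : IntervalIntegrable (fun s => W s * b s) volume t u :=
    (hWc.mul hb).intervalIntegrable _ _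
  have hfund := intervalIntegral.integral_eq_sub_of_hasDeriv_right (a := t) (b := u)
    (f := fun s => W s * R s) (f' := fun s => W s * b s - (W s * A s) * (J s - J t))
    (by
      rw [uIcc_of_le hu.1]
      exact hWc.continuousOn.mul (hRc.mono hsub))
    (by
      rw [min_eq_left hu.1, max_eq_right hu.1]
      intro s hs
      have hs' : s ∈ Ico t T := ⟨hs.1.le, hs.2.trans_le hu.2⟩
      refine ((hW s).hasDerivWithinAt.mul (hRd s hs')).congr_deriv ?_
      rw [hQR s ⟨hs'.1, hs'.2.le⟩]
      ring)
    (hint1.sub hint2)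
  rw [intervalIntegral.integral_sub hint1 hint2] at hfund
  have hRt : R t = q := by simp [hR]
  simp only [hRt] at hfund
  rw [hQR u hu]
  linarith

variable {Ω : Type*}

theorem continuousWithinAt_cumVolume {N : ℝ≥0 → Ω → ℕ} (ξ : ℕ → Ω → ℝ) {ω : Ω}
    (h : ∀ t, ContinuousWithinAt (fun s => N s ω) (Ici t) t) (s : ℝ) :
    ContinuousWithinAt (fun s => cumVolume N ξ s ω) (Ici s) s := by
  have h1 : ContinuousWithinAt (fun v : ℝ => N v.toNNReal ω) (Ici s) s :=
    (h s.toNNReal).comp (t := Ici s.toNNReal) continuous_real_toNNReal.continuousWithinAt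
      fun v hv => Real.toNNReal_le_toNNReal hv
  exact (continuous_of_discreteTopology (f := fun k : ℕ => ∑ n ∈ Finset.range k, ξ n ω)
    ).continuousAt.comp_continuousWithinAt h1

/-! ### The deterministic functions of the model -/

namespace Model

variable (m : Model)

/-- Written as `α (1 - e) + a μ e`, with `e` the exponential, the denominator is a sum of two terms
with the sign of `μ`, the second of them nonzero. This uses `t ≤ T`; hence the versions of `h1` and
`h2` that are frozen after the horizon. -/
theorem den_ne_zero (k : Pair) (hk : m.muHat k ≠ 0) {t : ℝ} (ht : t ≤ m.T) :
    m.α k - (m.α k - m.a k * m.muHat k) * Real.exp (-m.muHat k * (m.T - t)) ≠ 0 := by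
  have ha := m.a_pos k
  have hα := m.α_nonneg k
  have he := Real.exp_pos (-m.muHat k * (m.T - t))
  have e : m.α k - (m.α k - m.a k * m.muHat k) * Real.exp (-m.muHat k * (m.T - t)) =
      m.α k * (1 - Real.exp (-m.muHat k * (m.T - t))) +
        m.a k * m.muHat k * Real.exp (-m.muHat k * (m.T - t)) := by ring
  rw [e]
  rcases lt_or_gt_of_ne hk with h | h
  · have h1 : 1 ≤ Real.exp (-m.muHat k * (m.T - t)) :=
      Real.one_le_exp (mul_nonneg (by linarith) (by linarith))
    have h2 : m.a k * m.muHat k * Real.exp (-m.muHat k * (m.T - t)) < 0 :=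
      mul_neg_of_neg_of_pos (mul_neg_of_pos_of_neg ha h) he
    have h3 : m.α k * (1 - Real.exp (-m.muHat k * (m.T - t))) ≤ 0 :=
      mul_nonpos_of_nonneg_of_nonpos hα (by linarith)
    linarith
  · have h1 : Real.exp (-m.muHat k * (m.T - t)) ≤ 1 :=
      Real.exp_le_one_iff.2 (mul_nonpos_of_nonpos_of_nonneg (by linarith) (by linarith))
    have h2 : 0 < m.a k * m.muHat k * Real.exp (-m.muHat k * (m.T - t)) := by positivity
    have h3 : 0 ≤ m.α k * (1 - Real.exp (-m.muHat k * (m.T - t))) :=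
      mul_nonneg hα (by linarith)
    linarith

theorem den_pos (k : Pair) {t : ℝ} (ht : t ≤ m.T) : 0 < m.a k + m.α k * (m.T - t) := by
  have := mul_nonneg (m.α_nonneg k) (sub_nonneg.2 ht)
  linarith [m.a_pos k]

/-- `h₂ᵏ`, kept constant after the horizon. -/
def h2c (k : Pair) (u : ℝ) : ℝ := m.h2 k (min u m.T)

/-- `h₁ᵏ`, kept constant after the horizon. -/
def h1c (k : Pair) (u : ℝ) : ℝ := m.h1 k (min u m.T)

theorem h2c_eq (k : Pair) {u : ℝ} (hu : u ≤ m.T) : m.h2c k u = m.h2 k u := by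
  rw [h2c, min_eq_left hu]

theorem h1c_eq (k : Pair) {u : ℝ} (hu : u ≤ m.T) : m.h1c k u = m.h1 k u := by
  rw [h1c, min_eq_left hu]

theorem continuous_h2c (k : Pair) : Continuous (m.h2c k) := by
  unfold h2c h2
  split_ifs with hk
  · exact Continuous.div (by fun_prop) (by fun_prop) fun u =>
      (m.den_pos k (min_le_right u m.T)).ne'
  · exact Continuous.div (by fun_prop) (by fun_prop) fun u =>
      m.den_ne_zero k hk (min_le_right u m.T)

theorem continuous_h1c (k : Pair) : Continuous (m.h1c k) := by
  unfold h1c h1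
  split_ifs with hk
  · exact Continuous.mul (by fun_prop) (Continuous.div (by fun_prop) (by fun_prop) fun u =>
      (m.den_pos k (min_le_right u m.T)).ne')
  · exact Continuous.div (by fun_prop) (by fun_prop) fun u =>
      m.den_ne_zero k hk (min_le_right u m.T)

/-- The rate of mean reversion of the auxiliary inventory. -/
def revert (k : Pair) (u : ℝ) : ℝ := m.h2c k u / m.a k

/-- The constant part of the drift of the auxiliary inventory. -/
def drift (k : Pair) (u : ℝ) : ℝ := -(m.h1c k u / (2 * m.a k))

theorem continuous_revert (k : Pair) : Continuous (m.revert k) := (m.continuous_h2c k).div_const _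

theorem continuous_drift (k : Pair) : Continuous (m.drift k) :=
  ((m.continuous_h1c k).div_const _).neg

theorem beta_eq (k : Pair) {u : ℝ} (hu : u ≤ m.T) (q : ℝ) :
    m.beta k u q = m.drift k u - m.revert k u * q := by
  have := (m.a_pos k).ne'
  rw [beta, drift, revert, m.h1c_eq k hu, m.h2c_eq k hu]
  field_simp
  ring

/-- The integrating factor of the equation for the auxiliary inventory. -/
def wt (k : Pair) (u : ℝ) : ℝ := Real.exp (∫ s in (0 : ℝ)..u, m.revert k s)

theorem wt_pos (k : Pair) (u : ℝ) : 0 < m.wt k u := Real.exp_pos _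

theorem hasDerivAt_wt (k : Pair) (u : ℝ) :
    HasDerivAt (m.wt k) (m.wt k u * m.revert k u) u :=
  ((m.continuous_revert k).integral_hasStrictDerivAt 0 u).hasDerivAt.exp

theorem continuous_wt (k : Pair) : Continuous (m.wt k) :=
  continuous_iff_continuousAt.2 fun u => (m.hasDerivAt_wt k u).continuousAt

/-- The contribution of the constant part of the drift, with the integrating factor. -/
def shift (k : Pair) (u : ℝ) : ℝ := ∫ s in (0 : ℝ)..u, m.wt k s * m.drift k s

theorem hasDerivAt_shift (k : Pair) (u : ℝ) :
    HasDerivAt (m.shift k) (m.wt k u * m.drift k u) u :=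
  (((m.continuous_wt k).mul (m.continuous_drift k)).integral_hasStrictDerivAt 0 u).hasDerivAt

theorem continuous_shift (k : Pair) : Continuous (m.shift k) :=
  continuous_iff_continuousAt.2 fun u => (m.hasDerivAt_shift k u).continuousAt

end Model

variable [MeasurableSpace Ω] {P : Measure Ω}

/-- The martingale part of the auxiliary inventory, with the integrating factor. -/
def noise (m : Model) (N : Pair → Side → ℝ≥0 → Ω → ℕ) (ξ : Pair → Side → ℕ → Ω → ℝ)
    (k : Pair) (t u : ℝ) (ω : Ω) : ℝ :=
  stochInt (m.wt k) (N k .sell) (ξ k .sell) t u ω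
    + -1 * stochInt (m.wt k) (N k .buy) (ξ k .buy) t u ω

/-- Pathwise variation of constants with `J` the net volume, sells minus buys. The jump term comes
out integrated by parts, which is the form in which the two stochastic integrals are known. -/
theorem IsAuxInventory.ae_eq {m : Model} [IsProbabilityMeasure P]
    {N : Pair → Side → ℝ≥0 → Ω → ℕ} {ξ : Pair → Side → ℕ → Ω → ℝ} (hflow : IsOrderFlow m P N ξ)
    {k : Pair} {t q : ℝ} {Q : ℝ → Ω → ℝ} (hQ : IsAuxInventory m P N ξ k t q Q)
    {u : ℝ} (hu : u ∈ Icc t m.T) :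
    ∀ᵐ ω ∂P, m.wt k u * Q u ω - m.shift k u =
      m.wt k t * q - m.shift k t + noise m N ξ k t u ω := by
  have hw' : Continuous fun s => m.wt k s * m.revert k s :=
    (m.continuous_wt k).mul (m.continuous_revert k)
  filter_upwards [hQ.integrable, hQ.sde, (hflow.isStream k .sell).ae_monotone_cumVolume,
    (hflow.isStream k .buy).ae_monotone_cumVolume,
    (hflow.isStream k .sell).poisson.rightCont, (hflow.isStream k .buy).poisson.rightCont,
    (hflow.isStream k .sell).ae_tendsto_stochInt (m.hasDerivAt_wt k) hw' hu.1,
    (hflow.isStream k .buy).ae_tendsto_stochInt (m.hasDerivAt_wt k) hw' hu.1]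
    with ω hInt hsde hmS hmB hrS hrB hS hB
  set S : ℝ → ℝ := fun s => cumVolume (N k .sell) (ξ k .sell) s ω
  set B : ℝ → ℝ := fun s => cumVolume (N k .buy) (ξ k .buy) s ω
  have hSi : ∀ u, IntervalIntegrable S volume t u := fun u => hmS.intervalIntegrable
  have hBi : ∀ u, IntervalIntegrable B volume t u := fun u => hmB.intervalIntegrable
  have htT : t ≤ m.T := hu.1.trans hu.2
  have hcongr : ∀ v ∈ Icc t m.T, ∫ s in t..v, m.beta k s (Q s ω) =
      ∫ s in t..v, (m.drift k s - m.revert k s * Q s ω) := fun v hv =>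
    intervalIntegral.integral_congr fun s hs => by
      rw [uIcc_of_le hv.1] at hs
      exact m.beta_eq k (hs.2.trans hv.2) _
  have key := integrating_factor (W := m.wt k) (A := m.revert k) (b := m.drift k)
    (J := fun s => S s - B s) (Q := fun s => Q s ω) (t := t) (T := m.T) (q := q)
    (m.hasDerivAt_wt k) (m.continuous_revert k) (m.continuous_drift k)
    (fun s => (continuousWithinAt_cumVolume _ hrS s).sub (continuousWithinAt_cumVolume _ hrB s))
    (fun u => (hSi u).sub (hBi u))
    (hInt.congr (by
      intro s hs
      rw [uIoc_of_le htT] at hs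
      exact m.beta_eq k hs.2 _))
    (fun v hv => by
      rw [hsde v hv, hcongr v hv]
      simp only [S, B]
      ring) hu
  have hsh : ∫ s in t..u, m.wt k s * m.drift k s = m.shift k u - m.shift k t :=
    intervalIntegral.integral_eq_sub_of_hasDerivAt (fun s _ => m.hasDerivAt_shift k s)
      (((m.continuous_wt k).mul (m.continuous_drift k)).intervalIntegrable _ _)
  have hsplit : ∫ s in t..u, (m.wt k s * m.revert k s) * (S s - B s - (S t - B t)) =
      (∫ s in t..u, (m.wt k s * m.revert k s) * (S s - S t)) -
        ∫ s in t..u, (m.wt k s * m.revert k s) * (B s - B t) := by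
    rw [← intervalIntegral.integral_sub]
    · congr 1
      funext s
      ring
    · exact ((hSi u).sub intervalIntegrable_const).continuousOn_mul hw'.continuousOn
    · exact ((hBi u).sub intervalIntegrable_const).continuousOn_mul hw'.continuousOn
  rw [noise, hS.2, hB.2]
  rw [hsh, hsplit] at key
  simp only [S, B] at key ⊢
  linarith

end FX

end

noncomputable section

namespace FX

/-! ### Coefficient functions: functions of time and inventories -/

/-- `G` is continuous on `[0, T]`, and has the continuous partial derivatives `Gt` and `Gq` on
`[0, T)`. -/
structure IsC1 (T : ℝ) (G Gt : ℝ → (Pair → ℝ) → ℝ) (Gq : Pair → ℝ → (Pair → ℝ) → ℝ) : Prop where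
  cont : ContinuousOn (fun z : ℝ × (Pair → ℝ) => G z.1 z.2) (Icc 0 T ×ˢ univ)
  cont_t : ContinuousOn (fun z : ℝ × (Pair → ℝ) => Gt z.1 z.2) (Ico 0 T ×ˢ univ)
  cont_q : ∀ k, ContinuousOn (fun z : ℝ × (Pair → ℝ) => Gq k z.1 z.2) (Ico 0 T ×ˢ univ)
  deriv_t : ∀ t ∈ Ico 0 T, ∀ q, HasDerivWithinAt (fun s => G s q) (Gt t q) (Icc 0 T) t
  deriv_q : ∀ k, ∀ t ∈ Ico 0 T, ∀ q : Pair → ℝ,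
    HasDerivAt (fun v => G t (Function.update q k v)) (Gq k t q) (q k)

theorem Ico_prod_subset (T : ℝ) :
    (Ico 0 T ×ˢ univ : Set (ℝ × (Pair → ℝ))) ⊆ Icc 0 T ×ˢ univ :=
  prod_mono Ico_subset_Icc_self le_rfl

namespace IsC1

variable {T : ℝ} {G Gt H Ht : ℝ → (Pair → ℝ) → ℝ} {Gq Hq : Pair → ℝ → (Pair → ℝ) → ℝ}

theorem add (hG : IsC1 T G Gt Gq) (hH : IsC1 T H Ht Hq) :
    IsC1 T (fun t q => G t q + H t q) (fun t q => Gt t q + Ht t q)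
      (fun k t q => Gq k t q + Hq k t q) where
  cont := hG.cont.add hH.cont
  cont_t := hG.cont_t.add hH.cont_t
  cont_q k := (hG.cont_q k).add (hH.cont_q k)
  deriv_t t ht q := (hG.deriv_t t ht q).add (hH.deriv_t t ht q)
  deriv_q k t ht q := (hG.deriv_q k t ht q).add (hH.deriv_q k t ht q)

theorem mul (hG : IsC1 T G Gt Gq) (hH : IsC1 T H Ht Hq) :
    IsC1 T (fun t q => G t q * H t q) (fun t q => Gt t q * H t q + G t q * Ht t q)
      (fun k t q => Gq k t q * H t q + G t q * Hq k t q) where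
  cont := hG.cont.mul hH.cont
  cont_t := (hG.cont_t.mul (hH.cont.mono (Ico_prod_subset T))).add
    ((hG.cont.mono (Ico_prod_subset T)).mul hH.cont_t)
  cont_q k := ((hG.cont_q k).mul (hH.cont.mono (Ico_prod_subset T))).add
    ((hG.cont.mono (Ico_prod_subset T)).mul (hH.cont_q k))
  deriv_t t ht q := (hG.deriv_t t ht q).mul (hH.deriv_t t ht q)
  deriv_q k t ht q := by
    have := (hG.deriv_q k t ht q).mul (hH.deriv_q k t ht q)
    simp only [Function.update_eq_self] at this
    exact this

theorem of_time {τ τ' : ℝ → ℝ} (h : ∀ t, HasDerivAt τ (τ' t) t) (h' : Continuous τ') :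
    IsC1 T (fun t _ => τ t) (fun t _ => τ' t) (fun _ _ _ => 0) where
  cont := ((continuous_iff_continuousAt.2 fun s => (h s).continuousAt).comp
    continuous_fst).continuousOn
  cont_t := (h'.comp continuous_fst).continuousOn
  cont_q _ := continuousOn_const
  deriv_t t _ _ := (h t).hasDerivWithinAt
  deriv_q _ _ _ _ := hasDerivAt_const _ _

theorem const_mul (c : ℝ) (hG : IsC1 T G Gt Gq) :
    IsC1 T (fun t q => c * G t q) (fun t q => c * Gt t q) (fun k t q => c * Gq k t q) where
  cont := continuousOn_const.mul hG.cont
  cont_t := continuousOn_const.mul hG.cont_t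
  cont_q k := continuousOn_const.mul (hG.cont_q k)
  deriv_t t ht q := (hG.deriv_t t ht q).const_mul c
  deriv_q k t ht q := (hG.deriv_q k t ht q).const_mul c

theorem sum {ι : Type*} (s : Finset ι) {G Gt : ι → ℝ → (Pair → ℝ) → ℝ}
    {Gq : ι → Pair → ℝ → (Pair → ℝ) → ℝ} (h : ∀ i ∈ s, IsC1 T (G i) (Gt i) (Gq i)) :
    IsC1 T (fun t q => ∑ i ∈ s, G i t q) (fun t q => ∑ i ∈ s, Gt i t q)
      (fun k t q => ∑ i ∈ s, Gq i k t q) where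
  cont := continuousOn_finsetSum _ fun i hi => (h i hi).cont
  cont_t := continuousOn_finsetSum _ fun i hi => (h i hi).cont_t
  cont_q k := continuousOn_finsetSum _ fun i hi => (h i hi).cont_q k
  deriv_t t ht q := HasDerivWithinAt.fun_sum fun i hi => (h i hi).deriv_t t ht q
  deriv_q k t ht q := HasDerivAt.fun_sum fun i hi => (h i hi).deriv_q k t ht q

theorem congr (hG : IsC1 T G Gt Gq) (e : ∀ t ∈ Icc 0 T, ∀ q, H t q = G t q) :
    IsC1 T H Gt Gq where
  cont := hG.cont.congr fun z hz => e z.1 hz.1 z.2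
  cont_t := hG.cont_t
  cont_q := hG.cont_q
  deriv_t t ht q := (hG.deriv_t t ht q).congr (fun s hs => e s hs q)
    (e t (Ico_subset_Icc_self ht) q)
  deriv_q k t ht q := by
    have : (fun v => H t (Function.update q k v)) = fun v => G t (Function.update q k v) :=
      funext fun v => e t (Ico_subset_Icc_self ht) _
    rw [this]
    exact hG.deriv_q k t ht q

theorem continuous_q (hG : IsC1 T G Gt Gq) {t : ℝ} (ht : t ∈ Icc 0 T) : Continuous (G t) := by
  have : ContinuousOn (fun q : Pair → ℝ => G t q) univ :=
    hG.cont.comp (f := fun q : Pair → ℝ => (t, q)) (by fun_prop) fun q _ => ⟨ht, mem_univ _⟩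
  exact continuousOn_univ.1 this

end IsC1

/-- The size of a vector of inventories. -/
def qsize (q : Pair → ℝ) : ℝ := 1 + ∑ k, |q k|

theorem one_le_qsize (q : Pair → ℝ) : 1 ≤ qsize q := by
  have : 0 ≤ ∑ k, |q k| := Finset.sum_nonneg fun k _ => abs_nonneg _
  unfold qsize
  linarith

theorem sum_pair (f : Pair → ℝ) : ∑ k, f k = f .x + f .y + f .z := by
  change ∑ k ∈ ({.x, .y, .z} : Finset Pair), f k = _
  rw [Finset.sum_insert (by decide), Finset.sum_insert (by decide), Finset.sum_singleton]
  ring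

theorem sum_side (f : Side → ℝ) : ∑ s, f s = f .sell + f .buy := by
  change ∑ k ∈ ({.sell, .buy} : Finset Side), f k = _
  rw [Finset.sum_insert (by decide), Finset.sum_singleton]

theorem abs_sgn (s : Side) : |s.sgn| = 1 := by cases s <;> simp [Side.sgn]

/-- The product form lets a `p`-th power split into a power of the inventories and one of the order
volume, so that jumps preserve growth of degree `p` when `p`-th moments are finite. -/
theorem qsize_afterOrder_le (q : Pair → ℝ) (k : Pair) (s : Side) (r : ℝ) :
    qsize (Model.afterOrder q k s r) ≤ qsize q * (1 + |r|) := by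
  have h1 : qsize (Model.afterOrder q k s r) ≤ qsize q + |r| := by
    have h2 : |q k + s.sgn * r| ≤ |q k| + |r| := by
      refine (abs_add_le _ _).trans ?_
      rw [abs_mul, abs_sgn, one_mul]
    unfold qsize Model.afterOrder
    rw [sum_pair, sum_pair]
    cases k <;> simp <;> linarith
  nlinarith [one_le_qsize q, abs_nonneg r]

/-- Polynomial growth of degree `n` in the inventories, uniformly on `[0, T]`. -/
def HasDeg (T : ℝ) (n : ℕ) (G : ℝ → (Pair → ℝ) → ℝ) : Prop :=
  ∃ C, 0 ≤ C ∧ ∀ t ∈ Icc 0 T, ∀ q, |G t q| ≤ C * qsize q ^ n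

namespace HasDeg

variable {T : ℝ} {n n' : ℕ} {G H : ℝ → (Pair → ℝ) → ℝ}

theorem add (hG : HasDeg T n G) (hH : HasDeg T n H) : HasDeg T n (fun t q => G t q + H t q) := by
  obtain ⟨C, hC, h⟩ := hG
  obtain ⟨D, hD, h'⟩ := hH
  refine ⟨C + D, by positivity, fun t ht q => (abs_add_le _ _).trans ?_⟩
  rw [add_mul]
  exact add_le_add (h t ht q) (h' t ht q)

theorem mul (hG : HasDeg T n G) (hH : HasDeg T n' H) :
    HasDeg T (n + n') (fun t q => G t q * H t q) := by
  obtain ⟨C, hC, h⟩ := hG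
  obtain ⟨D, hD, h'⟩ := hH
  refine ⟨C * D, by positivity, fun t ht q => ?_⟩
  rw [abs_mul, pow_add, mul_mul_mul_comm]
  have := (zero_le_one (α := ℝ)).trans (one_le_qsize q)
  exact mul_le_mul (h t ht q) (h' t ht q) (abs_nonneg _) (by positivity)

theorem mono (hG : HasDeg T n G) (hn : n ≤ n') : HasDeg T n' G := by
  obtain ⟨C, hC, h⟩ := hG
  exact ⟨C, hC, fun t ht q => (h t ht q).trans
    (mul_le_mul_of_nonneg_left (pow_le_pow_right₀ (one_le_qsize q) hn) hC)⟩

theorem of_time {τ : ℝ → ℝ} (h : Continuous τ) : HasDeg T 0 (fun t _ => τ t) := by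
  obtain ⟨C, hC⟩ := (isCompact_Icc (a := (0 : ℝ)) (b := T)).exists_bound_of_continuousOn
    h.continuousOn
  refine ⟨|C|, abs_nonneg _, fun t ht q => ?_⟩
  simpa using (hC t ht).trans (le_abs_self C)

theorem coord (k : Pair) : HasDeg T 1 (fun _ q => q k) := by
  refine ⟨1, zero_le_one, fun t _ q => ?_⟩
  rw [one_mul, pow_one, qsize]
  have := Finset.single_le_sum (f := fun k => |q k|) (fun k _ => abs_nonneg _) (Finset.mem_univ k)
  linarith

theorem pow (hG : HasDeg T n G) (j : ℕ) : HasDeg T (n * j) (fun t q => G t q ^ j) := by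
  induction j with
  | zero => simpa using of_time (T := T) (continuous_const (y := (1 : ℝ)))
  | succ j ih =>
    simp only [pow_succ, Nat.mul_succ]
    exact ih.mul hG

theorem const_mul (c : ℝ) (hG : HasDeg T n G) : HasDeg T n (fun t q => c * G t q) := by
  have := (of_time (T := T) (continuous_const (y := c))).mul hG
  rwa [zero_add] at this

theorem sum {ι : Type*} (s : Finset ι) {G : ι → ℝ → (Pair → ℝ) → ℝ}
    (h : ∀ i ∈ s, HasDeg T n (G i)) : HasDeg T n (fun t q => ∑ i ∈ s, G i t q) := by
  classical
  induction s using Finset.induction_on with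
  | empty => exact ⟨0, le_rfl, fun t _ q => by simp⟩
  | insert i s hi ih =>
    simp only [Finset.sum_insert hi]
    exact (h i (Finset.mem_insert_self i s)).add
      (ih fun j hj => h j (Finset.mem_insert_of_mem hj))

theorem congr (hG : HasDeg T n G) (e : ∀ t ∈ Icc 0 T, ∀ q, H t q = G t q) : HasDeg T n H := by
  obtain ⟨C, hC, h⟩ := hG
  exact ⟨C, hC, fun t ht q => by rw [e t ht q]; exact h t ht q⟩

end HasDeg

/-! ### The jump operator on functions of polynomial growth. -/

namespace Model

variable (m : Model)

/-- Change of a coefficient function when a client order arrives. -/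
def qjump (G : ℝ → (Pair → ℝ) → ℝ) (k : Pair) (s : Side) (t : ℝ) (q : Pair → ℝ) (r : ℝ) : ℝ :=
  G t (afterOrder q k s r) - G t q

/-- The part of the generator that comes from the clients' orders. -/
def jumpGen (G : ℝ → (Pair → ℝ) → ℝ) (t : ℝ) (q : Pair → ℝ) : ℝ :=
  ∑ k : Pair, ∑ s : Side, m.lam k s * ∫ r in Ioi 0, qjump G k s t q r ∂(m.F k s)

theorem integrable_one_add_pow {p : ℕ} (hp : ∀ k s, Integrable (fun r : ℝ => r ^ p) (m.F k s))
    (k : Pair) (s : Side) : Integrable (fun r : ℝ => (1 + |r|) ^ p) (m.F k s) := by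
  have := m.F_prob k s
  have h2 : Integrable (fun r : ℝ => (2 : ℝ) ^ p * (1 + |r ^ p|)) (m.F k s) :=
    ((integrable_const _).add (hp k s).abs).const_mul _
  refine h2.mono' (by fun_prop) (Filter.Eventually.of_forall fun r => ?_)
  rw [Real.norm_eq_abs, abs_of_nonneg (by positivity), abs_pow]
  rcases le_total |r| 1 with h | h
  · calc (1 + |r|) ^ p ≤ 2 ^ p := by gcongr; linarith
      _ ≤ 2 ^ p * (1 + |r| ^ p) := le_mul_of_one_le_right (by positivity)
          (by linarith [pow_nonneg (abs_nonneg r) p])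
  · calc (1 + |r|) ^ p ≤ (2 * |r|) ^ p := by gcongr; linarith
      _ = 2 ^ p * |r| ^ p := mul_pow _ _ _
      _ ≤ 2 ^ p * (1 + |r| ^ p) := by gcongr; linarith

theorem continuous_afterOrder (q : Pair → ℝ) (k : Pair) (s : Side) :
    Continuous (afterOrder q k s) := by
  unfold afterOrder
  exact continuous_const.update k (by fun_prop)

theorem abs_qjump_le {p : ℕ} {C : ℝ} (hC : 0 ≤ C) {G : ℝ → (Pair → ℝ) → ℝ} {t : ℝ}
    (hG : ∀ q, |G t q| ≤ C * qsize q ^ p) (k : Pair) (s : Side) (q : Pair → ℝ) (r : ℝ) :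
    |qjump G k s t q r| ≤ 2 * C * qsize q ^ p * (1 + |r|) ^ p := by
  have h0 := (zero_le_one (α := ℝ)).trans (one_le_qsize q)
  have h0' := (zero_le_one (α := ℝ)).trans (one_le_qsize (afterOrder q k s r))
  have h1 : |G t (afterOrder q k s r)| ≤ C * (qsize q ^ p * (1 + |r|) ^ p) := by
    refine (hG _).trans ?_
    rw [← mul_pow]
    gcongr
    exact qsize_afterOrder_le q k s r
  have h2 : |G t q| ≤ C * (qsize q ^ p * (1 + |r|) ^ p) := by
    refine (hG q).trans ?_
    gcongr
    exact le_mul_of_one_le_right (by positivity) (one_le_pow₀ (by linarith [abs_nonneg r]))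
  calc |qjump G k s t q r| ≤ |G t (afterOrder q k s r)| + |G t q| := abs_sub _ _
    _ ≤ _ := by linarith

theorem integrableOn_qjump {p : ℕ} (hp : ∀ k s, Integrable (fun r : ℝ => r ^ p) (m.F k s))
    {G : ℝ → (Pair → ℝ) → ℝ} (hG : HasDeg m.T p G) {t : ℝ} (ht : t ∈ Icc 0 m.T)
    (hc : Continuous (G t)) (k : Pair) (s : Side) (q : Pair → ℝ) :
    IntegrableOn (qjump G k s t q) (Ioi 0) (m.F k s) := by
  obtain ⟨C, hC, h⟩ := hG
  refine (((m.integrable_one_add_pow hp k s).const_mul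
    (2 * C * qsize q ^ p)).mono' ?_ (Filter.Eventually.of_forall fun r => ?_)).integrableOn
  · exact ((hc.comp (continuous_afterOrder q k s)).sub continuous_const).aestronglyMeasurable
  · exact abs_qjump_le hC (h t ht) k s q r

theorem jumpGen_sum {ι : Type*} (I : Finset ι) (c : ι → ℝ) (G : ι → ℝ → (Pair → ℝ) → ℝ)
    {t : ℝ} {q : Pair → ℝ}
    (h : ∀ i ∈ I, ∀ k s, IntegrableOn (qjump (G i) k s t q) (Ioi 0) (m.F k s)) :
    m.jumpGen (fun t q => ∑ i ∈ I, c i * G i t q) t q = ∑ i ∈ I, c i * m.jumpGen (G i) t q := by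
  have e : ∀ k s, ∫ r in Ioi 0, qjump (fun t q => ∑ i ∈ I, c i * G i t q) k s t q r ∂(m.F k s) =
      ∑ i ∈ I, c i * ∫ r in Ioi 0, qjump (G i) k s t q r ∂(m.F k s) := by
    intro k s
    simp only [← integral_const_mul]
    rw [← integral_finsetSum _ fun i hi => (h i hi k s).const_mul (c i)]
    congr 1
    funext r
    simp only [qjump, ← Finset.sum_sub_distrib, mul_sub]
  simp only [jumpGen, e, Finset.mul_sum]
  rw [Finset.sum_comm]
  conv_rhs => rw [Finset.sum_comm]
  rw [Finset.sum_comm]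
  refine Finset.sum_congr rfl fun k _ => ?_
  rw [Finset.sum_comm]
  refine Finset.sum_congr rfl fun i _ => Finset.sum_congr rfl fun s _ => ?_
  ring

end Model

end FX

end

noncomputable section

namespace FX

/-! ### Polynomial solutions of the backward equation -/

/-- Derivative of `bell n x κ` in the direction `(x', κ')`. -/
def bellD (n : ℕ) (x : ℝ) (κ : ℕ → ℝ) (x' : ℝ) (κ' : ℕ → ℝ) : ℝ :=
  n * bell (n - 1) x κ * x' + ∑ r ∈ Finset.Icc 1 4, (n.choose r : ℝ) * κ' r * bell (n - r) x κ

theorem sum_Icc_one_four (f : ℕ → ℝ) : ∑ r ∈ Finset.Icc 1 4, f r = f 1 + f 2 + f 3 + f 4 := by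
  rw [Finset.sum_Icc_succ_top (by norm_num), Finset.sum_Icc_succ_top (by norm_num),
    Finset.sum_Icc_succ_top (by norm_num)]
  simp

/-- With the exponential generating function `exp (x s + ∑ κ r s ^ r / r!)`, differentiating in `x`
or `κ r` lowers `n` by `1` or `r`, with a binomial factor. Terms with `r > n` drop out, because the
binomial coefficient is zero where `n - r` is truncated. -/
theorem hasDerivAt_bell {X : ℝ → ℝ} {κ : ℕ → ℝ → ℝ} {X' t : ℝ} {κ' : ℕ → ℝ} {n : ℕ} (hn : n ≤ 4)
    (hX : HasDerivAt X X' t) (hκ : ∀ r, HasDerivAt (κ r) (κ' r) t) :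
    HasDerivAt (fun s => bell n (X s) (fun r => κ r s))
      (bellD n (X t) (fun r => κ r t) X' κ') t := by
  have h1 := hX.add (hκ 1)
  have h2 := hκ 2
  have h3 := hκ 3
  have h4 := hκ 4
  unfold bellD
  rw [sum_Icc_one_four]
  interval_cases n <;> simp only [bell]
  · exact (hasDerivAt_const t (1 : ℝ)).congr_deriv (by simp)
  · exact h1.congr_deriv (by simp [Nat.choose])
  · refine ((h1.pow 2).add h2).congr_deriv ?_
    simp [Nat.choose]
    ring
  · refine (((h1.pow 3).add ((h2.const_mul 3).mul h1)).add h3).congr_deriv ?_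
    simp [Nat.choose]
    ring
  · refine (((((h1.pow 4).add ((h2.const_mul 6).mul (h1.pow 2))).add
      ((h3.const_mul 4).mul h1)).add h4).add ((h2.pow 2).const_mul 3)).congr_deriv ?_
    simp [Nat.choose]
    ring

/-- Taylor expansion of an Appell sequence. The right-hand side has the shape of the `κ`-derivatives
in `bellD`, with `y ^ r` in the place of `κ' r`; this is what makes drift of cumulants and jumps
cancel. -/
theorem bell_add {n : ℕ} (hn : n ≤ 4) (x y : ℝ) (κ : ℕ → ℝ) :
    bell n (x + y) κ - bell n x κ =
      ∑ r ∈ Finset.Icc 1 4, (n.choose r : ℝ) * y ^ r * bell (n - r) x κ := by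
  rw [sum_Icc_one_four]
  interval_cases n <;> simp [bell, Nat.choose] <;> ring

theorem continuous_bell {Y : Type*} [TopologicalSpace Y] {X : Y → ℝ} {κ : ℕ → Y → ℝ} (n : ℕ)
    (hX : Continuous X) (hκ : ∀ r, Continuous (κ r)) :
    Continuous fun y => bell n (X y) (fun r => κ r y) := by
  have h1 := hκ 1
  have h2 := hκ 2
  have h3 := hκ 3
  have h4 := hκ 4
  rcases n with _ | _ | _ | _ | _ | n <;> simp only [bell] <;> fun_prop

theorem continuous_bellD {Y : Type*} [TopologicalSpace Y] {X X' : Y → ℝ} {κ κ' : ℕ → Y → ℝ}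
    (n : ℕ) (hX : Continuous X) (hκ : ∀ r, Continuous (κ r)) (hX' : Continuous X')
    (hκ' : ∀ r, Continuous (κ' r)) :
    Continuous fun y => bellD n (X y) (fun r => κ r y) (X' y) (fun r => κ' r y) := by
  unfold bellD
  exact ((continuous_const.mul (continuous_bell _ hX hκ)).mul hX').add
    (continuous_finsetSum _ fun r _ =>
      (continuous_const.mul (hκ' r)).mul (continuous_bell _ hX hκ))

theorem hasDeg_bell {T : ℝ} {X : ℝ → (Pair → ℝ) → ℝ} {κ : ℕ → ℝ → ℝ} {n : ℕ} (hn : n ≤ 4)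
    (hX : HasDeg T 1 X) (hκ : ∀ r, Continuous (κ r)) :
    HasDeg T n (fun t q => bell n (X t q) (fun r => κ r t)) := by
  have hc : ∀ c : ℝ, HasDeg T 0 (fun _ _ => c) := fun c => HasDeg.of_time continuous_const
  have k0 : ∀ r, HasDeg T 0 (fun t _ => κ r t) := fun r => HasDeg.of_time (hκ r)
  have h1 : HasDeg T 1 (fun t q => X t q + κ 1 t) := hX.add ((k0 1).mono (by norm_num))
  interval_cases n <;> simp only [bell]
  · exact hc 1
  · exact h1
  · exact (h1.pow 2).add ((k0 2).mono (by norm_num))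
  · exact ((h1.pow 3).add ((((k0 2).const_mul 3).mul h1).mono (by norm_num))).add
      ((k0 3).mono (by norm_num))
  · exact ((((h1.pow 4).add ((((k0 2).const_mul 6).mul (h1.pow 2)).mono (by norm_num))).add
      ((((k0 3).const_mul 4).mul h1).mono (by norm_num))).add ((k0 4).mono (by norm_num))).add
      ((((k0 2).pow 2).const_mul 3).mono (by norm_num))

namespace Model

variable (m : Model)

/-- The rates of growth of the cumulants of the net order flow in the pair `k`. -/
def cumRate (k : Pair) (r : ℕ) : ℝ :=
  m.lam k .sell * (∫ x, x ^ r ∂(m.F k .sell)) + (-1) ^ r * (m.lam k .buy * ∫ x, x ^ r ∂(m.F k .buy))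

/-- The cumulants of the noise up to time `t`. -/
def kap (k : Pair) (r : ℕ) (t : ℝ) : ℝ := m.cumRate k r * ∫ s in (0 : ℝ)..t, m.wt k s ^ r

theorem hasDerivAt_kap (k : Pair) (r : ℕ) (t : ℝ) :
    HasDerivAt (m.kap k r) (m.cumRate k r * m.wt k t ^ r) t :=
  ((((m.continuous_wt k).pow r).integral_hasStrictDerivAt 0 t).hasDerivAt).const_mul _

theorem continuous_kap (k : Pair) (r : ℕ) : Continuous (m.kap k r) :=
  continuous_iff_continuousAt.2 fun u => (m.hasDerivAt_kap k r u).continuousAt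

/-- The inventory `v` at time `t` in the coordinate in which the drift vanishes. -/
def coordX (k : Pair) (t v : ℝ) : ℝ := m.wt k t * v - m.shift k t

/-- Polynomials of degree `n` in the inventory that are martingales along the auxiliary inventory
process. -/
def app (k : Pair) (n : ℕ) (t v : ℝ) : ℝ := bell n (m.coordX k t v) (fun r => -m.kap k r t)

/-- Time derivative of `app`. -/
def appT (k : Pair) (n : ℕ) (t v : ℝ) : ℝ :=
  bellD n (m.coordX k t v) (fun r => -m.kap k r t)
    (m.wt k t * m.revert k t * v - m.wt k t * m.drift k t)
    (fun r => -(m.cumRate k r * m.wt k t ^ r))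

/-- Derivative of `app` in the inventory. -/
def appQ (k : Pair) (n : ℕ) (t v : ℝ) : ℝ :=
  bellD n (m.coordX k t v) (fun r => -m.kap k r t) (m.wt k t) (fun _ => 0)

theorem hasDerivAt_app_t (k : Pair) {n : ℕ} (hn : n ≤ 4) (t v : ℝ) :
    HasDerivAt (fun s => m.app k n s v) (m.appT k n t v) t :=
  hasDerivAt_bell (κ := fun r s => -m.kap k r s) hn
    (((m.hasDerivAt_wt k t).mul_const v).sub (m.hasDerivAt_shift k t))
    fun r => (m.hasDerivAt_kap k r t).neg

theorem hasDerivAt_app_q (k : Pair) {n : ℕ} (hn : n ≤ 4) (t v : ℝ) :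
    HasDerivAt (fun v => m.app k n t v) (m.appQ k n t v) v := by
  refine hasDerivAt_bell (X := fun v => m.coordX k t v) (κ := fun r _ => -m.kap k r t) hn ?_
    fun r => hasDerivAt_const _ _
  exact (((hasDerivAt_id v).const_mul (m.wt k t)).sub_const (m.shift k t)).congr_deriv (mul_one _)

theorem continuous_coordX (k : Pair) : Continuous fun z : ℝ × ℝ => m.coordX k z.1 z.2 := by
  have h1 := m.continuous_wt k
  have h2 := m.continuous_shift k
  unfold coordX
  fun_prop

theorem continuous_app (k : Pair) (n : ℕ) : Continuous fun z : ℝ × ℝ => m.app k n z.1 z.2 :=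
  continuous_bell (κ := fun r (z : ℝ × ℝ) => -m.kap k r z.1) n (m.continuous_coordX k)
    fun r => ((m.continuous_kap k r).comp continuous_fst).neg

theorem continuous_appT (k : Pair) (n : ℕ) : Continuous fun z : ℝ × ℝ => m.appT k n z.1 z.2 := by
  have h1 := m.continuous_wt k
  have h2 := m.continuous_revert k
  have h3 := m.continuous_drift k
  exact continuous_bellD (κ := fun r (z : ℝ × ℝ) => -m.kap k r z.1)
    (κ' := fun r (z : ℝ × ℝ) => -(m.cumRate k r * m.wt k z.1 ^ r)) n (m.continuous_coordX k)
    (fun r => ((m.continuous_kap k r).comp continuous_fst).neg) (by fun_prop)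
    fun r => by fun_prop

theorem continuous_appQ (k : Pair) (n : ℕ) : Continuous fun z : ℝ × ℝ => m.appQ k n z.1 z.2 :=
  continuous_bellD (κ := fun r (z : ℝ × ℝ) => -m.kap k r z.1)
    (κ' := fun _ (_ : ℝ × ℝ) => 0) n (m.continuous_coordX k)
    (fun r => ((m.continuous_kap k r).comp continuous_fst).neg)
    ((m.continuous_wt k).comp continuous_fst) fun _ => continuous_const

theorem isC1_app (k : Pair) {n : ℕ} (hn : n ≤ 4) :
    IsC1 m.T (fun t q => m.app k n t (q k)) (fun t q => m.appT k n t (q k))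
      (fun l t q => if l = k then m.appQ k n t (q k) else 0) := by
  have hc : Continuous fun z : ℝ × (Pair → ℝ) => (z.1, z.2 k) := by fun_prop
  refine ⟨((m.continuous_app k n).comp hc).continuousOn,
    ((m.continuous_appT k n).comp hc).continuousOn, fun l => ?_,
    fun t _ q => (m.hasDerivAt_app_t k hn t (q k)).hasDerivWithinAt, fun l t _ q => ?_⟩
  · split_ifs
    · exact ((m.continuous_appQ k n).comp hc).continuousOn
    · exact continuousOn_const
  · split_ifs with h
    · subst h
      simpa only [Function.update_self] using m.hasDerivAt_app_q l hn t (q l)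
    · have : ∀ v, Function.update q l v k = q k := fun v =>
        Function.update_of_ne (Ne.symm h) _ _
      simp only [this]
      exact hasDerivAt_const _ _

theorem hasDeg_app (k : Pair) {n : ℕ} (hn : n ≤ 4) :
    HasDeg m.T n (fun t q => m.app k n t (q k)) := by
  refine hasDeg_bell (κ := fun r t => -m.kap k r t) hn ?_ fun r => (m.continuous_kap k r).neg
  have h1 : HasDeg m.T 1 (fun t q => m.wt k t * q k) := by
    simpa using (HasDeg.of_time (T := m.T) (m.continuous_wt k)).mul (HasDeg.coord k)
  have h2 := (HasDeg.of_time (T := m.T) (m.continuous_shift k).neg).mono (n' := 1) (by norm_num)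
  refine (h1.add h2).congr fun t _ q => ?_
  simp [coordX, sub_eq_add_neg]

/-- The volumes are nonnegative, and a possible atom at zero does not contribute to a positive
power. -/
theorem setIntegral_pow (k : Pair) (s : Side) {r : ℕ} (hr : 1 ≤ r) :
    ∫ x in Ioi 0, x ^ r ∂(m.F k s) = ∫ x, x ^ r ∂(m.F k s) := by
  refine setIntegral_eq_integral_of_ae_compl_eq_zero ?_
  have h0 : ∀ᵐ x ∂(m.F k s), 0 ≤ x := by
    rw [ae_iff]
    convert m.F_supp k s using 2
    ext x
    simp
  filter_upwards [h0] with x h1 h2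
  have : x = 0 := le_antisymm (by simpa using h2) h1
  rw [this, zero_pow (by omega)]

/-- The effect of the orders in the pair `k` on `app`. -/
def appJ (k : Pair) (n : ℕ) (t v : ℝ) : ℝ :=
  ∑ s : Side, m.lam k s * ∫ r in Ioi 0, (m.app k n t (v + s.sgn * r) - m.app k n t v) ∂(m.F k s)

/-- Two cancellations. The drift `β` compensates the explicit time derivative of the coordinate
`coordX`. A jump of volume `r` shifts this coordinate by `± wt * r`, so by `bell_add` the averaged
jumps give the binomial sum with coefficients `cumRate r * wt ^ r`, opposite to what the decrease of
the cumulants `-kap` gives. -/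
theorem backward_app (hF : ∀ k s, Integrable (fun r : ℝ => r ^ 4) (m.F k s)) (k : Pair) {n : ℕ}
    (hn : n ≤ 4) {t : ℝ} (ht : t ≤ m.T) (v : ℝ) :
    m.appT k n t v + m.beta k t v * m.appQ k n t v + m.appJ k n t v = 0 := by
  have hJ : ∀ s : Side, ∫ r in Ioi 0, (m.app k n t (v + s.sgn * r) - m.app k n t v) ∂(m.F k s) =
      ∑ r ∈ Finset.Icc 1 4, (n.choose r : ℝ) * (m.wt k t * s.sgn) ^ r *
        (∫ x, x ^ r ∂(m.F k s)) * bell (n - r) (m.coordX k t v) (fun r => -m.kap k r t) := by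
    intro s
    have := m.F_prob k s
    have e : ∀ r : ℝ, m.app k n t (v + s.sgn * r) - m.app k n t v =
        ∑ j ∈ Finset.Icc 1 4, ((n.choose j : ℝ) * (m.wt k t * s.sgn) ^ j *
          bell (n - j) (m.coordX k t v) (fun r => -m.kap k r t)) * r ^ j := by
      intro r
      have hx : m.coordX k t (v + s.sgn * r) = m.coordX k t v + (m.wt k t * s.sgn) * r := by
        unfold coordX
        ring
      rw [app, app, hx, bell_add hn]
      refine Finset.sum_congr rfl fun j _ => ?_
      rw [mul_pow]
      ring
    simp only [e]
    rw [integral_finsetSum]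
    · refine Finset.sum_congr rfl fun j hj => ?_
      rw [integral_const_mul, m.setIntegral_pow k s (Finset.mem_Icc.1 hj).1]
      ring
    · intro j hj
      exact ((integrable_pow_of_le (X := id) aemeasurable_id (hF k s)
        (Finset.mem_Icc.1 hj).2).integrableOn).const_mul _
  rw [appJ, sum_side, hJ, hJ, m.beta_eq k ht, appT, appQ, bellD, bellD]
  simp only [Side.sgn, mul_one, cumRate, sum_Icc_one_four]
  ring

/-- The products of two of the polynomials `app`. -/
def app2 (k l : Pair) (i j : ℕ) (t : ℝ) (q : Pair → ℝ) : ℝ :=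
  m.app k i t (q k) * m.app l j t (q l)

/-- `B` solves the homogeneous backward equation of the auxiliary inventories. -/
def IsHarmonic (B : ℝ → (Pair → ℝ) → ℝ) : Prop :=
  ∃ Bt Bq, IsC1 m.T B Bt Bq ∧ ∀ t ∈ Ico 0 m.T, ∀ q,
    Bt t q + (∑ k, m.beta k t (q k) * Bq k t q) + m.jumpGen B t q = 0

/-- An order changes one inventory only, so the generator acts on a product over two different pairs
by the Leibniz rule without a cross term. -/
theorem isHarmonic_app2 (hF : ∀ k s, Integrable (fun r : ℝ => r ^ 4) (m.F k s)) {k l : Pair}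
    (hkl : k ≠ l) {i j : ℕ} (hi : i ≤ 4) (hj : j ≤ 4) : m.IsHarmonic (m.app2 k l i j) := by
  refine ⟨_, _, (m.isC1_app k hi).mul (m.isC1_app l hj), fun t ht q => ?_⟩
  have hJ : m.jumpGen (m.app2 k l i j) t q =
      m.appJ k i t (q k) * m.app l j t (q l) + m.app k i t (q k) * m.appJ l j t (q l) := by
    have hs : ∀ c : Pair, (∑ s : Side, m.lam c s * ∫ r in Ioi 0,
          qjump (m.app2 k l i j) c s t q r ∂(m.F c s)) =
        (if c = k then m.appJ k i t (q k) * m.app l j t (q l) else 0) +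
          (if c = l then m.app k i t (q k) * m.appJ l j t (q l) else 0) := by
      intro c
      by_cases hck : c = k
      · subst hck
        rw [if_pos rfl, if_neg hkl, add_zero, appJ, Finset.sum_mul]
        refine Finset.sum_congr rfl fun s _ => ?_
        rw [mul_assoc, ← integral_mul_const]
        congr 2
        funext r
        simp only [qjump, app2, afterOrder, Function.update_self, Function.update_of_ne hkl.symm]
        ring
      · by_cases hcl : c = l
        · subst hcl
          rw [if_neg hck, if_pos rfl, zero_add, appJ, Finset.mul_sum]
          refine Finset.sum_congr rfl fun s _ => ?_
          rw [mul_left_comm, ← integral_const_mul (m.app k i t (q k))]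
          congr 2
          funext r
          simp only [qjump, app2, afterOrder, Function.update_self, Function.update_of_ne hkl]
          ring
        · rw [if_neg hck, if_neg hcl, add_zero]
          refine Finset.sum_eq_zero fun s _ => ?_
          simp [qjump, app2, afterOrder, Function.update_of_ne (Ne.symm hck),
            Function.update_of_ne (Ne.symm hcl)]
    rw [jumpGen, Finset.sum_congr rfl fun c _ => hs c, Finset.sum_add_distrib]
    simp
  rw [hJ]
  have hβ : ∑ c, m.beta c t (q c) * ((if c = k then m.appQ k i t (q k) else 0) * m.app l j t (q l) +
        m.app k i t (q k) * (if c = l then m.appQ l j t (q l) else 0)) =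
      m.beta k t (q k) * m.appQ k i t (q k) * m.app l j t (q l) +
        m.app k i t (q k) * (m.beta l t (q l) * m.appQ l j t (q l)) := by
    simp only [mul_add, Finset.sum_add_distrib, ite_mul, mul_ite, zero_mul, mul_zero,
      Finset.sum_ite_eq', Finset.mem_univ, if_true]
    ring
  rw [hβ]
  have h1 := m.backward_app hF k hi ht.2.le (q k)
  have h2 := m.backward_app hF l hj ht.2.le (q l)
  linear_combination m.app l j t (q l) * h1 + m.app k i t (q k) * h2

end Model

end FX

end

noncomputable section

namespace FX

variable {Ω : Type*} [MeasurableSpace Ω] {P : Measure Ω}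

/-! ### Expectations along the auxiliary inventories -/

/-- Adding an independent variable adds cumulants; for `κ'` that need not come from any variable
this is the polynomial identity obtained from `bell_add`. With `κ' = -kap u` and `κ = kap u - kap t`
it is the martingale property. -/
theorem HasCumulants.integral_bell [IsProbabilityMeasure P] {Z : Ω → ℝ} {κ : ℕ → ℝ}
    (h : HasCumulants Z P κ) {n : ℕ} (hn : n ≤ 4) (x : ℝ) (κ' : ℕ → ℝ) :
    Integrable (fun ω => bell n (x + Z ω) κ') P ∧
      ∫ ω, bell n (x + Z ω) κ' ∂P = bell n x (fun r => κ r + κ' r) := by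
  have e : ∀ ω, bell n (x + Z ω) κ' = bell n x κ' +
      (n.choose 1 * bell (n - 1) x κ') * Z ω + (n.choose 2 * bell (n - 2) x κ') * Z ω ^ 2 +
      (n.choose 3 * bell (n - 3) x κ') * Z ω ^ 3 + (n.choose 4 * bell (n - 4) x κ') * Z ω ^ 4 := by
    intro ω
    have := bell_add hn x (Z ω) κ'
    rw [sum_Icc_one_four] at this
    linear_combination this
  simp only [e]
  refine ⟨(h.integral_poly _ _ _ _ _).1, ?_⟩
  rw [(h.integral_poly _ _ _ _ _).2]
  interval_cases n <;> simp [bell, Nat.choose] <;> ring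

variable {m : Model} {N : Pair → Side → ℝ≥0 → Ω → ℕ} {ξ : Pair → Side → ℕ → Ω → ℝ}

theorem measurable_noise (k : Pair) (t u : ℝ) :
    Measurable[⨆ j ∈ {j : Pair × Side | j.1 = k}, streamSigma (N j.1 j.2) (ξ j.1 j.2)]
      (noise m N ξ k t u) := by
  have h : ∀ s, Measurable[⨆ j ∈ {j : Pair × Side | j.1 = k}, streamSigma (N j.1 j.2) (ξ j.1 j.2)]
      (stochInt (m.wt k) (N k s) (ξ k s) t u) := fun s =>
    (measurable_stochInt (m.wt k) (N k s) (ξ k s) t u).mono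
      (le_iSup₂_of_le (f := fun (j : Pair × Side) (_ : j ∈ {j : Pair × Side | j.1 = k}) =>
        streamSigma (N j.1 j.2) (ξ j.1 j.2)) (k, s) rfl le_rfl) le_rfl
  exact (h .sell).add ((h .buy).const_mul _)

theorem indepFun_noise [IsProbabilityMeasure P] (hflow : IsOrderFlow m P N ξ) {k l : Pair}
    (hkl : k ≠ l) (t u : ℝ) : IndepFun (noise m N ξ k t u) (noise m N ξ l t u) P := by
  refine indep_of_indep_of_le (hflow.indep_stream (S := {j | j.1 = k}) (T := {j | j.1 = l}) ?_)
    (measurable_noise k t u).comap_le (measurable_noise l t u).comap_le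
  exact Set.disjoint_left.2 fun j (h1 : j.1 = k) (h2 : j.1 = l) => hkl (h1.symm.trans h2)

theorem hasCumulants_noise [IsProbabilityMeasure P] (hflow : IsOrderFlow m P N ξ)
    (hF : ∀ k s, Integrable (fun r : ℝ => r ^ 4) (m.F k s)) (k : Pair) {t u : ℝ} (ht : 0 ≤ t)
    (htu : t ≤ u) :
    HasCumulants (noise m N ξ k t u) P (fun r => m.kap k r u - m.kap k r t) := by
  have hw' : Continuous fun s => m.wt k s * m.revert k s :=
    (m.continuous_wt k).mul (m.continuous_revert k)
  have h := fun s => (hflow.isStream k s).hasCumulants_stochInt (hF k s) (m.hasDerivAt_wt k) hw'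
    ht htu
  have hi : IndepFun (stochInt (m.wt k) (N k .sell) (ξ k .sell) t u)
      (fun ω => -1 * stochInt (m.wt k) (N k .buy) (ξ k .buy) t u ω) P := by
    have h0 : IndepFun (stochInt (m.wt k) (N k .sell) (ξ k .sell) t u)
        (stochInt (m.wt k) (N k .buy) (ξ k .buy) t u) P := by
      have hd := hflow.indep_stream (S := {(k, .sell)}) (T := {(k, .buy)}) (by simp)
      simp only [mem_singleton_iff, iSup_iSup_eq_left] at hd
      exact indep_of_indep_of_le hd (measurable_stochInt _ _ _ _ _).comap_le
        (measurable_stochInt _ _ _ _ _).comap_le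
    exact h0.comp measurable_id (measurable_const_mul (-1))
  refine ((h .sell).add ((h .buy).const_mul (-1)) hi).congr_cumulants fun r _ => ?_
  have e : ∫ s in t..u, m.wt k s ^ r =
      (∫ s in (0 : ℝ)..u, m.wt k s ^ r) - ∫ s in (0 : ℝ)..t, m.wt k s ^ r :=
    (intervalIntegral.integral_interval_sub_left
      (((m.continuous_wt k).pow r).intervalIntegrable _ _)
      (((m.continuous_wt k).pow r).intervalIntegrable _ _)).symm
  rw [e, Model.kap, Model.kap, Model.cumRate]
  ring

/-- A polynomial solution of the homogeneous backward equation that is a martingale along the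
auxiliary inventories. -/
structure IsBasis (m : Model) (P : Measure Ω) (Q : Pair → ℝ → ℝ → ℝ → Ω → ℝ) (B : ℝ → (Pair → ℝ) → ℝ) : Prop where
  harmonic : m.IsHarmonic B
  deg : HasDeg m.T 4 B
  mart : ∀ t ∈ Icc 0 m.T, ∀ u ∈ Icc t m.T, ∀ q : Pair → ℝ,
    Integrable (fun ω => B u (fun k => Q k t (q k) u ω)) P ∧
      ∫ ω, B u (fun k => Q k t (q k) u ω) ∂P = B t q

variable {Q : Pair → ℝ → ℝ → ℝ → Ω → ℝ}

/-- In the driftless coordinate the inventory is its start plus noise. The two noises are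
independent, so the expectation of the product factors into two applications of `integral_bell`. -/
theorem isBasis_app2 [IsProbabilityMeasure P] (hflow : IsOrderFlow m P N ξ)
    (hF : ∀ k s, Integrable (fun r : ℝ => r ^ 4) (m.F k s))
    (hQ : ∀ k, ∀ t ∈ Icc 0 m.T, ∀ q, IsAuxInventory m P N ξ k t q (Q k t q))
    {k l : Pair} (hkl : k ≠ l) {i j : ℕ} (hij : i + j ≤ 4) :
    IsBasis m P Q (m.app2 k l i j) where
  harmonic := m.isHarmonic_app2 hF hkl (by omega) (by omega)
  deg := ((m.hasDeg_app k (by omega)).mul (m.hasDeg_app l (by omega))).mono hij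
  mart t ht u hu q := by
    have h : ∀ c : Pair, ∀ n ≤ 4,
        Integrable (fun ω => bell n (m.coordX c t (q c) + noise m N ξ c t u ω)
          (fun r => -m.kap c r u)) P ∧
        ∫ ω, bell n (m.coordX c t (q c) + noise m N ξ c t u ω) (fun r => -m.kap c r u) ∂P =
          m.app c n t (q c) := by
      intro c n hn
      obtain ⟨h1, h2⟩ := (hasCumulants_noise hflow hF c ht.1 hu.1).integral_bell hn
        (m.coordX c t (q c)) (fun r => -m.kap c r u)
      refine ⟨h1, h2.trans ?_⟩
      rw [Model.app]
      congr 1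
      funext r
      ring
    have hae : ∀ c : Pair, ∀ n, (fun ω => m.app c n u (Q c t (q c) u ω)) =ᵐ[P]
        fun ω => bell n (m.coordX c t (q c) + noise m N ξ c t u ω) (fun r => -m.kap c r u) := by
      intro c n
      filter_upwards [(hQ c t ht (q c)).ae_eq hflow hu] with ω hω
      have : m.coordX c u (Q c t (q c) u ω) = m.coordX c t (q c) + noise m N ξ c t u ω := hω
      rw [Model.app, this]
    have hmeas : ∀ (c : Pair) (n : ℕ), Measurable fun z : ℝ =>
        bell n (m.coordX c t (q c) + z) (fun r => -m.kap c r u) := fun c n =>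
      (continuous_bell (X := fun z : ℝ => m.coordX c t (q c) + z)
        (κ := fun r _ => -m.kap c r u) n (by fun_prop) fun r => continuous_const).measurable
    have hind := (indepFun_noise hflow hkl t u).comp (hmeas k i) (hmeas l j)
    have hae2 : (fun ω => m.app2 k l i j u (fun k => Q k t (q k) u ω)) =ᵐ[P]
        fun ω => bell i (m.coordX k t (q k) + noise m N ξ k t u ω) (fun r => -m.kap k r u) *
          bell j (m.coordX l t (q l) + noise m N ξ l t u ω) (fun r => -m.kap l r u) := by
      filter_upwards [hae k i, hae l j] with ω h1 h2
      rw [Model.app2, h1, h2]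
    obtain ⟨ik, ek⟩ := h k i (by omega)
    obtain ⟨il, el⟩ := h l j (by omega)
    refine ⟨(hind.integrable_mul ik il).congr hae2.symm, ?_⟩
    rw [integral_congr_ae hae2, Model.app2, ← ek, ← el]
    exact hind.integral_fun_mul_eq_mul_integral ik.aestronglyMeasurable il.aestronglyMeasurable

/-- A combination, with continuous coefficients, of solutions of the homogeneous backward
equation. -/
def IsSource (m : Model) (P : Measure Ω) (Q : Pair → ℝ → ℝ → ℝ → Ω → ℝ) (S : ℝ → (Pair → ℝ) → ℝ) : Prop :=
  ∃ (ι : Type) (_ : Fintype ι) (d : ι → ℝ → ℝ) (B : ι → ℝ → (Pair → ℝ) → ℝ),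
    (∀ i, Continuous (d i)) ∧ (∀ i, IsBasis m P Q (B i)) ∧
    ∀ t ∈ Icc 0 m.T, ∀ q, S t q = ∑ i, d i t * B i t q

theorem IsSource.add {S S' : ℝ → (Pair → ℝ) → ℝ} (h : IsSource m P Q S) (h' : IsSource m P Q S') :
    IsSource m P Q (fun t q => S t q + S' t q) := by
  obtain ⟨ι, _, d, B, hd, hB, e⟩ := h
  obtain ⟨ι', _, d', B', hd', hB', e'⟩ := h'
  refine ⟨ι ⊕ ι', inferInstance, Sum.elim d d', Sum.elim B B', ?_, ?_, fun t ht q => ?_⟩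
  · rintro (i | i)
    exacts [hd i, hd' i]
  · rintro (i | i)
    exacts [hB i, hB' i]
  · simp [e t ht q, e' t ht q]

theorem IsSource.congr {S S' : ℝ → (Pair → ℝ) → ℝ} (h : IsSource m P Q S)
    (he : ∀ t q, S' t q = S t q) : IsSource m P Q S' := by
  obtain ⟨ι, _, d, B, hd, hB, e⟩ := h
  exact ⟨ι, inferInstance, d, B, hd, hB, fun t ht q => (he t q).trans (e t ht q)⟩

/-! ### The sources in martingale coordinates. -/

namespace Model

variable (m)

/-- The contribution of the pair `k` to the derivative of `H₀` in the exchange rates. -/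
def part (k : Pair) (u v : ℝ) : ℝ := -m.h0part k u + (1 - m.h1 k u) * v - m.h2 k u * v ^ 2

theorem dxH0_eq (u qx qz : ℝ) : m.dxH0 u qx qz = m.part .x u qx + m.part .z u qz := by
  rw [dxH0, part, part, h0x]
  ring

theorem dyH0_eq (u qy : ℝ) : m.dyH0 u qy = m.part .y u qy := by
  rw [dyH0, part, h0y]
  ring

/-- `h0part`, with the functions `h1` and `h2` kept constant after the horizon. -/
def h0c (k : Pair) (t : ℝ) : ℝ :=
  Real.exp (-m.muHat k * t) * ∫ u in t..m.T, Real.exp (m.muHat k * u) *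
    (-m.psi k + m.gamma k * m.h1c k u + m.delta k * m.h2c k u - 1 / (4 * m.a k) * m.h1c k u ^ 2)

theorem continuous_h0c (k : Pair) : Continuous (m.h0c k) := by
  have h1 := m.continuous_h1c k
  have h2 := m.continuous_h2c k
  have hc : Continuous fun u => Real.exp (m.muHat k * u) *
    (-m.psi k + m.gamma k * m.h1c k u + m.delta k * m.h2c k u -
      1 / (4 * m.a k) * m.h1c k u ^ 2) := by fun_prop
  refine Continuous.mul (by fun_prop) ?_
  simp only [intervalIntegral.integral_symm m.T]
  exact (intervalIntegral.continuous_primitive (fun a b => hc.intervalIntegrable a b) m.T).neg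

theorem h0c_eq (k : Pair) {t : ℝ} (ht : t ≤ m.T) : m.h0c k t = m.h0part k t := by
  have h1 := m.continuous_h1c k
  have h2 := m.continuous_h2c k
  have c0 : Continuous fun u => -(Real.exp (m.muHat k * (u - t)) * m.psi k) := by fun_prop
  have c1 : Continuous fun u => Real.exp (m.muHat k * (u - t)) * (m.gamma k * m.h1c k u) := by
    fun_prop
  have c2 : Continuous fun u => Real.exp (m.muHat k * (u - t)) * (m.delta k * m.h2c k u) := by
    fun_prop
  have c3 : Continuous fun u => Real.exp (m.muHat k * (u - t)) *
    (1 / (4 * m.a k) * m.h1c k u ^ 2) := by fun_prop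
  have e1 : ∫ u in t..m.T, Real.exp (m.muHat k * (u - t)) * (m.gamma k * m.h1 k u) =
      ∫ u in t..m.T, Real.exp (m.muHat k * (u - t)) * (m.gamma k * m.h1c k u) :=
    intervalIntegral.integral_congr fun u hu => by
      rw [uIcc_of_le ht] at hu
      simp only [m.h1c_eq k hu.2]
  have e2 : ∫ u in t..m.T, Real.exp (m.muHat k * (u - t)) * (m.delta k * m.h2 k u) =
      ∫ u in t..m.T, Real.exp (m.muHat k * (u - t)) * (m.delta k * m.h2c k u) :=
    intervalIntegral.integral_congr fun u hu => by
      rw [uIcc_of_le ht] at hu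
      simp only [m.h2c_eq k hu.2]
  have e3 : ∫ u in t..m.T, Real.exp (m.muHat k * (u - t)) * (1 / (4 * m.a k) * m.h1 k u ^ 2) =
      ∫ u in t..m.T, Real.exp (m.muHat k * (u - t)) * (1 / (4 * m.a k) * m.h1c k u ^ 2) :=
    intervalIntegral.integral_congr fun u hu => by
      rw [uIcc_of_le ht] at hu
      simp only [m.h1c_eq k hu.2]
  rw [h0part, e1, e2, e3, h0c, ← intervalIntegral.integral_const_mul,
    ← intervalIntegral.integral_neg,
    ← intervalIntegral.integral_add (c0.intervalIntegrable _ _) (c1.intervalIntegrable _ _),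
    ← intervalIntegral.integral_add ((c0.fun_add c1).intervalIntegrable _ _)
      (c2.intervalIntegrable _ _),
    ← intervalIntegral.integral_sub (((c0.fun_add c1).fun_add c2).intervalIntegrable _ _)
      (c3.intervalIntegrable _ _)]
  congr 1
  funext u
  rw [show m.muHat k * (u - t) = -m.muHat k * t + m.muHat k * u by ring, Real.exp_add]
  ring

/-- The contribution of a pair as a polynomial in the martingale coordinate. -/
theorem exists_part_eq (k : Pair) : ∃ a0 a1 a2 : ℝ → ℝ,
    Continuous a0 ∧ Continuous a1 ∧ Continuous a2 ∧ ∀ u ∈ Icc 0 m.T, ∀ v,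
      m.part k u v = a0 u + a1 u * (m.coordX k u v - m.kap k 1 u) +
        a2 u * (m.coordX k u v - m.kap k 1 u) ^ 2 := by
  have h0 := m.continuous_h0c k
  have h1 := m.continuous_h1c k
  have h2 := m.continuous_h2c k
  have hw : Continuous fun u => (m.wt k u)⁻¹ :=
    (m.continuous_wt k).inv₀ fun u => (m.wt_pos k u).ne'
  have hs := m.continuous_shift k
  have hk := m.continuous_kap k 1
  -- Coefficients after inserting `v = wt⁻¹ (Z + shift + kap 1)`, where `Z = coordX - kap 1` is `app
  -- 1`.
  refine ⟨fun u => -m.h0c k u + (1 - m.h1c k u) * (m.wt k u)⁻¹ * (m.shift k u + m.kap k 1 u) -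
      m.h2c k u * (m.wt k u)⁻¹ ^ 2 * (m.shift k u + m.kap k 1 u) ^ 2,
    fun u => (1 - m.h1c k u) * (m.wt k u)⁻¹ -
      2 * m.h2c k u * (m.wt k u)⁻¹ ^ 2 * (m.shift k u + m.kap k 1 u),
    fun u => -m.h2c k u * (m.wt k u)⁻¹ ^ 2, by fun_prop, by fun_prop, by fun_prop,
    fun u hu v => ?_⟩
  have hv : v = (m.wt k u)⁻¹ * (m.coordX k u v - m.kap k 1 u + (m.shift k u + m.kap k 1 u)) := by
    have := (m.wt_pos k u).ne'
    rw [coordX]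
    field_simp
    ring
  beta_reduce
  rw [part, m.h0c_eq k hu.2, m.h1c_eq k hu.2, m.h2c_eq k hu.2]
  generalize m.coordX k u v - m.kap k 1 u = Z at hv ⊢
  rw [hv]
  ring

theorem exists_part_eq_sum (k : Pair) : ∃ c : Fin 3 → ℝ → ℝ, (∀ i, Continuous (c i)) ∧
    ∀ u ∈ Icc 0 m.T, ∀ v, m.part k u v = ∑ i : Fin 3, c i u * m.app k i u v := by
  obtain ⟨a0, a1, a2, h0, h1, h2, e⟩ := m.exists_part_eq k
  have hk := m.continuous_kap k 2
  refine ⟨![fun u => a0 u + m.kap k 2 u * a2 u, a1, a2], ?_, fun u hu v => ?_⟩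
  · intro i
    fin_cases i
    · exact h0.add (hk.mul h2)
    · exact h1
    · exact h2
  · rw [e u hu v, Fin.sum_univ_three]
    simp [app, bell]
    ring

theorem exists_part_sq_eq_sum (k : Pair) : ∃ c : Fin 5 → ℝ → ℝ, (∀ i, Continuous (c i)) ∧
    ∀ u ∈ Icc 0 m.T, ∀ v, m.part k u v ^ 2 = ∑ i : Fin 5, c i u * m.app k i u v := by
  obtain ⟨a0, a1, a2, h0, h1, h2, e⟩ := m.exists_part_eq k
  have k2 := m.continuous_kap k 2
  have k3 := m.continuous_kap k 3
  have k4 := m.continuous_kap k 4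
  -- The square is a quartic in `Z`. Its powers are converted by inverting `bell`: `Z ^ 4`, for
  -- example, is `app 4 + 6 kap 2 app 2 + 4 kap 3 app 1 + kap 4 + 3 kap 2 ^ 2`.
  refine ⟨![fun u => a0 u ^ 2 + m.kap k 2 u * (a1 u ^ 2 + 2 * a0 u * a2 u) +
        m.kap k 3 u * (2 * a1 u * a2 u) + (m.kap k 4 u + 3 * m.kap k 2 u ^ 2) * a2 u ^ 2,
      fun u => 2 * a0 u * a1 u + 3 * m.kap k 2 u * (2 * a1 u * a2 u) + 4 * m.kap k 3 u * a2 u ^ 2,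
      fun u => a1 u ^ 2 + 2 * a0 u * a2 u + 6 * m.kap k 2 u * a2 u ^ 2,
      fun u => 2 * a1 u * a2 u, fun u => a2 u ^ 2], ?_, fun u hu v => ?_⟩
  · intro i
    fin_cases i <;> simp <;> fun_prop
  · rw [e u hu v, Fin.sum_univ_five]
    simp [app, bell]
    ring

end Model

theorem isSource_part_sq [IsProbabilityMeasure P] (hflow : IsOrderFlow m P N ξ)
    (hF : ∀ k s, Integrable (fun r : ℝ => r ^ 4) (m.F k s))
    (hQ : ∀ k, ∀ t ∈ Icc 0 m.T, ∀ q, IsAuxInventory m P N ξ k t q (Q k t q)) (k : Pair) :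
    IsSource m P Q (fun t q => m.part k t (q k) ^ 2) := by
  obtain ⟨c, hc, e⟩ := m.exists_part_sq_eq_sum k
  obtain ⟨l, hl⟩ : ∃ l, k ≠ l := by
    cases k
    exacts [⟨.y, by decide⟩, ⟨.x, by decide⟩, ⟨.x, by decide⟩]
  -- A second pair with exponent `0` contributes the factor `1`, so single inventories are covered
  -- by the products.
  refine ⟨Fin 5, inferInstance, c, fun i => m.app2 k l i 0, hc,
    fun i => isBasis_app2 hflow hF hQ hl (by omega), fun t ht q => ?_⟩
  beta_reduce
  rw [e t ht]
  simp [Model.app2, Model.app, bell]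

theorem isSource_part_mul [IsProbabilityMeasure P] (hflow : IsOrderFlow m P N ξ)
    (hF : ∀ k s, Integrable (fun r : ℝ => r ^ 4) (m.F k s))
    (hQ : ∀ k, ∀ t ∈ Icc 0 m.T, ∀ q, IsAuxInventory m P N ξ k t q (Q k t q)) {k l : Pair}
    (hkl : k ≠ l) : IsSource m P Q (fun t q => m.part k t (q k) * m.part l t (q l)) := by
  obtain ⟨c, hc, e⟩ := m.exists_part_eq_sum k
  obtain ⟨c', hc', e'⟩ := m.exists_part_eq_sum l
  refine ⟨Fin 3 × Fin 3, inferInstance, fun p t => c p.1 t * c' p.2 t,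
    fun p => m.app2 k l p.1 p.2, fun p => (hc _).mul (hc' _),
    fun p => isBasis_app2 hflow hF hQ hkl (by omega), fun t ht q => ?_⟩
  beta_reduce
  rw [e t ht, e' t ht, Finset.sum_mul_sum, Fintype.sum_prod_type]
  refine Finset.sum_congr rfl fun i _ => Finset.sum_congr rfl fun j _ => ?_
  rw [Model.app2]
  ring

end FX

end

noncomputable section

namespace FX

/-! ### The equation for the coefficient functions -/

/-- `G` solves the backward equation `ℒ G + c G = K S` with terminal value zero, where `ℒ` is the
generator of the auxiliary inventories. -/
def IsCoeff (m : Model) (c K : ℝ) (S G : ℝ → (Pair → ℝ) → ℝ) : Prop :=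
  (∃ Gt Gq, IsC1 m.T G Gt Gq ∧ ∀ t ∈ Ico 0 m.T, ∀ q,
    Gt t q + (∑ k, m.beta k t (q k) * Gq k t q) + m.jumpGen G t q + c * G t q - K * S t q = 0) ∧
  ∀ q, G m.T q = 0

variable {Ω : Type*} [MeasurableSpace Ω] {P : Measure Ω} {m : Model}
  {Q : Pair → ℝ → ℝ → ℝ → Ω → ℝ} {S : ℝ → (Pair → ℝ) → ℝ}

/-- Expectation of `S` along the auxiliary inventories. -/
def expS (P : Measure Ω) (Q : Pair → ℝ → ℝ → ℝ → Ω → ℝ) (S : ℝ → (Pair → ℝ) → ℝ)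
    (t : ℝ) (q : Pair → ℝ) (u : ℝ) : ℝ :=
  ∫ ω, S u (fun k => Q k t (q k) u ω) ∂P

/-- The stochastic representation with the source `S`. -/
def repS (m : Model) (P : Measure Ω) (Q : Pair → ℝ → ℝ → ℝ → Ω → ℝ) (c K : ℝ)
    (S : ℝ → (Pair → ℝ) → ℝ) (t : ℝ) (q : Pair → ℝ) : ℝ :=
  -∫ u in t..m.T, Real.exp (c * (u - t)) * K * expS P Q S t q u

theorem hasDerivAt_discounted {d : ℝ → ℝ} (hd : Continuous d) (c K T t : ℝ) :
    HasDerivAt (fun t => -(Real.exp (-c * t) * ∫ u in t..T, Real.exp (c * u) * (K * d u)))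
      (-c * -(Real.exp (-c * t) * ∫ u in t..T, Real.exp (c * u) * (K * d u)) + K * d t) t := by
  have hc : Continuous fun u => Real.exp (c * u) * (K * d u) := by fun_prop
  have h1 : HasDerivAt (fun t => ∫ u in t..T, Real.exp (c * u) * (K * d u))
      (-(Real.exp (c * t) * (K * d t))) t := by
    simp only [intervalIntegral.integral_symm T]
    exact (hc.integral_hasStrictDerivAt T t).hasDerivAt.neg
  have h2 : HasDerivAt (fun t => Real.exp (-c * t)) (Real.exp (-c * t) * -c) t := by
    have := ((hasDerivAt_id t).const_mul (-c)).exp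
    simp only [id_eq, mul_one] at this
    exact this
  refine (h2.mul h1).neg.congr_deriv ?_
  have h3 : Real.exp (-c * t) * Real.exp (c * t) = 1 := by
    rw [← Real.exp_add]
    simp
  linear_combination (K * d t) * h3

/-- Taking expectations replaces `B i u` along the inventory by `B i t q`. The dependence on `u` is
left in the coefficients `d i` alone. -/
theorem IsSource.expS_eq {ι : Type} [Fintype ι] {d : ι → ℝ → ℝ} {B : ι → ℝ → (Pair → ℝ) → ℝ}
    (hB : ∀ i, IsBasis m P Q (B i))
    (e : ∀ t ∈ Icc 0 m.T, ∀ q, S t q = ∑ i, d i t * B i t q)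
    {t : ℝ} (ht : t ∈ Icc 0 m.T) {u : ℝ} (hu : u ∈ Icc t m.T) (q : Pair → ℝ) :
    Integrable (fun ω => S u (fun k => Q k t (q k) u ω)) P ∧
      expS P Q S t q u = ∑ i, d i u * B i t q := by
  have hu' : u ∈ Icc 0 m.T := ⟨ht.1.trans hu.1, hu.2⟩
  have hi : ∀ i ∈ Finset.univ, Integrable
      (fun ω => d i u * B i u (fun k => Q k t (q k) u ω)) P := fun i _ =>
    ((hB i).mart t ht u hu q).1.const_mul _
  unfold expS
  simp only [e u hu']
  refine ⟨integrable_finsetSum _ hi, ?_⟩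
  rw [integral_finsetSum _ hi]
  refine Finset.sum_congr rfl fun i _ => ?_
  rw [integral_const_mul, ((hB i).mart t ht u hu q).2]

theorem IsSource.finite (h : IsSource m P Q S) {t : ℝ} (ht : t ∈ Icc 0 m.T) (q : Pair → ℝ) :
    (∀ u ∈ Icc t m.T, Integrable (fun ω => S u (fun k => Q k t (q k) u ω)) P) ∧
      IntervalIntegrable (expS P Q S t q) volume t m.T := by
  obtain ⟨ι, _, d, B, hd, hB, e⟩ := h
  refine ⟨fun u hu => (IsSource.expS_eq hB e ht hu q).1, ?_⟩
  have hc : Continuous fun u => ∑ i, d i u * B i t q :=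
    continuous_finsetSum _ fun i _ => (hd i).mul continuous_const
  refine (hc.intervalIntegrable t m.T).congr fun u hu => ?_
  rw [uIoc_of_le ht.2] at hu
  exact ((IsSource.expS_eq hB e ht ⟨hu.1.le, hu.2⟩ q).2).symm

/-- The time integral falls on the coefficients only, giving a sum of `τ i t * B i t q` with `τ i' =
-c τ i + K d i`. As each `B i` is annihilated by the generator, only `τ i'` remains, and it produces
the zeroth-order term and the source. -/
theorem IsSource.isCoeff (hF : ∀ k s, Integrable (fun r : ℝ => r ^ 4) (m.F k s))
    (h : IsSource m P Q S) (c K : ℝ) :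
    IsCoeff m c K S (repS m P Q c K S) ∧ HasDeg m.T 4 (repS m P Q c K S) := by
  obtain ⟨ι, _, d, B, hd, hB, e⟩ := h
  let τ : ι → ℝ → ℝ := fun i t =>
    -(Real.exp (-c * t) * ∫ u in t..m.T, Real.exp (c * u) * (K * d i u))
  have hτ : ∀ i t, HasDerivAt (τ i) (-c * τ i t + K * d i t) t := fun i t =>
    hasDerivAt_discounted (hd i) c K m.T t
  have hτc : ∀ i, Continuous (τ i) := fun i =>
    continuous_iff_continuousAt.2 fun t => (hτ i t).continuousAt
  have hG : ∀ t ∈ Icc 0 m.T, ∀ q, repS m P Q c K S t q = ∑ i, τ i t * B i t q := by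
    intro t ht q
    have e1 : ∫ u in t..m.T, Real.exp (c * (u - t)) * K * expS P Q S t q u =
        ∫ u in t..m.T, ∑ i, (Real.exp (-c * t) * B i t q) * (Real.exp (c * u) * (K * d i u)) := by
      refine intervalIntegral.integral_congr fun u hu => ?_
      rw [uIcc_of_le ht.2] at hu
      rw [(IsSource.expS_eq hB e ht hu q).2, Finset.mul_sum,
        show c * (u - t) = -c * t + c * u by ring, Real.exp_add]
      refine Finset.sum_congr rfl fun i _ => ?_
      ring
    rw [repS, e1, intervalIntegral.integral_finsetSum, ← Finset.sum_neg_distrib]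
    · refine Finset.sum_congr rfl fun i _ => ?_
      rw [intervalIntegral.integral_const_mul]
      simp only [τ]
      ring
    · intro i _
      have := hd i
      exact (by fun_prop : Continuous fun u => (Real.exp (-c * t) * B i t q) *
        (Real.exp (c * u) * (K * d i u))).intervalIntegrable _ _
  choose Bt Bq hB1 hB2 using fun i => (hB i).harmonic
  have hC1 := IsC1.sum (T := m.T) Finset.univ fun i _ =>
    (IsC1.of_time (hτ i) (((hτc i).const_mul (-c)).add ((hd i).const_mul K))).mul (hB1 i)
  have hdeg : HasDeg m.T 4 (fun t q => ∑ i, τ i t * B i t q) := HasDeg.sum _ fun i _ => by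
    simpa using (HasDeg.of_time (T := m.T) (hτc i)).mul (hB i).deg
  refine ⟨⟨⟨_, _, hC1.congr hG, fun t ht q => ?_⟩, fun q => ?_⟩, hdeg.congr hG⟩
  · have ht' : t ∈ Icc 0 m.T := Ico_subset_Icc_self ht
    have hJ : m.jumpGen (repS m P Q c K S) t q = ∑ i, τ i t * m.jumpGen (B i) t q := by
      -- The jump operator looks at the single time `t`, so the time-dependent weights may be frozen
      -- there.
      rw [← m.jumpGen_sum Finset.univ (fun i => τ i t) B fun i _ k s =>
        m.integrableOn_qjump hF (hB i).deg ht' ((hB1 i).continuous_q ht') k s q]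
      unfold Model.jumpGen Model.qjump
      simp only [hG t ht']
    have hβ : ∑ k, m.beta k t (q k) * ∑ i, (0 * B i t q + τ i t * Bq i k t q) =
        ∑ i, τ i t * ∑ k, m.beta k t (q k) * Bq i k t q := by
      simp only [zero_mul, zero_add, Finset.mul_sum]
      rw [Finset.sum_comm]
      refine Finset.sum_congr rfl fun i _ => Finset.sum_congr rfl fun k _ => ?_
      ring
    rw [hβ, hJ, hG t ht', e t ht', Finset.mul_sum, Finset.mul_sum, ← Finset.sum_add_distrib,
      ← Finset.sum_add_distrib, ← Finset.sum_add_distrib, ← Finset.sum_sub_distrib]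
    refine Finset.sum_eq_zero fun i _ => ?_
    linear_combination τ i t * hB2 i t ht q
  · simp [repS]

end FX

end

noncomputable section

namespace FX

/-! ### The equation for `H₁` on quadratic functions of the exchange rates -/

/-- A quadratic form in the exchange rates. -/
def quad (A B C : ℝ → (Pair → ℝ) → ℝ) (t x y : ℝ) (q : Pair → ℝ) : ℝ :=
  A t q * x ^ 2 + B t q * y ^ 2 + C t q * (x * y)

section quad

variable (A B C : ℝ → (Pair → ℝ) → ℝ)

theorem hasDerivAt_quad_x (t x y : ℝ) (q : Pair → ℝ) :
    HasDerivAt (fun x' => quad A B C t x' y q) (2 * A t q * x + C t q * y) x := by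
  have h := (((hasDerivAt_id x).pow 2).const_mul (A t q)).add_const (B t q * y ^ 2)
  have h2 := ((hasDerivAt_id x).mul_const y).const_mul (C t q)
  exact (h.add h2).congr_deriv (by simp; ring)

theorem hasDerivAt_quad_y (t x y : ℝ) (q : Pair → ℝ) :
    HasDerivAt (fun y' => quad A B C t x y' q) (2 * B t q * y + C t q * x) y := by
  have h := (((hasDerivAt_id y).pow 2).const_mul (B t q)).const_add (A t q * x ^ 2)
  have h2 := ((hasDerivAt_id y).const_mul x).const_mul (C t q)
  exact (h.add h2).congr_deriv (by simp; ring)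

theorem dX_quad : dX (quad A B C) = fun t x y q => 2 * A t q * x + C t q * y := by
  funext t x y q
  exact (hasDerivAt_quad_x A B C t x y q).deriv

theorem dY_quad : dY (quad A B C) = fun t x y q => 2 * B t q * y + C t q * x := by
  funext t x y q
  exact (hasDerivAt_quad_y A B C t x y q).deriv

theorem hasDerivAt_affine (a b x : ℝ) : HasDerivAt (fun x' => a * x' + b) a x := by
  simpa using ((hasDerivAt_id x).const_mul a).add_const b

theorem dXX_quad : dX (dX (quad A B C)) = fun t _ _ q => 2 * A t q := by
  rw [dX_quad]
  funext t x y q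
  exact (hasDerivAt_affine _ _ _).deriv

theorem dYY_quad : dY (dY (quad A B C)) = fun t _ _ q => 2 * B t q := by
  rw [dY_quad]
  funext t x y q
  exact (hasDerivAt_affine _ _ _).deriv

theorem dXY_quad : dX (dY (quad A B C)) = fun t _ _ q => C t q := by
  rw [dY_quad]
  funext t x y q
  change deriv (fun x' => 2 * B t q * y + C t q * x') x = C t q
  simp only [add_comm (2 * B t q * y)]
  exact (hasDerivAt_affine _ _ _).deriv

end quad

variable {T : ℝ} {A B C At Bt Ct : ℝ → (Pair → ℝ) → ℝ} {Aq Bq Cq : Pair → ℝ → (Pair → ℝ) → ℝ}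

theorem hasDerivWithinAt_quad_t (hA : IsC1 T A At Aq) (hB : IsC1 T B Bt Bq) (hC : IsC1 T C Ct Cq)
    {t : ℝ} (ht : t ∈ Ico 0 T) (x y : ℝ) (q : Pair → ℝ) :
    HasDerivWithinAt (fun s => quad A B C s x y q) (quad At Bt Ct t x y q) (Icc 0 T) t :=
  (((hA.deriv_t t ht q).mul_const _).add ((hB.deriv_t t ht q).mul_const _)).add
    ((hC.deriv_t t ht q).mul_const _)

theorem hasDerivAt_quad_q (hA : IsC1 T A At Aq) (hB : IsC1 T B Bt Bq) (hC : IsC1 T C Ct Cq)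
    (k : Pair) {t : ℝ} (ht : t ∈ Ico 0 T) (x y : ℝ) (q : Pair → ℝ) :
    HasDerivAt (fun v => quad A B C t x y (Function.update q k v))
      (quad (Aq k) (Bq k) (Cq k) t x y q) (q k) :=
  (((hA.deriv_q k t ht q).mul_const _).add ((hB.deriv_q k t ht q).mul_const _)).add
    ((hC.deriv_q k t ht q).mul_const _)

theorem dT_quad (hA : IsC1 T A At Aq) (hB : IsC1 T B Bt Bq) (hC : IsC1 T C Ct Cq)
    {t : ℝ} (ht : t ∈ Ico 0 T) (x y : ℝ) (q : Pair → ℝ) :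
    dT T (quad A B C) t x y q = quad At Bt Ct t x y q :=
  (hasDerivWithinAt_quad_t hA hB hC ht x y q).derivWithin
    (uniqueDiffOn_Icc (ht.1.trans_lt ht.2) t (Ico_subset_Icc_self ht))

theorem dQ_quad (hA : IsC1 T A At Aq) (hB : IsC1 T B Bt Bq) (hC : IsC1 T C Ct Cq)
    (k : Pair) {t : ℝ} (ht : t ∈ Ico 0 T) (x y : ℝ) (q : Pair → ℝ) :
    dQ k (quad A B C) t x y q = quad (Aq k) (Bq k) (Cq k) t x y q :=
  (hasDerivAt_quad_q hA hB hC k ht x y q).deriv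

theorem continuousOn_lift {G : ℝ → (Pair → ℝ) → ℝ} {I : Set ℝ}
    (h : ContinuousOn (fun z : ℝ × (Pair → ℝ) => G z.1 z.2) (I ×ˢ univ)) :
    ContinuousOn (fun w : ℝ × ℝ × ℝ × (Pair → ℝ) => G w.1 w.2.2.2) (dom I) :=
  h.comp (f := fun w : ℝ × ℝ × ℝ × (Pair → ℝ) => (w.1, w.2.2.2)) (by fun_prop)
    fun _ hw => ⟨hw.1, mem_univ _⟩

theorem continuousOn_quad {I : Set ℝ}
    (hA : ContinuousOn (fun z : ℝ × (Pair → ℝ) => A z.1 z.2) (I ×ˢ univ))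
    (hB : ContinuousOn (fun z : ℝ × (Pair → ℝ) => B z.1 z.2) (I ×ˢ univ))
    (hC : ContinuousOn (fun z : ℝ × (Pair → ℝ) => C z.1 z.2) (I ×ˢ univ)) :
    ContinuousOn (onProd (quad A B C)) (dom I) :=
  (((continuousOn_lift hA).mul (by fun_prop)).add ((continuousOn_lift hB).mul (by fun_prop))).add
    ((continuousOn_lift hC).mul (by fun_prop))

theorem isRegular_quad (hA : IsC1 T A At Aq) (hB : IsC1 T B Bt Bq) (hC : IsC1 T C Ct Cq) :
    IsRegular T (quad A B C) := by
  have cA := continuousOn_lift (hA.cont.mono (Ico_prod_subset T))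
  have cB := continuousOn_lift (hB.cont.mono (Ico_prod_subset T))
  have cC := continuousOn_lift (hC.cont.mono (Ico_prod_subset T))
  refine
    { cont := continuousOn_quad hA.cont hB.cont hC.cont
      diff_t := fun t ht x _ y _ q => (hasDerivWithinAt_quad_t hA hB hC ht x y q).differentiableWithinAt
      diff_x := fun t _ x _ y _ q => (hasDerivAt_quad_x A B C t x y q).differentiableAt
      diff_y := fun t _ x _ y _ q => (hasDerivAt_quad_y A B C t x y q).differentiableAt
      diff_xx := fun t _ x _ y _ q => ?_
      diff_yy := fun t _ x _ y _ q => ?_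
      diff_xy := fun t _ x _ y _ q => ?_
      diff_q := fun k t ht x _ y _ q => (hasDerivAt_quad_q hA hB hC k ht x y q).differentiableAt
      cont_t := (continuousOn_quad hA.cont_t hB.cont_t hC.cont_t).congr fun w hw =>
        dT_quad hA hB hC hw.1 _ _ _
      cont_x := ?_
      cont_y := ?_
      cont_xx := ?_
      cont_yy := ?_
      cont_xy := ?_
      cont_q := fun k => (continuousOn_quad (hA.cont_q k) (hB.cont_q k) (hC.cont_q k)).congr
        fun w hw => dQ_quad hA hB hC k hw.1 _ _ _ }
  · rw [dX_quad]
    fun_prop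
  · rw [dY_quad]
    fun_prop
  · rw [dY_quad]
    fun_prop
  · rw [dX_quad]
    exact ((cA.const_mul 2).mul (by fun_prop)).add (cC.mul (by fun_prop))
  · rw [dY_quad]
    exact ((cB.const_mul 2).mul (by fun_prop)).add (cC.mul (by fun_prop))
  · rw [dXX_quad]
    exact cA.const_mul 2
  · rw [dYY_quad]
    exact cB.const_mul 2
  · rw [dXY_quad]
    exact cC

namespace Model

variable (m : Model)

/-- In `q k`, `H0` is the rate times a quadratic polynomial plus a constant, so the rate cancels.
The transport term of (E) is thus the drift of the auxiliary inventories. -/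
theorem drift_coeff (k : Pair) (t : ℝ) {x y : ℝ} (hx : 0 < x) (hy : 0 < y) (q : Pair → ℝ) :
    (rateHat k x y - dQ k m.H0 t x y q) / (2 * m.a k * rateHat k x y) = -m.beta k t (q k) := by
  have ha := (m.a_pos k).ne'
  have hd : dQ k m.H0 t x y q =
      rateHat k x y * (1 - m.h1 k t - 2 * m.h2 k t * q k) := by
    refine HasDerivAt.deriv ?_
    have hid := hasDerivAt_id (q k)
    have h0 : ∀ R c : ℝ, HasDerivAt (fun v => R * (v - m.h1 k t * v - m.h2 k t * v ^ 2) + c)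
        (R * (1 - m.h1 k t - 2 * m.h2 k t * q k)) (q k) := fun R c => by
      have := ((((hid.sub (hid.const_mul (m.h1 k t))).sub
        ((hid.pow 2).const_mul (m.h2 k t))).const_mul R).add_const c)
      refine this.congr_deriv ?_
      simp only [id_eq, Nat.cast_ofNat, Nat.add_one_sub_one, pow_one]
      ring
    have e : (fun v => m.H0 t x y (Function.update q k v)) = fun v =>
        rateHat k x y * (v - m.h1 k t * v - m.h2 k t * v ^ 2) +
          (m.H0 t x y (Function.update q k 0)) := by
      funext v
      cases k <;> simp [H0, rateHat] <;> ring
    rw [e]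
    exact h0 _ _
  have hr : rateHat k x y ≠ 0 := by cases k <;> simp [rateHat, hx.ne', hy.ne']
  rw [hd, beta]
  field_simp
  ring

theorem jumpGen_quad {t x y : ℝ} {q : Pair → ℝ}
    (iA : ∀ k s, IntegrableOn (qjump A k s t q) (Ioi 0) (m.F k s))
    (iB : ∀ k s, IntegrableOn (qjump B k s t q) (Ioi 0) (m.F k s))
    (iC : ∀ k s, IntegrableOn (qjump C k s t q) (Ioi 0) (m.F k s)) :
    ∑ k : Pair, ∑ s : Side, m.lam k s * ∫ r in Ioi 0, jump (quad A B C) k s t x y q r ∂(m.F k s) =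
      x ^ 2 * m.jumpGen A t q + y ^ 2 * m.jumpGen B t q + x * y * m.jumpGen C t q := by
  have e : ∀ k s, ∫ r in Ioi 0, jump (quad A B C) k s t x y q r ∂(m.F k s) =
      x ^ 2 * (∫ r in Ioi 0, qjump A k s t q r ∂(m.F k s)) +
      y ^ 2 * (∫ r in Ioi 0, qjump B k s t q r ∂(m.F k s)) +
      x * y * (∫ r in Ioi 0, qjump C k s t q r ∂(m.F k s)) := fun k s => by
    have i1 := (iA k s).const_mul (x ^ 2)
    have i2 := (iB k s).const_mul (y ^ 2)
    have i3 := (iC k s).const_mul (x * y)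
    rw [← integral_const_mul, ← integral_const_mul, ← integral_const_mul,
      ← integral_add i1 i2, ← integral_add (i1.fun_add i2) i3]
    congr 1
    funext r
    simp only [jump, quad, qjump]
    ring
  simp only [e, jumpGen, Finset.mul_sum, ← Finset.sum_add_distrib]
  refine Finset.sum_congr rfl fun k _ => Finset.sum_congr rfl fun s _ => ?_
  ring

/-- The left-hand side of the equation for a coefficient function. -/
def coeffLHS (c K : ℝ) (S G Gt : ℝ → (Pair → ℝ) → ℝ) (Gq : Pair → ℝ → (Pair → ℝ) → ℝ)
    (t : ℝ) (q : Pair → ℝ) : ℝ :=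
  Gt t q + (∑ k, m.beta k t (q k) * Gq k t q) + m.jumpGen G t q + c * G t q - K * S t q

/-- The sources in the equations for the three coefficients. -/
def srcXX (t : ℝ) (q : Pair → ℝ) : ℝ := m.dxH0 t (q .x) (q .z) ^ 2

def srcYY (t : ℝ) (q : Pair → ℝ) : ℝ := m.dyH0 t (q .y) ^ 2

def srcXY (t : ℝ) (q : Pair → ℝ) : ℝ := m.dxH0 t (q .x) (q .z) * m.dyH0 t (q .y)

/-- The generator of the exchange rates maps `x ^ 2`, `y ^ 2` and `x * y` to multiples of
themselves, whence the three discount rates. The remaining operators act on the inventories only,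
and the quadratic form in the gradient of `H0` splits into the three sources. -/
theorem pideRHS_quad (hA : IsC1 m.T A At Aq) (hB : IsC1 m.T B Bt Bq) (hC : IsC1 m.T C Ct Cq)
    {t x y : ℝ} (ht : t ∈ Ico 0 m.T) (hx : 0 < x) (hy : 0 < y) {q : Pair → ℝ}
    (iA : ∀ k s, IntegrableOn (qjump A k s t q) (Ioi 0) (m.F k s))
    (iB : ∀ k s, IntegrableOn (qjump B k s t q) (Ioi 0) (m.F k s))
    (iC : ∀ k s, IntegrableOn (qjump C k s t q) (Ioi 0) (m.F k s)) :
    m.pideRHS (quad A B C) t x y q =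
      x ^ 2 * m.coeffLHS (2 * m.μx + m.σx ^ 2) (1 / 2 * m.σx ^ 2) m.srcXX A At Aq t q +
      y ^ 2 * m.coeffLHS (2 * m.μy + m.σy ^ 2) (1 / 2 * m.σy ^ 2) m.srcYY B Bt Bq t q +
      x * y * m.coeffLHS (m.μx + m.μy + m.ρ * m.σx * m.σy) (m.ρ * m.σx * m.σy) m.srcXY
        C Ct Cq t q := by
  have hdrift : ∑ k : Pair, (rateHat k x y - dQ k m.H0 t x y q) / (2 * m.a k * rateHat k x y) *
        dQ k (quad A B C) t x y q =
      -(x ^ 2 * (∑ k, m.beta k t (q k) * Aq k t q) + y ^ 2 * (∑ k, m.beta k t (q k) * Bq k t q) +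
        x * y * (∑ k, m.beta k t (q k) * Cq k t q)) := by
    simp only [Finset.mul_sum, ← Finset.sum_add_distrib, ← Finset.sum_neg_distrib]
    refine Finset.sum_congr rfl fun k _ => ?_
    rw [m.drift_coeff k t hx hy, dQ_quad hA hB hC k ht, quad]
    ring
  have hg : m.gradP m.H0 t x y q ⬝ᵥ (m.corr *ᵥ m.gradP m.H0 t x y q) =
      m.σx ^ 2 * x ^ 2 * m.dxH0 t (q .x) (q .z) ^ 2 +
        2 * m.ρ * m.σx * m.σy * (x * y) * (m.dxH0 t (q .x) (q .z) * m.dyH0 t (q .y)) +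
        m.σy ^ 2 * y ^ 2 * m.dyH0 t (q .y) ^ 2 := by
    rw [gradP, dX, dY, (m.hasDerivAt_H0_x t x y q).deriv, (m.hasDerivAt_H0_y t x y q).deriv]
    simp [corr, Matrix.mulVec, dotProduct, Fin.sum_univ_two]
    ring
  rw [pideRHS, hdrift, hg, m.jumpGen_quad iA iB iC, dT_quad hA hB hC ht, genP, dXX_quad, dYY_quad,
    dXY_quad, dX_quad, dY_quad]
  simp only [coeffLHS, srcXX, srcYY, srcXY, quad]
  ring

end Model

end FX

end

noncomputable section

namespace FX

/-! ### Differentiation along curves -/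

theorem hasFDerivAt_prod_of_partial {E : Type*} [NormedAddCommGroup E] [NormedSpace ℝ E]
    {f f₁ : ℝ → E → ℝ} {f₂ : ℝ → E → E →L[ℝ] ℝ} {U : Set (ℝ × E)} (hU : IsOpen U)
    (h₁ : ∀ z ∈ U, HasDerivAt (fun s => f s z.2) (f₁ z.1 z.2) z.1)
    (h₂ : ∀ z ∈ U, HasFDerivAt (f z.1) (f₂ z.1 z.2) z.2)
    (c₁ : ContinuousOn (fun z : ℝ × E => f₁ z.1 z.2) U)
    (c₂ : ContinuousOn (fun z : ℝ × E => f₂ z.1 z.2) U) {z : ℝ × E} (hz : z ∈ U) :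
    HasFDerivAt (fun z : ℝ × E => f z.1 z.2) (f₁ z.1 z.2 • ContinuousLinearMap.fst ℝ ℝ E +
      (f₂ z.1 z.2).comp (ContinuousLinearMap.snd ℝ ℝ E)) z := by
  have hUz := hU.mem_nhds hz
  have h := hasStrictFDerivAt_uncurry_coprod (𝕜 := ℝ) (u := z) (f := f)
    (f₁ := fun s e => f₁ s e • ContinuousLinearMap.id ℝ ℝ) (f₂ := f₂)
    (Filter.mem_of_superset hUz fun v hv => (h₁ v hv).hasFDerivAt.congr_fderiv (by
      ext
      simp [Function.HasUncurry.uncurry]))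
    (Filter.mem_of_superset hUz fun v hv => h₂ v hv)
    ((c₁.smul continuousOn_const).continuousAt hUz)
    (c₂.continuousAt hUz)
  refine h.hasFDerivAt.congr_fderiv ?_
  ext <;> simp [Function.HasUncurry.uncurry]

/-- The vector of inventories with the given components. -/
def vec (a b c : ℝ) : Pair → ℝ
  | .x => a
  | .y => b
  | .z => c

theorem vec_eta (q : Pair → ℝ) : vec (q .x) (q .y) (q .z) = q := by
  funext k
  cases k <;> rfl

theorem update_vec_x (a b c v : ℝ) : Function.update (vec a b c) .x v = vec v b c := by
  funext k
  cases k <;> simp [vec]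

theorem update_vec_y (a b c v : ℝ) : Function.update (vec a b c) .y v = vec a v c := by
  funext k
  cases k <;> simp [vec]

theorem update_vec_z (a b c v : ℝ) : Function.update (vec a b c) .z v = vec a b v := by
  funext k
  cases k <;> simp [vec]

theorem continuous_vec : Continuous fun w : ℝ × ℝ × ℝ × ℝ => (w.1, vec w.2.1 w.2.2.1 w.2.2.2) := by
  refine continuous_fst.prodMk (continuous_pi fun k => ?_)
  cases k <;> simp only [vec] <;> fun_prop

/-- Continuous partial derivatives give total differentiability, hence the chain rule. Times are
restricted to the open interval, where the derivative within `[0, T]` is two-sided. -/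
theorem IsC1.hasDerivAt_comp {T : ℝ} {G Gt : ℝ → (Pair → ℝ) → ℝ}
    {Gq : Pair → ℝ → (Pair → ℝ) → ℝ} (hG : IsC1 T G Gt Gq) {t : ℝ} (ht : t ∈ Ioo 0 T)
    {c : ℝ → Pair → ℝ} {c' : Pair → ℝ} (hc : ∀ k, HasDerivAt (fun s => c s k) (c' k) t) :
    HasDerivAt (fun s => G s (c s)) (Gt t (c t) + ∑ k, c' k * Gq k t (c t)) t := by
  have hI : Ioo 0 T ⊆ Ico 0 T := Ioo_subset_Ico_self
  let D : Pair → ℝ × ℝ × ℝ × ℝ → ℝ := fun k w => Gq k w.1 (vec w.2.1 w.2.2.1 w.2.2.2)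
  have hD : ∀ k, ContinuousOn (D k) (Ioo 0 T ×ˢ univ) := fun k =>
    (hG.cont_q k).comp continuous_vec.continuousOn fun w hw => ⟨hI hw.1, mem_univ _⟩
  have hDt : ContinuousOn (fun w : ℝ × ℝ × ℝ × ℝ => Gt w.1 (vec w.2.1 w.2.2.1 w.2.2.2))
      (Ioo 0 T ×ˢ univ) :=
    hG.cont_t.comp continuous_vec.continuousOn fun w hw => ⟨hI hw.1, mem_univ _⟩
  have hx : ∀ s ∈ Ioo 0 T, ∀ a b c, HasDerivAt (fun v => G s (vec v b c)) (Gq .x s (vec a b c)) a :=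
    fun s hs a b c => by
      have := hG.deriv_q .x s (hI hs) (vec a b c)
      simp only [update_vec_x] at this
      exact this
  have hy : ∀ s ∈ Ioo 0 T, ∀ a b c, HasDerivAt (fun v => G s (vec a v c)) (Gq .y s (vec a b c)) b :=
    fun s hs a b c => by
      have := hG.deriv_q .y s (hI hs) (vec a b c)
      simp only [update_vec_y] at this
      exact this
  have hz : ∀ s ∈ Ioo 0 T, ∀ a b c, HasDerivAt (fun v => G s (vec a b v)) (Gq .z s (vec a b c)) c :=
    fun s hs a b c => by
      have := hG.deriv_q .z s (hI hs) (vec a b c)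
      simp only [update_vec_z] at this
      exact this
  -- The total derivative is assembled one variable at a time, in the order `z`, `y`, `x`, time.
  let D1 : ℝ × ℝ × ℝ × ℝ → ℝ →L[ℝ] ℝ := fun w => D .z w • ContinuousLinearMap.id ℝ ℝ
  let D2 : ℝ × ℝ × ℝ × ℝ → ℝ × ℝ →L[ℝ] ℝ := fun w =>
    D .y w • ContinuousLinearMap.fst ℝ ℝ ℝ + (D1 w).comp (ContinuousLinearMap.snd ℝ ℝ ℝ)
  let D3 : ℝ × ℝ × ℝ × ℝ → ℝ × ℝ × ℝ →L[ℝ] ℝ := fun w =>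
    D .x w • ContinuousLinearMap.fst ℝ ℝ (ℝ × ℝ) +
      (D2 w).comp (ContinuousLinearMap.snd ℝ ℝ (ℝ × ℝ))
  have c1 : ContinuousOn D1 (Ioo 0 T ×ˢ univ) := (hD .z).smul continuousOn_const
  have c2 : ContinuousOn D2 (Ioo 0 T ×ˢ univ) :=
    ((hD .y).smul continuousOn_const).add (c1.clm_comp continuousOn_const)
  have c3 : ContinuousOn D3 (Ioo 0 T ×ˢ univ) :=
    ((hD .x).smul continuousOn_const).add (c2.clm_comp continuousOn_const)
  have d2 : ∀ s ∈ Ioo 0 T, ∀ a (z : ℝ × ℝ),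
      HasFDerivAt (fun z : ℝ × ℝ => G s (vec a z.1 z.2)) (D2 (s, a, z)) z := fun s hs a z =>
    hasFDerivAt_prod_of_partial (f := fun b c => G s (vec a b c))
      (f₁ := fun b c => D .y (s, a, b, c)) (f₂ := fun b c => D1 (s, a, b, c)) isOpen_univ
      (fun z _ => hy s hs a z.1 z.2)
      (fun z _ => (hz s hs a z.1 z.2).hasFDerivAt.congr_fderiv (by
        ext
        simp [D1, D]))
      ((hD .y).comp (f := fun z : ℝ × ℝ => (s, a, z.1, z.2)) (by fun_prop)
        fun _ _ => ⟨hs, mem_univ _⟩)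
      (c1.comp (f := fun z : ℝ × ℝ => (s, a, z.1, z.2)) (by fun_prop)
        fun _ _ => ⟨hs, mem_univ _⟩) (mem_univ z)
  have d3 : ∀ s ∈ Ioo 0 T, ∀ z : ℝ × ℝ × ℝ,
      HasFDerivAt (fun z : ℝ × ℝ × ℝ => G s (vec z.1 z.2.1 z.2.2)) (D3 (s, z)) z := fun s hs z =>
    hasFDerivAt_prod_of_partial (f := fun a (z : ℝ × ℝ) => G s (vec a z.1 z.2))
      (f₁ := fun a z => D .x (s, a, z)) (f₂ := fun a z => D2 (s, a, z)) isOpen_univ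
      (fun z _ => hx s hs z.1 z.2.1 z.2.2) (fun z _ => d2 s hs z.1 z.2)
      ((hD .x).comp (f := fun z : ℝ × ℝ × ℝ => (s, z.1, z.2)) (by fun_prop)
        fun _ _ => ⟨hs, mem_univ _⟩)
      (c2.comp (f := fun z : ℝ × ℝ × ℝ => (s, z.1, z.2)) (by fun_prop)
        fun _ _ => ⟨hs, mem_univ _⟩) (mem_univ z)
  have d4 := hasFDerivAt_prod_of_partial
    (f := fun s (z : ℝ × ℝ × ℝ) => G s (vec z.1 z.2.1 z.2.2))
    (f₁ := fun s z => Gt s (vec z.1 z.2.1 z.2.2)) (f₂ := fun s z => D3 (s, z))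
    (U := Ioo 0 T ×ˢ univ) (isOpen_Ioo.prod isOpen_univ)
    (fun z hz => (hG.deriv_t z.1 (hI hz.1) _).hasDerivAt (Icc_mem_nhds hz.1.1 hz.1.2))
    (fun z hz => d3 z.1 hz.1 z.2) hDt c3
    (z := (t, c t .x, c t .y, c t .z)) ⟨ht, mem_univ _⟩
  have h := d4.comp_hasDerivAt t
    ((hasDerivAt_id t).prodMk ((hc .x).prodMk ((hc .y).prodMk (hc .z))))
  have e : (fun s => G s (c s)) = (fun w : ℝ × ℝ × ℝ × ℝ => G w.1 (vec w.2.1 w.2.2.1 w.2.2.2)) ∘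
      fun s => (id s, c s .x, c s .y, c s .z) := by
    funext s
    simp [vec_eta]
  rw [e]
  refine h.congr_deriv ?_
  rw [sum_pair]
  simp [D3, D2, D1, D, vec_eta]
  ring

/-! ### Uniqueness of solutions of polynomial growth -/

/-- Both `g` and `-g`, after adding the exponential barrier, are nonincreasing, and their value at
`T` is `D ≥ 0`. -/
theorem abs_le_of_backward {g g' : ℝ → ℝ} {t T R D : ℝ} (hD : 0 ≤ D) (htT : t ≤ T)
    (hc : ContinuousOn g (Icc t T)) (hd : ∀ s ∈ Ioo t T, HasDerivAt g (g' s) s)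
    (hb : ∀ s ∈ Ioo t T, |g' s| ≤ R * D * Real.exp (R * (T - s))) (hT : g T = 0) :
    |g t| ≤ D * Real.exp (R * (T - t)) := by
  have hE : ∀ s, HasDerivAt (fun s => D * Real.exp (R * (T - s)))
      (-(R * D * Real.exp (R * (T - s)))) s := fun s => by
    have := ((((hasDerivAt_id s).const_sub T).const_mul R).exp).const_mul D
    refine this.congr_deriv ?_
    simp only [id_eq]
    ring
  have key : ∀ ε : ℝ, |ε| = 1 → 0 ≤ ε * g t + D * Real.exp (R * (T - t)) := by
    intro ε hε
    have hd' : ∀ s ∈ Ioo t T, HasDerivAt (fun s => ε * g s + D * Real.exp (R * (T - s)))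
        (ε * g' s + -(R * D * Real.exp (R * (T - s)))) s := fun s hs =>
      ((hd s hs).const_mul ε).add (hE s)
    have hanti : AntitoneOn (fun s => ε * g s + D * Real.exp (R * (T - s))) (Icc t T) := by
      refine antitoneOn_of_deriv_nonpos (convex_Icc t T) ?_ ?_ ?_
      · exact (hc.const_mul ε).add (by fun_prop)
      · rw [interior_Icc]
        exact fun s hs => (hd' s hs).differentiableAt.differentiableWithinAt
      · rw [interior_Icc]
        intro s hs
        rw [(hd' s hs).deriv]
        have h1 : ε * g' s ≤ |g' s| := by
          calc ε * g' s ≤ |ε * g' s| := le_abs_self _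
            _ = |g' s| := by rw [abs_mul, hε, one_mul]
        linarith [hb s hs]
    have := hanti (left_mem_Icc.2 htT) (right_mem_Icc.2 htT) htT
    simp only [hT, sub_self, mul_zero, Real.exp_zero, mul_one, zero_add] at this
    linarith
  rw [abs_le]
  have h1 := key 1 (by simp)
  have h2 := key (-1) (by simp)
  constructor <;> linarith

namespace Model

variable (m : Model)

/-- The auxiliary inventory in the absence of orders. -/
def curve (t : ℝ) (q : Pair → ℝ) (s : ℝ) (k : Pair) : ℝ :=
  (m.wt k s)⁻¹ * (m.wt k t * q k - m.shift k t + m.shift k s)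

theorem curve_self (t : ℝ) (q : Pair → ℝ) : m.curve t q t = q := by
  funext k
  have := (m.wt_pos k t).ne'
  rw [curve]
  field_simp
  ring

theorem hasDerivAt_curve (t : ℝ) (q : Pair → ℝ) {s : ℝ} (hs : s ≤ m.T) (k : Pair) :
    HasDerivAt (fun s => m.curve t q s k) (m.beta k s (m.curve t q s k)) s := by
  have hw := (m.wt_pos k s).ne'
  have := ((m.hasDerivAt_wt k s).inv hw).mul
    ((m.hasDerivAt_shift k s).const_add (m.wt k t * q k - m.shift k t))
  refine this.congr_deriv ?_
  rw [m.beta_eq k hs, curve]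
  simp only [Pi.inv_apply]
  field_simp
  ring

theorem exists_qsize_curve_le : ∃ C : ℝ, 1 ≤ C ∧ ∀ t ∈ Icc 0 m.T, ∀ s ∈ Icc 0 m.T, ∀ q,
    qsize (m.curve t q s) ≤ C * qsize q := by
  have hk : ∀ k, ∃ C : ℝ, 0 ≤ C ∧ ∀ t ∈ Icc 0 m.T, ∀ s ∈ Icc 0 m.T, ∀ q,
      |m.curve t q s k| ≤ C * qsize q := fun k => by
    have hw := m.continuous_wt k
    have hsh := m.continuous_shift k
    have hwi : Continuous fun s => (m.wt k s)⁻¹ := hw.inv₀ fun s => (m.wt_pos k s).ne'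
    have hK : IsCompact (Icc 0 m.T ×ˢ Icc 0 m.T) := isCompact_Icc.prod isCompact_Icc
    obtain ⟨A, hA⟩ := hK.exists_bound_of_continuousOn
      (f := fun z : ℝ × ℝ => (m.wt k z.2)⁻¹ * m.wt k z.1)
      ((hwi.comp continuous_snd).mul (hw.comp continuous_fst)).continuousOn
    obtain ⟨B, hB⟩ := hK.exists_bound_of_continuousOn
      (f := fun z : ℝ × ℝ => (m.wt k z.2)⁻¹ * (m.shift k z.2 - m.shift k z.1))
      ((hwi.comp continuous_snd).mul
        ((hsh.comp continuous_snd).sub (hsh.comp continuous_fst))).continuousOn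
    refine ⟨|A| + |B|, by positivity, fun t ht s hs q => ?_⟩
    have h1 : |(m.wt k s)⁻¹ * m.wt k t| ≤ |A| := (hA (t, s) ⟨ht, hs⟩).trans (le_abs_self A)
    have h2 : |(m.wt k s)⁻¹ * (m.shift k s - m.shift k t)| ≤ |B| :=
      (hB (t, s) ⟨ht, hs⟩).trans (le_abs_self B)
    have h3 : |q k| ≤ qsize q := by
      have := Finset.single_le_sum (f := fun k => |q k|) (fun k _ => abs_nonneg _)
        (Finset.mem_univ k)
      rw [qsize]
      linarith
    have h4 := one_le_qsize q
    calc |m.curve t q s k| = |((m.wt k s)⁻¹ * m.wt k t) * q k +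
          (m.wt k s)⁻¹ * (m.shift k s - m.shift k t)| := by rw [curve]; ring_nf
      _ ≤ |(m.wt k s)⁻¹ * m.wt k t| * |q k| + |(m.wt k s)⁻¹ * (m.shift k s - m.shift k t)| := by
        rw [← abs_mul]
        exact abs_add_le _ _
      _ ≤ |A| * qsize q + |B| * qsize q := by
        gcongr
        exact h2.trans (le_mul_of_one_le_right (abs_nonneg _) h4)
      _ = _ := by ring
  choose C hC h using hk
  refine ⟨1 + ∑ k, C k, le_add_of_nonneg_right (Finset.sum_nonneg fun k _ => hC k),
    fun t ht s hs q => ?_⟩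
  rw [add_mul, one_mul, Finset.sum_mul]
  unfold qsize at h ⊢
  exact add_le_add (le_add_of_nonneg_right (Finset.sum_nonneg fun k _ => abs_nonneg _))
    (Finset.sum_le_sum fun k _ => h k t ht s hs q)

/-- A bound for the jump operator in the norm weighted by `qsize ^ p`; `L` does not depend on the
function or on the time. -/
theorem exists_jumpGen_le {p : ℕ} (hp : ∀ k s, Integrable (fun r : ℝ => r ^ p) (m.F k s)) :
    ∃ L : ℝ, 0 ≤ L ∧ ∀ (G : ℝ → (Pair → ℝ) → ℝ) (t C : ℝ), 0 ≤ C →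
      (∀ q, |G t q| ≤ C * qsize q ^ p) → ∀ q, |m.jumpGen G t q| ≤ L * (C * qsize q ^ p) := by
  refine ⟨∑ k : Pair, ∑ s : Side, m.lam k s * (2 * ∫ r in Ioi 0, (1 + |r|) ^ p ∂(m.F k s)),
    ?_, fun G t C hC hG q => ?_⟩
  · refine Finset.sum_nonneg fun k _ => Finset.sum_nonneg fun s _ => ?_
    have : 0 ≤ ∫ r in Ioi (0 : ℝ), (1 + |r|) ^ p ∂(m.F k s) :=
      integral_nonneg fun r => by positivity
    positivity
  · rw [jumpGen, Finset.sum_mul]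
    refine (Finset.abs_sum_le_sum_abs _ _).trans (Finset.sum_le_sum fun k _ => ?_)
    rw [Finset.sum_mul]
    refine (Finset.abs_sum_le_sum_abs _ _).trans (Finset.sum_le_sum fun s _ => ?_)
    rw [abs_mul, abs_of_nonneg (NNReal.coe_nonneg _), mul_assoc]
    refine mul_le_mul_of_nonneg_left ?_ (NNReal.coe_nonneg _)
    have h1 : ‖∫ r in Ioi 0, qjump G k s t q r ∂(m.F k s)‖ ≤
        ∫ r in Ioi 0, 2 * C * qsize q ^ p * (1 + |r|) ^ p ∂(m.F k s) :=
      norm_integral_le_of_norm_le ((m.integrable_one_add_pow hp k s).const_mul _).integrableOn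
        (Filter.Eventually.of_forall fun r => abs_qjump_le hC hG k s q r)
    rw [integral_const_mul, Real.norm_eq_abs] at h1
    refine h1.trans (le_of_eq ?_)
    ring

/-- Along `curve` the equation reads `g' = -(jumps + c g)`. A bound on `G` in the exponentially
weighted norm bounds the right-hand side, and integrating backwards from the zero terminal value
returns the same bound halved. Iterating leaves zero. -/
theorem eq_zero_of_backward {p : ℕ} (hp : ∀ k s, Integrable (fun r : ℝ => r ^ p) (m.F k s))
    {c : ℝ} {G Gt : ℝ → (Pair → ℝ) → ℝ} {Gq : Pair → ℝ → (Pair → ℝ) → ℝ}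
    (hG : IsC1 m.T G Gt Gq) (hdeg : HasDeg m.T p G)
    (heq : ∀ t ∈ Ico 0 m.T, ∀ q,
      Gt t q + (∑ k, m.beta k t (q k) * Gq k t q) + m.jumpGen G t q + c * G t q = 0)
    (hT : ∀ q, G m.T q = 0) {t : ℝ} (ht : t ∈ Icc 0 m.T) (q : Pair → ℝ) : G t q = 0 := by
  obtain ⟨L, hL, hjump⟩ := m.exists_jumpGen_le hp
  obtain ⟨K, hK, hcurve⟩ := m.exists_qsize_curve_le
  have hK0 : 0 ≤ K := zero_le_one.trans hK
  have hq0 : ∀ q, 0 ≤ qsize q := fun q => zero_le_one.trans (one_le_qsize q)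
  -- `L + |c|` bounds the right-hand side and `K ^ p` the growth of `qsize ^ p` along the curve. The
  -- factor `2` makes the iteration contract by one half.
  set R : ℝ := 2 * ((L + |c|) * K ^ p) with hR
  have hR0 : 0 ≤ R := by positivity
  have improve : ∀ M : ℝ, 0 ≤ M →
      (∀ t ∈ Icc 0 m.T, ∀ q, |G t q| ≤ M * Real.exp (R * (m.T - t)) * qsize q ^ p) →
      ∀ t ∈ Icc 0 m.T, ∀ q, |G t q| ≤ M / 2 * Real.exp (R * (m.T - t)) * qsize q ^ p := by
    intro M hM hb t ht q
    have hcd : ∀ s ∈ Ioo t m.T, HasDerivAt (fun s => G s (m.curve t q s))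
        (-(m.jumpGen G s (m.curve t q s) + c * G s (m.curve t q s))) s := fun s hs => by
      have hs' : s ∈ Ioo 0 m.T := ⟨ht.1.trans_lt hs.1, hs.2⟩
      refine (hG.hasDerivAt_comp hs' fun k => m.hasDerivAt_curve t q hs.2.le k).congr_deriv ?_
      linarith [heq s (Ioo_subset_Ico_self hs') (m.curve t q s)]
    have hcont : ContinuousOn (fun s => G s (m.curve t q s)) (Icc t m.T) := by
      refine hG.cont.comp (f := fun s => (s, m.curve t q s)) ?_
        fun s hs => ⟨⟨ht.1.trans hs.1, hs.2⟩, mem_univ _⟩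
      exact continuousOn_id.prodMk (continuousOn_pi.2 fun k s hs =>
        (m.hasDerivAt_curve t q hs.2 k).continuousAt.continuousWithinAt)
    have hbound : ∀ s ∈ Ioo t m.T,
        |-(m.jumpGen G s (m.curve t q s) + c * G s (m.curve t q s))| ≤
          R * (M / 2 * qsize q ^ p) * Real.exp (R * (m.T - s)) := fun s hs => by
      have hs' : s ∈ Icc 0 m.T := ⟨ht.1.trans hs.1.le, hs.2.le⟩
      set E := Real.exp (R * (m.T - s)) with hE
      have hE0 : 0 ≤ E := (Real.exp_pos _).le
      have h1 := hjump G s (M * E) (by positivity) (hb s hs') (m.curve t q s)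
      have h2 := hb s hs' (m.curve t q s)
      have h3 : qsize (m.curve t q s) ^ p ≤ (K * qsize q) ^ p :=
        pow_le_pow_left₀ (hq0 _) (hcurve t ht s hs' q) p
      calc |-(m.jumpGen G s (m.curve t q s) + c * G s (m.curve t q s))|
          ≤ |m.jumpGen G s (m.curve t q s)| + |c| * |G s (m.curve t q s)| := by
            rw [abs_neg, ← abs_mul]
            exact abs_add_le _ _
        _ ≤ L * (M * E * qsize (m.curve t q s) ^ p) + |c| * (M * E * qsize (m.curve t q s) ^ p) := by
            gcongr
        _ = (L + |c|) * (M * E) * qsize (m.curve t q s) ^ p := by ring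
        _ ≤ (L + |c|) * (M * E) * (K * qsize q) ^ p := by gcongr
        _ = R * (M / 2 * qsize q ^ p) * E := by
            rw [hR, mul_pow]
            ring
    have := abs_le_of_backward (g := fun s => G s (m.curve t q s)) (R := R)
      (D := M / 2 * qsize q ^ p) (mul_nonneg (by positivity) (pow_nonneg (hq0 q) p)) ht.2 hcont hcd
      hbound (hT _)
    simp only [m.curve_self] at this
    linarith
  obtain ⟨M, hM, hb⟩ := hdeg
  have hiter : ∀ n : ℕ, ∀ t ∈ Icc 0 m.T, ∀ q,
      |G t q| ≤ M / 2 ^ n * Real.exp (R * (m.T - t)) * qsize q ^ p := by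
    intro n
    induction n with
    | zero =>
      intro t ht q
      refine (hb t ht q).trans ?_
      have := Real.one_le_exp (mul_nonneg hR0 (sub_nonneg.2 ht.2))
      have := pow_nonneg (hq0 q) p
      rw [pow_zero, div_one]
      gcongr
      exact le_mul_of_one_le_right hM (by assumption)
    | succ n ih =>
      intro t ht q
      refine (improve _ (by positivity) ih t ht q).trans (le_of_eq ?_)
      rw [pow_succ, div_div]
  have hlim : Filter.Tendsto (fun n : ℕ => M / 2 ^ n * Real.exp (R * (m.T - t)) * qsize q ^ p)
      Filter.atTop (nhds 0) := by
    have h := ((tendsto_pow_atTop_nhds_zero_of_lt_one (r := (1 / 2 : ℝ)) (by norm_num)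
      (by norm_num)).const_mul M).mul_const (Real.exp (R * (m.T - t)) * qsize q ^ p)
    simp only [mul_zero, zero_mul] at h
    refine h.congr fun n => ?_
    rw [one_div, inv_pow]
    ring
  exact abs_eq_zero.1 (le_antisymm (ge_of_tendsto' hlim fun n => hiter n t ht q) (abs_nonneg _))

end Model

end FX

end

noncomputable section

namespace FX

/-! ### The coefficients of a solution -/

theorem IsRegular.isC1 {T : ℝ} {H : ℝ → ℝ → ℝ → (Pair → ℝ) → ℝ} (h : IsRegular T H) {x y : ℝ}
    (hx : 0 < x) (hy : 0 < y) :
    IsC1 T (fun t q => H t x y q) (fun t q => dT T H t x y q) (fun k t q => dQ k H t x y q) := by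
  have hmaps : ∀ I : Set ℝ, MapsTo (fun z : ℝ × (Pair → ℝ) => (z.1, x, y, z.2)) (I ×ˢ univ)
      (dom I) := fun I z hz => ⟨hz.1, hx, hy, mem_univ _⟩
  have hc : ∀ s, ContinuousOn (fun z : ℝ × (Pair → ℝ) => (z.1, x, y, z.2)) s := fun s => by
    fun_prop
  exact
    { cont := h.cont.comp (hc _) (hmaps _)
      cont_t := h.cont_t.comp (hc _) (hmaps _)
      cont_q := fun k => (h.cont_q k).comp (hc _) (hmaps _)
      deriv_t := fun t ht q => (h.diff_t t ht x hx y hy q).hasDerivWithinAt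
      deriv_q := fun k t ht q => (h.diff_q k t ht x hx y hy q).hasDerivAt }

/-- Each coefficient is a fixed linear combination of the values of the form at three points of the
open quadrant, so it inherits their regularity. -/
theorem IsRegular.exists_isC1_quad {T : ℝ} {A B C : ℝ → (Pair → ℝ) → ℝ}
    (h : IsRegular T (quad A B C)) :
    (∃ At Aq, IsC1 T A At Aq) ∧ (∃ Bt Bq, IsC1 T B Bt Bq) ∧ ∃ Ct Cq, IsC1 T C Ct Cq := by
  have key : ∀ (a b c : ℝ) (G : ℝ → (Pair → ℝ) → ℝ), (∀ t q, G t q = a * quad A B C t 1 1 q +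
      b * quad A B C t 2 1 q + c * quad A B C t 1 2 q) → ∃ Gt Gq, IsC1 T G Gt Gq :=
    fun a b c G hG => ⟨_, _, (((h.isC1 one_pos one_pos).const_mul a).add
      ((h.isC1 two_pos one_pos).const_mul b)).add
        ((h.isC1 one_pos two_pos).const_mul c) |>.congr fun t _ q => hG t q⟩
  -- Inversion of the linear system for the values at `(1, 1)`, `(2, 1)` and `(1, 2)`.
  refine ⟨key (-2) (2 / 3) (1 / 3) A ?_, key (-2) (1 / 3) (2 / 3) B ?_, key 5 (-1) (-1) C ?_⟩ <;>
  · intro t q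
    simp only [quad]
    ring

theorem Model.jumpGen_sub (m : Model) {G H : ℝ → (Pair → ℝ) → ℝ} {t : ℝ} {q : Pair → ℝ}
    (hG : ∀ k s, IntegrableOn (Model.qjump G k s t q) (Ioi 0) (m.F k s))
    (hH : ∀ k s, IntegrableOn (Model.qjump H k s t q) (Ioi 0) (m.F k s)) :
    m.jumpGen (fun t q => G t q + -1 * H t q) t q = m.jumpGen G t q + -1 * m.jumpGen H t q := by
  have h := m.jumpGen_sum Finset.univ ![1, -1] ![G, H] (t := t) (q := q) fun i _ => by
    fin_cases i
    · exact hG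
    · exact hH
  simpa [Fin.sum_univ_two] using h

theorem IsCoeff.eq {m : Model} {p : ℕ} (hp : ∀ k s, Integrable (fun r : ℝ => r ^ p) (m.F k s))
    {c K : ℝ} {S G H : ℝ → (Pair → ℝ) → ℝ} (hG : IsCoeff m c K S G) (hH : IsCoeff m c K S H)
    (dG : HasDeg m.T p G) (dH : HasDeg m.T p H) {t : ℝ} (ht : t ∈ Icc 0 m.T) (q : Pair → ℝ) :
    G t q = H t q := by
  obtain ⟨⟨Gt, Gq, cG, eG⟩, zG⟩ := hG
  obtain ⟨⟨Ht, Hq, cH, eH⟩, zH⟩ := hH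
  have := m.eq_zero_of_backward hp (c := c) (cG.add (cH.const_mul (-1)))
    (dG.add (dH.const_mul (-1))) (fun t ht q => ?_) (fun q => by rw [zG, zH]; ring) ht q
  · linarith
  · have ht' := Ico_subset_Icc_self ht
    rw [m.jumpGen_sub (fun k s => m.integrableOn_qjump hp dG ht' (cG.continuous_q ht') k s q)
      (fun k s => m.integrableOn_qjump hp dH ht' (cH.continuous_q ht') k s q)]
    have e : ∑ k, m.beta k t (q k) * (Gq k t q + -1 * Hq k t q) =
        (∑ k, m.beta k t (q k) * Gq k t q) - ∑ k, m.beta k t (q k) * Hq k t q := by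
      rw [← Finset.sum_sub_distrib]
      exact Finset.sum_congr rfl fun k _ => by ring
    rw [e]
    linear_combination eG t ht q - eH t ht q

/-! ### Passage between (E) and the three coefficient equations. -/

namespace Model

variable (m : Model)

/-- The system of equations for the coefficients of a quadratic solution. -/
def IsCoeffSystem (A B C : ℝ → (Pair → ℝ) → ℝ) : Prop :=
  IsCoeff m (2 * m.μx + m.σx ^ 2) (1 / 2 * m.σx ^ 2) m.srcXX A ∧
  IsCoeff m (2 * m.μy + m.σy ^ 2) (1 / 2 * m.σy ^ 2) m.srcYY B ∧
  IsCoeff m (m.μx + m.μy + m.ρ * m.σx * m.σy) (m.ρ * m.σx * m.σy) m.srcXY C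

theorem eq_zero_of_quad {u v w : ℝ}
    (h : ∀ x > 0, ∀ y > 0, x ^ 2 * u + y ^ 2 * v + x * y * w = 0) : u = 0 ∧ v = 0 ∧ w = 0 := by
  have h1 := h 1 one_pos 1 one_pos
  have h2 := h 2 two_pos 1 one_pos
  have h3 := h 1 one_pos 2 two_pos
  exact ⟨by linarith, by linarith, by linarith⟩

variable {m} {A B C : ℝ → (Pair → ℝ) → ℝ} {p : ℕ}

theorem IsCoeffSystem.isSolutionH1
    (hp : ∀ k s, Integrable (fun r : ℝ => r ^ p) (m.F k s)) (h : m.IsCoeffSystem A B C)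
    (dA : HasDeg m.T p A) (dB : HasDeg m.T p B) (dC : HasDeg m.T p C) :
    m.IsSolutionH1 (quad A B C) := by
  obtain ⟨⟨⟨At, Aq, cA, eA⟩, zA⟩, ⟨⟨Bt, Bq, cB, eB⟩, zB⟩, ⟨⟨Ct, Cq, cC, eC⟩, zC⟩⟩ := h
  have iA := fun k s t (ht : t ∈ Ico 0 m.T) q => m.integrableOn_qjump hp dA
    (Ico_subset_Icc_self ht) (cA.continuous_q (Ico_subset_Icc_self ht)) k s q
  have iB := fun k s t (ht : t ∈ Ico 0 m.T) q => m.integrableOn_qjump hp dB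
    (Ico_subset_Icc_self ht) (cB.continuous_q (Ico_subset_Icc_self ht)) k s q
  have iC := fun k s t (ht : t ∈ Ico 0 m.T) q => m.integrableOn_qjump hp dC
    (Ico_subset_Icc_self ht) (cC.continuous_q (Ico_subset_Icc_self ht)) k s q
  refine ⟨isRegular_quad cA cB cC, fun k s t ht x _ y _ q => ?_, fun t ht x hx y hy q => ?_,
    fun x _ y _ q => ?_⟩
  · have e : jump (quad A B C) k s t x y q = fun r => x ^ 2 * qjump A k s t q r +
        y ^ 2 * qjump B k s t q r + x * y * qjump C k s t q r := by
      funext r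
      simp only [jump, qjump, quad]
      ring
    rw [e]
    exact (((iA k s t ht q).const_mul _).fun_add ((iB k s t ht q).const_mul _)).fun_add
      ((iC k s t ht q).const_mul _)
  · rw [m.pideRHS_quad cA cB cC ht hx hy (fun k s => iA k s t ht q) (fun k s => iB k s t ht q)
      (fun k s => iC k s t ht q)]
    have hA : m.coeffLHS _ _ _ A At Aq t q = 0 := eA t ht q
    have hB : m.coeffLHS _ _ _ B Bt Bq t q = 0 := eB t ht q
    have hC : m.coeffLHS _ _ _ C Ct Cq t q = 0 := eC t ht q
    rw [hA, hB, hC]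
    ring
  · rw [quad, zA, zB, zC]
    ring

/-- The growth bounds make the jump integrals of each coefficient converge separately; then the
monomials `x ^ 2`, `y ^ 2`, `x * y` are linearly independent on the open quadrant. -/
theorem IsSolutionH1.isCoeffSystem
    (hp : ∀ k s, Integrable (fun r : ℝ => r ^ p) (m.F k s)) (h : m.IsSolutionH1 (quad A B C))
    (dA : HasDeg m.T p A) (dB : HasDeg m.T p B) (dC : HasDeg m.T p C) :
    m.IsCoeffSystem A B C := by
  obtain ⟨⟨At, Aq, cA⟩, ⟨Bt, Bq, cB⟩, ⟨Ct, Cq, cC⟩⟩ := h.regular.exists_isC1_quad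
  have hterm : ∀ q, A m.T q = 0 ∧ B m.T q = 0 ∧ C m.T q = 0 := fun q =>
    eq_zero_of_quad fun x hx y hy => by
      have := h.terminal x hx y hy q
      rw [quad] at this
      linarith
  have heq : ∀ t ∈ Ico 0 m.T, ∀ q, _ := fun t ht q => by
    have ht' := Ico_subset_Icc_self ht
    exact eq_zero_of_quad fun x hx y hy => (m.pideRHS_quad cA cB cC ht hx hy
      (fun k s => m.integrableOn_qjump hp dA ht' (cA.continuous_q ht') k s q)
      (fun k s => m.integrableOn_qjump hp dB ht' (cB.continuous_q ht') k s q)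
      (fun k s => m.integrableOn_qjump hp dC ht' (cC.continuous_q ht') k s q)).symm.trans
        (h.pide t ht x hx y hy q)
  exact ⟨⟨⟨At, Aq, cA, fun t ht q => (heq t ht q).1⟩, fun q => (hterm q).1⟩,
    ⟨⟨Bt, Bq, cB, fun t ht q => (heq t ht q).2.1⟩, fun q => (hterm q).2.1⟩,
    ⟨⟨Ct, Cq, cC, fun t ht q => (heq t ht q).2.2⟩, fun q => (hterm q).2.2⟩⟩

theorem hasGrowth_iff {p : ℕ} {H11 : ℝ → ℝ → ℝ → ℝ} {H12 : ℝ → ℝ → ℝ}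
    {H13 : ℝ → ℝ → ℝ → ℝ → ℝ} :
    m.HasGrowth p H11 H12 H13 ↔ HasDeg m.T p (fun t q => H11 t (q .x) (q .z)) ∧
      HasDeg m.T p (fun t q => H12 t (q .y)) ∧
      HasDeg m.T p (fun t q => H13 t (q .x) (q .y) (q .z)) := by
  have hs : ∀ q, qsize q = 1 + (|q .x| + |q .y| + |q .z|) := fun q => by rw [qsize, sum_pair]
  constructor
  · rintro ⟨C, h⟩
    have mono : ∀ {v u w : ℝ}, 0 ≤ u → u ≤ w → |v| ≤ C * u ^ p → |v| ≤ |C| * w ^ p :=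
      fun {v u w} hu huw hv => hv.trans <|
        mul_le_mul (le_abs_self C) (pow_le_pow_left₀ hu huw p) (by positivity) (abs_nonneg C)
    refine ⟨⟨|C|, abs_nonneg _, fun t ht q => ?_⟩, ⟨|C|, abs_nonneg _, fun t ht q => ?_⟩,
      ⟨|C|, abs_nonneg _, fun t ht q => ?_⟩⟩
    · refine mono (by positivity) ?_ (h t ht (q .x) (q .y) (q .z)).1
      rw [hs]
      linarith [abs_nonneg (q .y)]
    · refine mono (by positivity) ?_ (h t ht (q .x) (q .y) (q .z)).2.1
      rw [hs]
      linarith [abs_nonneg (q .x), abs_nonneg (q .z)]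
    · refine mono (by positivity) ?_ (h t ht (q .x) (q .y) (q .z)).2.2
      rw [hs]
      linarith
  · rintro ⟨⟨A, hA, a⟩, ⟨B, hB, b⟩, ⟨C, hC, c⟩⟩
    have mono : ∀ {v u D : ℝ}, 0 ≤ u → D ≤ A + B + C → |v| ≤ D * u ^ p →
        |v| ≤ (A + B + C) * u ^ p := fun hu hD hv =>
      hv.trans (mul_le_mul_of_nonneg_right hD (by positivity))
    refine ⟨A + B + C, fun t ht qx qy qz => ⟨?_, ?_, ?_⟩⟩
    · refine mono (by positivity) (by linarith : A ≤ _) ?_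
      -- The inventories that do not enter are set to zero, so that they do not count in `qsize`.
      have := a t ht (vec qx 0 qz)
      simpa [hs, vec, ← add_assoc] using this
    · refine mono (by positivity) (by linarith : B ≤ _) ?_
      have := b t ht (vec 0 qy 0)
      simpa [hs, vec, ← add_assoc] using this
    · refine mono (by positivity) (by linarith : C ≤ _) ?_
      have := c t ht (vec qx qy qz)
      simpa [hs, vec, ← add_assoc] using this

end Model

section Sources

variable {Ω : Type*} [MeasurableSpace Ω] {P : Measure Ω} [IsProbabilityMeasure P] {m : Model}
  {N : Pair → Side → ℝ≥0 → Ω → ℕ} {ξ : Pair → Side → ℕ → Ω → ℝ} {Q : Pair → ℝ → ℝ → ℝ → Ω → ℝ}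

theorem isSource_srcXX (hF : ∀ k s, Integrable (fun r : ℝ => r ^ 4) (m.F k s))
    (hflow : IsOrderFlow m P N ξ)
    (hQ : ∀ k, ∀ t ∈ Icc 0 m.T, ∀ q, IsAuxInventory m P N ξ k t q (Q k t q)) :
    IsSource m P Q m.srcXX := by
  have hxz := isSource_part_mul hflow hF hQ (k := .x) (l := .z) (by decide)
  -- The cross term of the square appears twice.
  refine (((isSource_part_sq hflow hF hQ .x).add (isSource_part_sq hflow hF hQ .z)).add
    (hxz.add hxz)).congr fun t q => ?_
  rw [Model.srcXX, Model.dxH0_eq]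
  ring

theorem isSource_srcYY (hF : ∀ k s, Integrable (fun r : ℝ => r ^ 4) (m.F k s))
    (hflow : IsOrderFlow m P N ξ)
    (hQ : ∀ k, ∀ t ∈ Icc 0 m.T, ∀ q, IsAuxInventory m P N ξ k t q (Q k t q)) :
    IsSource m P Q m.srcYY :=
  (isSource_part_sq hflow hF hQ .y).congr fun t q => by rw [Model.srcYY, Model.dyH0_eq]

theorem isSource_srcXY (hF : ∀ k s, Integrable (fun r : ℝ => r ^ 4) (m.F k s))
    (hflow : IsOrderFlow m P N ξ)
    (hQ : ∀ k, ∀ t ∈ Icc 0 m.T, ∀ q, IsAuxInventory m P N ξ k t q (Q k t q)) :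
    IsSource m P Q m.srcXY := by
  refine ((isSource_part_mul hflow hF hQ (k := .x) (l := .y) (by decide)).add
    (isSource_part_mul hflow hF hQ (k := .z) (l := .y) (by decide))).congr fun t q => ?_
  rw [Model.srcXY, Model.dxH0_eq, Model.dyH0_eq]
  ring

end Sources

end FX

end

theorem mainTheorem6 (m : FX.Model)
    (hF : ∀ k s, Integrable (fun r : ℝ => r ^ 4) (m.F k s))
    {Ω : Type*} [MeasurableSpace Ω] (P : Measure Ω) [IsProbabilityMeasure P]
    (N : FX.Pair → FX.Side → ℝ≥0 → Ω → ℕ) (ξ : FX.Pair → FX.Side → ℕ → Ω → ℝ)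
    (hflow : FX.IsOrderFlow m P N ξ)
    (Q : FX.Pair → ℝ → ℝ → ℝ → Ω → ℝ)
    (hQ : ∀ k, ∀ t ∈ Icc 0 m.T, ∀ q, FX.IsAuxInventory m P N ξ k t q (Q k t q)) :
    -- the expectations and the time integrals in the three formulas are finite
    (∀ t ∈ Icc 0 m.T, ∀ qx qy qz : ℝ,
      (∀ u ∈ Icc t m.T,
        Integrable (fun ω => (m.dxH0 u (Q .x t qx u ω) (Q .z t qz u ω)) ^ 2) P ∧
        Integrable (fun ω => (m.dyH0 u (Q .y t qy u ω)) ^ 2) P ∧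
        Integrable (fun ω =>
          m.dxH0 u (Q .x t qx u ω) (Q .z t qz u ω) * m.dyH0 u (Q .y t qy u ω)) P) ∧
      IntervalIntegrable (m.expXX P Q t qx qz) volume t m.T ∧
      IntervalIntegrable (m.expYY P Q t qy) volume t m.T ∧
      IntervalIntegrable (m.expXY P Q t qx qy qz) volume t m.T) ∧
    -- the formulas give a solution of the equation for `H₁`
    m.IsSolutionH1 (FX.Model.ansatz (m.repH11 P Q) (m.repH12 P Q) (m.repH13 P Q)) ∧
    m.HasGrowth 4 (m.repH11 P Q) (m.repH12 P Q) (m.repH13 P Q) ∧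
    -- every solution of the form of the ansatz is given by the formulas
    (∀ (H11 : ℝ → ℝ → ℝ → ℝ) (H12 : ℝ → ℝ → ℝ) (H13 : ℝ → ℝ → ℝ → ℝ → ℝ),
      m.IsSolutionH1 (FX.Model.ansatz H11 H12 H13) →
      (∃ p : ℕ, 4 ≤ p ∧ (∀ k s, Integrable (fun r : ℝ => r ^ p) (m.F k s)) ∧
        m.HasGrowth p H11 H12 H13) →
      ∀ t ∈ Icc 0 m.T, ∀ qx qy qz : ℝ,
        H11 t qx qz = m.repH11 P Q t qx qz ∧
        H12 t qy = m.repH12 P Q t qy ∧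
        H13 t qx qy qz = m.repH13 P Q t qx qy qz) := by
  have sXX := FX.isSource_srcXX hF hflow hQ
  have sYY := FX.isSource_srcYY hF hflow hQ
  have sXY := FX.isSource_srcXY hF hflow hQ
  obtain ⟨cXX, dXX⟩ := sXX.isCoeff hF (2 * m.μx + m.σx ^ 2) (1 / 2 * m.σx ^ 2)
  obtain ⟨cYY, dYY⟩ := sYY.isCoeff hF (2 * m.μy + m.σy ^ 2) (1 / 2 * m.σy ^ 2)
  obtain ⟨cXY, dXY⟩ := sXY.isCoeff hF (m.μx + m.μy + m.ρ * m.σx * m.σy) (m.ρ * m.σx * m.σy)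
  refine ⟨fun t ht qx qy qz => ?_, ?_, FX.Model.hasGrowth_iff.2 ⟨dXX, dYY, dXY⟩, ?_⟩
  · have fXX := sXX.finite ht (FX.vec qx qy qz)
    have fYY := sYY.finite ht (FX.vec qx qy qz)
    have fXY := sXY.finite ht (FX.vec qx qy qz)
    -- At `vec qx qy qz` the general source expectations are the three given ones by definition.
    exact ⟨fun u hu => ⟨fXX.1 u hu, fYY.1 u hu, fXY.1 u hu⟩, fXX.2, fYY.2, fXY.2⟩
  · exact FX.Model.IsCoeffSystem.isSolutionH1 hF ⟨cXX, cYY, cXY⟩ dXX dYY dXY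
  · rintro H11 H12 H13 hsol ⟨p, hp4, hp, hgrowth⟩ t ht qx qy qz
    obtain ⟨d11, d12, d13⟩ := FX.Model.hasGrowth_iff.1 hgrowth
    obtain ⟨c11, c12, c13⟩ := FX.Model.IsSolutionH1.isCoeffSystem hp hsol d11 d12 d13
    -- Since `4 ≤ p`, the representations also lie in the class of growth `p`, where uniqueness
    -- applies.
    exact ⟨c11.eq hp cXX d11 (dXX.mono hp4) ht (FX.vec qx qy qz),
      c12.eq hp cYY d12 (dYY.mono hp4) ht (FX.vec qx qy qz),
      c13.eq hp cXY d13 (dXY.mono hp4) ht (FX.vec qx qy qz)⟩
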